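/- Let $(M,\varphi,\xi,\eta,g)$ be a three-dimensional (connected, smooth) paracontact metric manifold. That is, $\varphi$ is a $(1,1)$-tensor field, $\xi$ a vector field and $\eta$ a one-form with $\varphi\xi=0$, $\eta\circ\varphi=0$, $\eta(\xi)=1$, $\varphi^2=\mathrm{Id}-\eta\otimes\xi$, such that the eigenbundles of $\varphi|_{\ker\eta}$ for the eigenvalues $1$ and $-1$ have equal rank; $g$ is a pseudo-Riemannian metric with $g(\varphi X,\varphi Y)=-g(X,Y)+\eta(X)\eta(Y)$; and $g(X,\varphi Y)=d\eta(X,Y)$, where $2\,d\eta(X,Y)=X(\eta(Y))-Y(\eta(X))-\eta([X,Y])$. Let $\varrho$ and $r$ denote the Ricci tensor and the scalar curvature of $g$. A local $\varphi$-basis is a local pseudo-orthonormal frame of smooth vector fields $\{\xi,e,\varphi e\}$ with $g(\xi,\xi)=g(e,e)=1$ and $g(\varphi e,\varphi e)=-1$. For every real number $\lambda$, the paracontact Ricci soliton equation $$\mathcal L_\xi g+\varrho=\lambda g$$ holds on $M$ if and only if $\lambda=-2$ and every point of $M$ has an open neighbourhood on which there are a $\varphi$-basis $\{\xi,e,\varphi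 e\}$, a constant $\varepsilon\in\{1,-1\}$ and smooth functions $a_1,a_3,a_4,a_5$ such that $$\begin{aligned} [\xi,e]&=-\varepsilon a_1e+(a_3-a_1+1)\varphi e,\\ [\xi,\varphi e]&=(a_3+a_1+1)e+\varepsilon a_1\varphi e,\\ [e,\varphi e]&=-2\xi+a_4e-a_5\varphi e, \end{aligned}$$ $$\begin{aligned} &\xi(a_4)-e(a_3)+\varepsilon a_1a_4-a_5(a_3-a_1+1)=0,\\ &\xi(a_5)-(\varphi e)(a_3)-\varepsilon a_1a_5-a_4(a_3+a_1+1)=0,\\ &(e+\varepsilon\varphi e)(a_1)+2\varepsilon a_1a_4+2a_1a_5=0, \end{aligned}$$ $$\xi(a_1)+2\varepsilon a_1a_3=2a_1,\qquad r=-6.$$ In particular, every three-dimensional paracontact Ricci soliton is expanding, that is, $\lambda<0$. -/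

import Mathlib

open scoped Manifold ContDiff Topology Bundle

noncomputable section

namespace Paracontact

/-! ### Classical tensor calculus in coordinates

`G x i j` are the components `g_ij` of a pseudo-Riemannian metric at the point `x` of (an open subset
of) `ℝⁿ`; the inverse matrix `(G x)⁻¹` has components `g^ij`. -/

section Coordinates

variable {n : ℕ}

/-- The partial derivative `∂_i f` at `x`. -/
def partialDeriv (i : Fin n) (f : EuclideanSpace ℝ (Fin n) → ℝ) (x : EuclideanSpace ℝ (Fin n)) : ℝ :=
  fderiv ℝ f x (EuclideanSpace.single i 1)

/-- The Christoffel symbols of the Levi-Civita connection, `∇_{∂_i} ∂_j = ∑ k, Γ^k_ij ∂_k`: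
`Γ^k_ij = 1/2 ∑ l, g^kl (∂_i g_jl + ∂_j g_il - ∂_l g_ij)`. -/
def christoffel (G : EuclideanSpace ℝ (Fin n) → Matrix (Fin n) (Fin n) ℝ) (k i j : Fin n)
    (x : EuclideanSpace ℝ (Fin n)) : ℝ :=
  (1 / 2 : ℝ) * ∑ l, (G x)⁻¹ k l *
    (partialDeriv i (fun y => G y j l) x + partialDeriv j (fun y => G y i l) x
      - partialDeriv l (fun y => G y i j) x)

/-- The components of the curvature tensor:
`∇_{∂_i} ∇_{∂_j} ∂_k - ∇_{∂_j} ∇_{∂_i} ∂_k = ∑ l, (riemann G l i j k) ∂_l`. -/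
def riemann (G : EuclideanSpace ℝ (Fin n) → Matrix (Fin n) (Fin n) ℝ) (l i j k : Fin n)
    (x : EuclideanSpace ℝ (Fin n)) : ℝ :=
  partialDeriv i (christoffel G l j k) x - partialDeriv j (christoffel G l i k) x
    + ∑ m, (christoffel G l i m x * christoffel G m j k x
      - christoffel G l j m x * christoffel G m i k x)

/-- The components of the Ricci tensor, `ϱ (∂_j, ∂_k) = tr (v ↦ R (v, ∂_j) ∂_k)` for
`R (u, v) = [∇_u, ∇_v] - ∇_[u, v]`; with this sign round spheres have positive Ricci curvature. -/
def ricciComp (G : EuclideanSpace ℝ (Fin n) → Matrix (Fin n) (Fin n) ℝ) (j k : Fin n)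
    (x : EuclideanSpace ℝ (Fin n)) : ℝ :=
  ∑ i, riemann G i i j k x

end Coordinates

/-! ### Tensors on a manifold

Tensors at a point `p` are computed in the preferred chart at `p`; the derivative of this chart at `p`
is the identification of `TangentSpace (𝓡 n) p` with `EuclideanSpace ℝ (Fin n)`. -/

section Manifold

variable {n : ℕ} {M : Type*} [TopologicalSpace M] [ChartedSpace (EuclideanSpace ℝ (Fin n)) M]

/-- The `i`-th component of a tangent vector at `p`, in the preferred chart at `p`. -/
def coord {p : M} (v : TangentSpace (𝓡 n) p) (i : Fin n) : ℝ :=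
  (show EuclideanSpace ℝ (Fin n) from v) i

/-- The derivative at `x` of the inverse of the chart at `p`: it sends a coordinate vector at `x` to
the tangent vector that it represents. -/
def chartFrame (p : M) (x : EuclideanSpace ℝ (Fin n)) :
    EuclideanSpace ℝ (Fin n) →L[ℝ] TangentSpace (𝓡 n) ((extChartAt (𝓡 n) p).symm x) :=
  mfderiv (𝓡 n) (𝓡 n) (extChartAt (𝓡 n) p).symm x

/-- The component `X^k` of a vector field in the chart at `p`. -/
def vectorInChart (X : (q : M) → TangentSpace (𝓡 n) q) (p : M) (k : Fin n)
    (x : EuclideanSpace ℝ (Fin n)) : ℝ :=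
  ((chartFrame p x).inverse (X ((extChartAt (𝓡 n) p).symm x))) k

/-- The component `η_i` of a one-form in the chart at `p`. -/
def formInChart (η : (q : M) → TangentSpace (𝓡 n) q →L[ℝ] ℝ) (p : M) (i : Fin n)
    (x : EuclideanSpace ℝ (Fin n)) : ℝ :=
  η ((extChartAt (𝓡 n) p).symm x) (chartFrame p x (EuclideanSpace.single i 1))

/-- The matrix `g_ij` of a field of bilinear forms in the chart at `p`. -/
def bilinInChart
    (g : (q : M) → TangentSpace (𝓡 n) q →L[ℝ] TangentSpace (𝓡 n) q →L[ℝ] ℝ) (p : M)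
    (x : EuclideanSpace ℝ (Fin n)) : Matrix (Fin n) (Fin n) ℝ :=
  Matrix.of fun i j => g ((extChartAt (𝓡 n) p).symm x)
    (chartFrame p x (EuclideanSpace.single i 1)) (chartFrame p x (EuclideanSpace.single j 1))

/-- The exterior derivative of a one-form, normalized by
`2 dη (X, Y) = X (η Y) - Y (η X) - η [X, Y]`, so that `(dη)_ij = 1/2 (∂_i η_j - ∂_j η_i)`. -/
def extDerivForm (η : (q : M) → TangentSpace (𝓡 n) q →L[ℝ] ℝ) (p : M)
    (v w : TangentSpace (𝓡 n) p) : ℝ :=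
  ∑ i, ∑ j, coord v i * coord w j * ((1 / 2 : ℝ) *
    (partialDeriv i (formInChart η p j) (extChartAt (𝓡 n) p p)
      - partialDeriv j (formInChart η p i) (extChartAt (𝓡 n) p p)))

/-- The Lie derivative `(L_X g) (v, w)` at `p` of a field of bilinear forms along a vector field:
`(L_X g)_ij = ∑ k, (X^k ∂_k g_ij + g_kj ∂_i X^k + g_ik ∂_j X^k)`. -/
def lieDerivBilin (X : (q : M) → TangentSpace (𝓡 n) q)
    (g : (q : M) → TangentSpace (𝓡 n) q →L[ℝ] TangentSpace (𝓡 n) q →L[ℝ] ℝ) (p : M)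
    (v w : TangentSpace (𝓡 n) p) : ℝ :=
  let x₀ := extChartAt (𝓡 n) p p
  ∑ i, ∑ j, coord v i * coord w j * ∑ k,
    (vectorInChart X p k x₀ * partialDeriv k (fun x => bilinInChart g p x i j) x₀
      + bilinInChart g p x₀ k j * partialDeriv i (vectorInChart X p k) x₀
      + bilinInChart g p x₀ i k * partialDeriv j (vectorInChart X p k) x₀)

/-- The derivative at `p` of a function in the direction of a tangent vector. -/
def dirDeriv (a : M → ℝ) {p : M} (v : TangentSpace (𝓡 n) p) : ℝ :=
  NormedSpace.fromTangentSpace (𝕜 := ℝ) (a p) (mfderiv (𝓡 n) 𝓘(ℝ, ℝ) a p v)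

variable (n M) in
/-- A smooth pseudo-Riemannian metric (of any signature). -/
structure PseudoMetric [IsManifold (𝓡 n) ∞ M] where
  /-- The scalar product on each tangent space. -/
  val (p : M) : TangentSpace (𝓡 n) p →L[ℝ] TangentSpace (𝓡 n) p →L[ℝ] ℝ
  symm (p : M) (v w : TangentSpace (𝓡 n) p) : val p v w = val p w v
  nondegenerate (p : M) (v : TangentSpace (𝓡 n) p) : (∀ w, val p v w = 0) → v = 0
  smooth : ContMDiff (𝓡 n) ((𝓡 n).prod 𝓘(ℝ, EuclideanSpace ℝ (Fin n) →L[ℝ] EuclideanSpace ℝ (Fin n) →L[ℝ] ℝ)) ∞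
    (fun p => Bundle.TotalSpace.mk' (EuclideanSpace ℝ (Fin n) →L[ℝ] EuclideanSpace ℝ (Fin n) →L[ℝ] ℝ)
      (E := fun q : M => TangentSpace (𝓡 n) q →L[ℝ] TangentSpace (𝓡 n) q →L[ℝ] ℝ) p (val p))

variable [IsManifold (𝓡 n) ∞ M]

/-- The Ricci tensor `ϱ` of a pseudo-Riemannian metric. -/
def PseudoMetric.ricci (g : PseudoMetric n M) (p : M) (v w : TangentSpace (𝓡 n) p) : ℝ :=
  ∑ i, ∑ j, coord v i * coord w j * ricciComp (bilinInChart g.val p) i j (extChartAt (𝓡 n) p p)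

/-- The scalar curvature `r = ∑ i j, g^ij ϱ_ij` of a pseudo-Riemannian metric. -/
def PseudoMetric.scalarCurvature (g : PseudoMetric n M) (p : M) : ℝ :=
  ∑ i, ∑ j, (bilinInChart g.val p (extChartAt (𝓡 n) p p))⁻¹ i j *
    ricciComp (bilinInChart g.val p) i j (extChartAt (𝓡 n) p p)

variable (n M) in
/-- An almost paracontact metric structure `(φ, ξ, η, g)`. -/
structure AlmostParacontactMetric where
  /-- The (1,1)-tensor. -/
  φ (p : M) : TangentSpace (𝓡 n) p →L[ℝ] TangentSpace (𝓡 n) p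
  /-- The Reeb vector field. -/
  ξ (p : M) : TangentSpace (𝓡 n) p
  /-- The one-form. -/
  η (p : M) : TangentSpace (𝓡 n) p →L[ℝ] ℝ
  /-- The metric. -/
  g : PseudoMetric n M
  smooth_φ : ContMDiff (𝓡 n) ((𝓡 n).prod 𝓘(ℝ, EuclideanSpace ℝ (Fin n) →L[ℝ] EuclideanSpace ℝ (Fin n))) ∞
    (fun p => Bundle.TotalSpace.mk' (EuclideanSpace ℝ (Fin n) →L[ℝ] EuclideanSpace ℝ (Fin n))
      (E := fun q : M => TangentSpace (𝓡 n) q →L[ℝ] TangentSpace (𝓡 n) q) p (φ p))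
  smooth_ξ : ContMDiff (𝓡 n) (𝓡 n).tangent ∞
    (fun p => (⟨p, ξ p⟩ : TangentBundle (𝓡 n) M))
  smooth_η : ContMDiff (𝓡 n) ((𝓡 n).prod 𝓘(ℝ, EuclideanSpace ℝ (Fin n) →L[ℝ] ℝ)) ∞
    (fun p => Bundle.TotalSpace.mk' (EuclideanSpace ℝ (Fin n) →L[ℝ] ℝ)
      (E := fun q : M => TangentSpace (𝓡 n) q →L[ℝ] ℝ) p (η p))
  φ_ξ (p : M) : φ p (ξ p) = 0
  η_φ (p : M) (v : TangentSpace (𝓡 n) p) : η p (φ p v) = 0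
  η_ξ (p : M) : η p (ξ p) = 1
  φ_φ (p : M) (v : TangentSpace (𝓡 n) p) : φ p (φ p v) = v - η p v • ξ p
  /-- The eigenspaces of `φ` on `ker η` for `1` and `-1` have equal dimension. -/
  paracomplex (p : M) :
    Module.finrank ℝ ↥((η p).toLinearMap.ker ⊓ Module.End.eigenspace (φ p).toLinearMap 1) =
      Module.finrank ℝ ↥((η p).toLinearMap.ker ⊓ Module.End.eigenspace (φ p).toLinearMap (-1))
  compatible (p : M) (v w : TangentSpace (𝓡 n) p) :
    g.val p (φ p v) (φ p w) = - g.val p v w + η p v * η p w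

namespace AlmostParacontactMetric

variable (S : AlmostParacontactMetric n M)

/-- `(φ, ξ, η, g)` is a paracontact metric structure: the fundamental 2-form
`Φ (X, Y) = g (X, φ Y)` is equal to `dη`. -/
def IsParacontactMetric : Prop :=
  ∀ (p : M) (v w : TangentSpace (𝓡 n) p), S.g.val p v (S.φ p w) = extDerivForm S.η p v w

/-- The Reeb vector field satisfies the Ricci soliton equation `L_ξ g + ϱ = lam g`. -/
def IsReebSoliton (lam : ℝ) : Prop :=
  ∀ (p : M) (v w : TangentSpace (𝓡 n) p),
    lieDerivBilin S.ξ S.g.val p v w + S.g.ricci p v w = lam * S.g.val p v w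

/-- The vector field `φ X`. -/
def applyφ (X : (q : M) → TangentSpace (𝓡 n) q) (q : M) : TangentSpace (𝓡 n) q :=
  S.φ q (X q)

/-- `{ξ, e, φ e}` is a smooth φ-basis on `U` (of a three-dimensional manifold): it is
pseudo-orthonormal, with `ξ, e` space-like and `φ e` time-like. -/
structure IsPhiBasisOn (e : (q : M) → TangentSpace (𝓡 n) q) (U : Set M) : Prop where
  smooth : ContMDiffOn (𝓡 n) (𝓡 n).tangent ∞
    (fun q => (⟨q, e q⟩ : TangentBundle (𝓡 n) M)) U
  ξ_ξ : ∀ q ∈ U, S.g.val q (S.ξ q) (S.ξ q) = 1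
  e_e : ∀ q ∈ U, S.g.val q (e q) (e q) = 1
  φe_φe : ∀ q ∈ U, S.g.val q (S.φ q (e q)) (S.φ q (e q)) = -1
  ξ_e : ∀ q ∈ U, S.g.val q (S.ξ q) (e q) = 0
  ξ_φe : ∀ q ∈ U, S.g.val q (S.ξ q) (S.φ q (e q)) = 0
  e_φe : ∀ q ∈ U, S.g.val q (e q) (S.φ q (e q)) = 0

end AlmostParacontactMetric

end Manifold

end Paracontact

end

/-! In a φ-basis ξ, e, f = φe the condition g(X, φY) = dη(X, Y) fixes the ξ-components of the
brackets, and the Jacobi identity leaves five functions: [ξ,e] = A e + (s+1+b) f, [ξ,f] = (s+1−b) e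
− A f, [e,f] = −2ξ + a₄ e − a₅ f. The brackets determine the Levi-Civita connection and hence the
curvature (`frameRicci_eq`), and the only nonzero components of L_ξ g are −2A and 2b. So the soliton
equation becomes (`soliton_iff`): λ = −2(A² − b² + 1), ξA + 2bs = 2A, ξb + 2As = 2b, two equations
for derivatives of A and b along e and f, and a value for ϱ(e,e), equivalent to one for r.

The first of these makes A² − b² constant, while the next two give ξ(A² − b²) = 4(A² − b²). Hence A²
= b² and λ = −2 (`sq_eq_sq`, `lam_eq`).

Now A = ±b at each point, and the difficulty is that the sign might change across common zeros. Put
u = A + b and w = b − A, so uw = 0. The equations make u solve linear homogeneous ODEs along ξ and e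
+ f, and w one along e − f. Heuristically, nonvanishing of u spreads over a surface and nonvanishing
of w along a curve transversal to it; if both occurred arbitrarily close to a point, surface and
curve would meet, against uw = 0. `eventually_eq_zero_or_eventually_eq_zero` proves this without
flows by doubling variables: a maximum point (x, y) of u(x)² w(y)² exp(−2Kψ), where ψ is |x − y|
plus quadratic penalties, forces x − y to be almost orthogonal to three independent directions.

Once A = εb near a point, a₁ = −b and a₃ = s give the stated brackets, and the constraints are
Jacobi identities and soliton equations combined. Conversely, the stated equations return every
frame component of the soliton equation. -/

noncomputable section

namespace Paracontact

/-! ### Connections on a vector space and their curvature. -/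

section AffineConnection

variable {E : Type*} [NormedAddCommGroup E] [NormedSpace ℝ E]

/-- The covariant derivative `∇_V W` of vector fields on a vector space, with connection
coefficients `Γ`. -/
def covDeriv (Γ : E → E →L[ℝ] E →L[ℝ] E) (V W : E → E) (x : E) : E :=
  fderiv ℝ W x (V x) + Γ x (V x) (W x)

/-- The curvature `R (u, v) w` of the connection with coefficients `Γ`. -/
def curvature (Γ : E → E →L[ℝ] E →L[ℝ] E) (x u v w : E) : E :=
  fderiv ℝ Γ x u v w - fderiv ℝ Γ x v u w + Γ x u (Γ x v w) - Γ x v (Γ x u w)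

variable {Γ : E → E →L[ℝ] E →L[ℝ] E} {X Y Z W : E → E} {f : E → ℝ} {x : E}

theorem ContDiffAt.differentiableAt_of_infty {F : Type*} [NormedAddCommGroup F] [NormedSpace ℝ F]
    {g : E → F} (hg : ContDiffAt ℝ ∞ g x) : DifferentiableAt ℝ g x :=
  hg.differentiableAt (by simp)

theorem contDiffAt_fderiv_of_infty {F : Type*} [NormedAddCommGroup F] [NormedSpace ℝ F]
    {g : E → F} (hg : ContDiffAt ℝ ∞ g x) : ContDiffAt ℝ ∞ (fderiv ℝ g) x :=
  hg.fderiv_right (by simp)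

theorem contDiffAt_covDeriv (hΓ : ContDiffAt ℝ ∞ Γ x) (hX : ContDiffAt ℝ ∞ X x)
    (hY : ContDiffAt ℝ ∞ Y x) : ContDiffAt ℝ ∞ (covDeriv Γ X Y) x :=
  ((contDiffAt_fderiv_of_infty hY).clm_apply hX).add ((hΓ.clm_apply hX).clm_apply hY)

theorem covDeriv_add (hY : DifferentiableAt ℝ Y x) (hZ : DifferentiableAt ℝ Z x) :
    covDeriv Γ X (fun y => Y y + Z y) x = covDeriv Γ X Y x + covDeriv Γ X Z x := by
  simp only [covDeriv]
  rw [fderiv_fun_add hY hZ]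
  simp only [add_apply, map_add]
  abel

theorem covDeriv_smul (hf : DifferentiableAt ℝ f x) (hY : DifferentiableAt ℝ Y x) :
    covDeriv Γ X (fun y => f y • Y y) x = fderiv ℝ f x (X x) • Y x + f x • covDeriv Γ X Y x := by
  simp only [covDeriv]
  rw [fderiv_fun_smul hf hY]
  simp only [add_apply, smul_apply, ContinuousLinearMap.smulRight_apply, map_smul, smul_add]
  abel

theorem covDeriv_smul_add_smul {g : E → ℝ} (hf : DifferentiableAt ℝ f x)
    (hg : DifferentiableAt ℝ g x) (hY : DifferentiableAt ℝ Y x) (hZ : DifferentiableAt ℝ Z x) :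
    covDeriv Γ X (fun y => f y • Y y + g y • Z y) x =
      fderiv ℝ f x (X x) • Y x + f x • covDeriv Γ X Y x
        + (fderiv ℝ g x (X x) • Z x + g x • covDeriv Γ X Z x) := by
  rw [covDeriv_add (hf.fun_smul hY) (hg.fun_smul hZ), covDeriv_smul hf hY, covDeriv_smul hg hZ]

theorem covDeriv_congr (h : Y =ᶠ[𝓝 x] Z) : covDeriv Γ X Y x = covDeriv Γ X Z x := by
  simp only [covDeriv, h.fderiv_eq, h.eq_of_nhds]

/-- If `V x` is a combination of values of vector fields, so is `∇_V W` at `x`. -/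
theorem covDeriv_of_eq {a b c : ℝ} (h : X x = a • Y x + b • Z x + c • W x) (V : E → E) :
    covDeriv Γ X V x = a • covDeriv Γ Y V x + b • covDeriv Γ Z V x + c • covDeriv Γ W V x := by
  simp only [covDeriv, h, map_add, map_smul, add_apply, smul_apply, smul_add]
  abel

theorem covDeriv_sub_covDeriv (hΓ : ∀ u v, Γ x u v = Γ x v u) :
    covDeriv Γ X Y x - covDeriv Γ Y X x = VectorField.lieBracket ℝ X Y x := by
  simp only [covDeriv, VectorField.lieBracket, hΓ (Y x) (X x)]
  abel

theorem fderiv_covDeriv (hΓ : ContDiffAt ℝ ∞ Γ x) (hX : ContDiffAt ℝ ∞ X x)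
    (hY : ContDiffAt ℝ ∞ Y x) (v : E) :
    fderiv ℝ (covDeriv Γ X Y) x v =
      fderiv ℝ (fderiv ℝ Y) x v (X x) + fderiv ℝ Y x (fderiv ℝ X x v)
        + (fderiv ℝ Γ x v (X x) (Y x) + Γ x (fderiv ℝ X x v) (Y x)
          + Γ x (X x) (fderiv ℝ Y x v)) := by
  have h1 := (ContDiffAt.differentiableAt_of_infty (contDiffAt_fderiv_of_infty hY)).hasFDerivAt
  have hX' := (ContDiffAt.differentiableAt_of_infty hX).hasFDerivAt
  have hY' := (ContDiffAt.differentiableAt_of_infty hY).hasFDerivAt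
  have hΓ' := (ContDiffAt.differentiableAt_of_infty hΓ).hasFDerivAt
  have h := (h1.clm_apply hX').add ((hΓ'.clm_apply hX').clm_apply hY')
  have h2 : fderiv ℝ (covDeriv Γ X Y) x = _ := h.fderiv
  rw [h2]
  simp
  abel

/-- In the commutator the second derivatives of `Z` cancel by Schwarz's theorem, and the first
derivatives of `X` and `Y` are absorbed by the bracket term; torsion plays no role. -/
theorem curvature_eq_covDeriv (hΓ : ContDiffAt ℝ ∞ Γ x) (hX : ContDiffAt ℝ ∞ X x)
    (hY : ContDiffAt ℝ ∞ Y x) (hZ : ContDiffAt ℝ ∞ Z x) :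
    curvature Γ x (X x) (Y x) (Z x) =
      covDeriv Γ X (covDeriv Γ Y Z) x - covDeriv Γ Y (covDeriv Γ X Z) x
        - covDeriv Γ (VectorField.lieBracket ℝ X Y) Z x := by
  have hs : fderiv ℝ (fderiv ℝ Z) x (X x) (Y x) = fderiv ℝ (fderiv ℝ Z) x (Y x) (X x) :=
    (hZ.isSymmSndFDerivAt (by simpa using WithTop.coe_le_coe.2 (le_top : (2 : ℕ∞) ≤ ⊤))) (X x) (Y x)
  have e1 := fderiv_covDeriv hΓ hY hZ (X x)
  have e2 := fderiv_covDeriv hΓ hX hZ (Y x)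
  have e1' : covDeriv Γ X (covDeriv Γ Y Z) x =
    fderiv ℝ (covDeriv Γ Y Z) x (X x) + Γ x (X x) (covDeriv Γ Y Z x) := rfl
  have e2' : covDeriv Γ Y (covDeriv Γ X Z) x =
    fderiv ℝ (covDeriv Γ X Z) x (Y x) + Γ x (Y x) (covDeriv Γ X Z x) := rfl
  rw [e1', e2', e1, e2]
  simp only [covDeriv, VectorField.lieBracket, curvature, map_add, map_sub, sub_apply, hs]
  abel

theorem curvature_swap (u v w : E) : curvature Γ x u v w = - curvature Γ x v u w := by
  simp only [curvature]
  abel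

/-- The first Bianchi identity. -/
theorem curvature_cyclic (hΓ : ContDiffAt ℝ ∞ Γ x) (h : ∀ᶠ y in 𝓝 x, ∀ u v, Γ y u v = Γ y v u)
    (u v w : E) : curvature Γ x u v w + curvature Γ x v w u + curvature Γ x w u v = 0 := by
  -- Symmetry of `Γ` on a neighbourhood passes to its derivative; this is why the hypothesis is not
  -- just at `x`.
  have hd : ∀ a b c, fderiv ℝ Γ x a b c = fderiv ℝ Γ x a c b := by
    intro a b c
    have hd' := (ContDiffAt.differentiableAt_of_infty hΓ).hasFDerivAt
    have e : ∀ p q, fderiv ℝ (fun y => Γ y p q) x a = fderiv ℝ Γ x a p q := fun p q => by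
      rw [((hd'.clm_apply (hasFDerivAt_const p x)).clm_apply (hasFDerivAt_const q x)).fderiv]
      simp only [add_apply, ContinuousLinearMap.comp_apply, ContinuousLinearMap.flip_apply,
        zero_apply, map_zero, zero_add]
    have e3 : (fun y => Γ y b c) =ᶠ[𝓝 x] fun y => Γ y c b := h.mono fun y hy => hy b c
    rw [← e, ← e, e3.fderiv_eq]
  have hx := h.self_of_nhds
  simp only [curvature, hd u w v, hd v u w, hd w v u, hx w v, hx u w, hx v u]
  abel

end AffineConnection

/-! ### Parallel bilinear forms and skewness of the curvature. -/

section Metric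

variable {E : Type*} [NormedAddCommGroup E] [NormedSpace ℝ E]

/-- `Γ` are the connection coefficients of a torsion-free connection on `Ω` for which the field of
symmetric bilinear forms `B` is parallel. -/
structure IsLeviCivitaOn (B : E → E →L[ℝ] E →L[ℝ] ℝ) (Γ : E → E →L[ℝ] E →L[ℝ] E) (Ω : Set E) :
    Prop where
  isOpen : IsOpen Ω
  contDiff_form : ∀ x ∈ Ω, ContDiffAt ℝ ∞ B x
  contDiff_coeff : ∀ x ∈ Ω, ContDiffAt ℝ ∞ Γ x
  form_symm : ∀ x ∈ Ω, ∀ u v, B x u v = B x v u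
  coeff_symm : ∀ x ∈ Ω, ∀ u v, Γ x u v = Γ x v u
  parallel : ∀ x ∈ Ω, ∀ u v w, fderiv ℝ B x u v w = B x (Γ x u v) w + B x v (Γ x u w)

variable {B : E → E →L[ℝ] E →L[ℝ] ℝ} {Γ : E → E →L[ℝ] E →L[ℝ] E} {Ω : Set E} {x : E}
  {X Y Z W : E → E}

theorem fderiv_form (hB : DifferentiableAt ℝ B x) (hY : DifferentiableAt ℝ Y x)
    (hZ : DifferentiableAt ℝ Z x) (u : E) :
    fderiv ℝ (fun y => B y (Y y) (Z y)) x u =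
      fderiv ℝ B x u (Y x) (Z x) + B x (fderiv ℝ Y x u) (Z x) + B x (Y x) (fderiv ℝ Z x u) := by
  rw [((hB.hasFDerivAt.clm_apply hY.hasFDerivAt).clm_apply hZ.hasFDerivAt).fderiv]
  simp
  abel

theorem IsLeviCivitaOn.fderiv_form (h : IsLeviCivitaOn B Γ Ω) (hx : x ∈ Ω)
    (hY : DifferentiableAt ℝ Y x) (hZ : DifferentiableAt ℝ Z x) :
    fderiv ℝ (fun y => B y (Y y) (Z y)) x (X x) =
      B x (covDeriv Γ X Y x) (Z x) + B x (Y x) (covDeriv Γ X Z x) := by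
  rw [Paracontact.fderiv_form (ContDiffAt.differentiableAt_of_infty (h.contDiff_form x hx)) hY hZ,
    h.parallel x hx]
  simp only [covDeriv, map_add, add_apply]
  ring

theorem IsLeviCivitaOn.form_covDeriv_of_const (h : IsLeviCivitaOn B Γ Ω) (hx : x ∈ Ω)
    (hY : DifferentiableAt ℝ Y x) (hZ : DifferentiableAt ℝ Z x) {c : ℝ}
    (hc : ∀ y ∈ Ω, B y (Y y) (Z y) = c) :
    B x (covDeriv Γ X Y x) (Z x) + B x (Y x) (covDeriv Γ X Z x) = 0 := by
  rw [← h.fderiv_form hx hY hZ]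
  have : (fun y => B y (Y y) (Z y)) =ᶠ[𝓝 x] fun _ => c :=
    Filter.eventually_of_mem (h.isOpen.mem_nhds hx) hc
  rw [this.fderiv_eq]
  simp

/-- Differentiating the constant `B Z W` twice, in both orders, and subtracting makes the mixed
terms cancel. Constancy of this one product suffices, which is the situation of frame fields. -/
theorem IsLeviCivitaOn.form_curvature_of_const (h : IsLeviCivitaOn B Γ Ω) (hx : x ∈ Ω)
    (hX : ∀ y ∈ Ω, ContDiffAt ℝ ∞ X y) (hY : ∀ y ∈ Ω, ContDiffAt ℝ ∞ Y y)
    (hZ : ∀ y ∈ Ω, ContDiffAt ℝ ∞ Z y) (hW : ∀ y ∈ Ω, ContDiffAt ℝ ∞ W y) {c : ℝ}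
    (hc : ∀ y ∈ Ω, B y (Z y) (W y) = c) :
    B x (curvature Γ x (X x) (Y x) (Z x)) (W x) =
      - B x (Z x) (curvature Γ x (X x) (Y x) (W x)) := by
  have hΓ := h.contDiff_coeff
  have key : ∀ {P Q : E → E}, (∀ y ∈ Ω, ContDiffAt ℝ ∞ P y) → (∀ y ∈ Ω, ContDiffAt ℝ ∞ Q y) →
      B x (covDeriv Γ P (covDeriv Γ Q Z) x) (W x) + B x (covDeriv Γ Q Z x) (covDeriv Γ P W x)
        + (B x (covDeriv Γ P Z x) (covDeriv Γ Q W x)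
          + B x (Z x) (covDeriv Γ P (covDeriv Γ Q W) x)) = 0 := by
    intro P Q hP hQ
    have hQZ := ContDiffAt.differentiableAt_of_infty
      (contDiffAt_covDeriv (hΓ x hx) (hQ x hx) (hZ x hx))
    have hQW := ContDiffAt.differentiableAt_of_infty
      (contDiffAt_covDeriv (hΓ x hx) (hQ x hx) (hW x hx))
    have hZ' := ContDiffAt.differentiableAt_of_infty (hZ x hx)
    have hW' := ContDiffAt.differentiableAt_of_infty (hW x hx)
    have hB := ContDiffAt.differentiableAt_of_infty (h.contDiff_form x hx)
    rw [← h.fderiv_form hx hQZ hW', ← h.fderiv_form hx hZ' hQW]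
    have e : (fun y => B y (covDeriv Γ Q Z y) (W y)) =ᶠ[𝓝 x]
        fun y => - B y (Z y) (covDeriv Γ Q W y) := by
      filter_upwards [h.isOpen.mem_nhds hx] with y hy
      have := h.form_covDeriv_of_const (X := Q) hy
        (ContDiffAt.differentiableAt_of_infty (hZ y hy))
        (ContDiffAt.differentiableAt_of_infty (hW y hy)) hc
      linarith
    rw [e.fderiv_eq, fderiv_fun_neg]
    simp
  have k1 := key hX hY
  have k2 := key hY hX
  have k3 := h.form_covDeriv_of_const (X := VectorField.lieBracket ℝ X Y) hx
    (ContDiffAt.differentiableAt_of_infty (hZ x hx))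
    (ContDiffAt.differentiableAt_of_infty (hW x hx)) hc
  rw [curvature_eq_covDeriv (hΓ x hx) (hX x hx) (hY x hx) (hZ x hx),
    curvature_eq_covDeriv (hΓ x hx) (hX x hx) (hY x hx) (hW x hx)]
  simp only [map_sub, sub_apply]
  linarith

end Metric

/-! ### Connection, Ricci curvature and Jacobi identity of a φ-frame. -/

section PhiFrame

variable {E : Type*} [NormedAddCommGroup E] [NormedSpace ℝ E]

/-- The algebraic identity behind the pair symmetry of curvature tensors. -/
theorem pair_symm_of_cyclic {ι : Type*} {R : ι → ι → ι → ι → ℝ}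
    (h₁ : ∀ i j k l, R i j k l = - R j i k l) (h₂ : ∀ i j k l, R i j k l = - R i j l k)
    (h₃ : ∀ i j k l, R i j k l + R j k i l + R k i j l = 0) (i j k l : ι) :
    R i j k l = R k l i j := by
  -- The octahedron argument: in a signed sum of the four cyclic identities for the rotations of `i
  -- j k l`, the antisymmetries cancel everything but twice the two sides.
  linarith [h₃ i j k l, h₃ j k l i, h₃ k l i j, h₃ l i j k, h₂ j k i l, h₂ k i j l, h₂ k l j i,
    h₁ l j k i, h₂ j l k i, h₂ l i k j, h₁ i k l j, h₂ k i l j, h₂ i j l k, h₁ j l i k,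
    h₁ l i j k, h₂ i l j k, h₂ i j k l, h₂ l j k i, h₂ l i j k, h₁ l i k j, h₂ j k l i,
    h₁ i k j l, h₁ l j i k, h₂ l j i k, h₂ j l i k, h₂ i k l j, h₂ i k j l]

/-- `ξ, e, f` is a pseudo-orthonormal frame on `Ω`, with `f` time-like, whose Lie brackets are those
of a φ-basis of a three-dimensional paracontact metric manifold. -/
structure IsPhiFrameOn (B : E → E →L[ℝ] E →L[ℝ] ℝ) (Ω : Set E) (ξ e f : E → E)
    (A b s a₄ a₅ : E → ℝ) : Prop where
  contDiff_ξ : ∀ x ∈ Ω, ContDiffAt ℝ ∞ ξ x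
  contDiff_e : ∀ x ∈ Ω, ContDiffAt ℝ ∞ e x
  contDiff_f : ∀ x ∈ Ω, ContDiffAt ℝ ∞ f x
  contDiff_A : ∀ x ∈ Ω, ContDiffAt ℝ ∞ A x
  contDiff_b : ∀ x ∈ Ω, ContDiffAt ℝ ∞ b x
  contDiff_s : ∀ x ∈ Ω, ContDiffAt ℝ ∞ s x
  contDiff_a₄ : ∀ x ∈ Ω, ContDiffAt ℝ ∞ a₄ x
  contDiff_a₅ : ∀ x ∈ Ω, ContDiffAt ℝ ∞ a₅ x
  ξ_ξ : ∀ x ∈ Ω, B x (ξ x) (ξ x) = 1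
  e_e : ∀ x ∈ Ω, B x (e x) (e x) = 1
  f_f : ∀ x ∈ Ω, B x (f x) (f x) = -1
  ξ_e : ∀ x ∈ Ω, B x (ξ x) (e x) = 0
  ξ_f : ∀ x ∈ Ω, B x (ξ x) (f x) = 0
  e_f : ∀ x ∈ Ω, B x (e x) (f x) = 0
  span : ∀ x ∈ Ω, ∀ v, v = B x v (ξ x) • ξ x + B x v (e x) • e x + (-B x v (f x)) • f x
  bracket_ξ_e : ∀ x ∈ Ω, VectorField.lieBracket ℝ ξ e x = A x • e x + (s x + 1 + b x) • f x
  bracket_ξ_f : ∀ x ∈ Ω, VectorField.lieBracket ℝ ξ f x = (s x + 1 - b x) • e x - A x • f x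
  bracket_e_f : ∀ x ∈ Ω, VectorField.lieBracket ℝ e f x =
    (-2 : ℝ) • ξ x + a₄ x • e x - a₅ x • f x

variable {B : E → E →L[ℝ] E →L[ℝ] ℝ} {Γ : E → E →L[ℝ] E →L[ℝ] E} {Ω : Set E}
  {ξ e f : E → E} {A b s a₄ a₅ : E → ℝ} {x : E}

/-- The Levi-Civita connection in a φ-basis. -/
theorem IsPhiFrameOn.covDeriv_frame (hF : IsPhiFrameOn B Ω ξ e f A b s a₄ a₅)
    (h : IsLeviCivitaOn B Γ Ω) (hx : x ∈ Ω) :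
    covDeriv Γ ξ ξ x = 0 ∧ covDeriv Γ e ξ x = (-A x) • e x + (-(b x + 1)) • f x ∧
    covDeriv Γ f ξ x = (b x - 1) • e x + A x • f x ∧
    covDeriv Γ ξ e x = s x • f x ∧ covDeriv Γ ξ f x = s x • e x ∧
    covDeriv Γ e e x = A x • ξ x + a₄ x • f x ∧
    covDeriv Γ e f x = (-(b x + 1)) • ξ x + a₄ x • e x ∧
    covDeriv Γ f e x = (1 - b x) • ξ x + a₅ x • f x ∧
    covDeriv Γ f f x = A x • ξ x + a₅ x • e x := by
  have dξ := ContDiffAt.differentiableAt_of_infty (hF.contDiff_ξ x hx)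
  have de := ContDiffAt.differentiableAt_of_infty (hF.contDiff_e x hx)
  have df := ContDiffAt.differentiableAt_of_infty (hF.contDiff_f x hx)
  have sy := h.form_symm x hx
  have k1 := hF.ξ_ξ x hx
  have k2 := hF.e_e x hx
  have k3 := hF.f_f x hx
  have k4 := hF.ξ_e x hx
  have k5 := hF.ξ_f x hx
  have k6 := hF.e_f x hx
  have k4' := (sy _ _).trans k4
  have k5' := (sy _ _).trans k5
  have k6' := (sy _ _).trans k6
  -- Constant inner products leave three free components of the connection in each direction, nine
  -- in all.
  have skew : ∀ V : E → E,
      B x (covDeriv Γ V ξ x) (ξ x) = 0 ∧ B x (covDeriv Γ V e x) (e x) = 0 ∧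
      B x (covDeriv Γ V f x) (f x) = 0 ∧
      B x (covDeriv Γ V ξ x) (e x) = - B x (covDeriv Γ V e x) (ξ x) ∧
      B x (covDeriv Γ V ξ x) (f x) = - B x (covDeriv Γ V f x) (ξ x) ∧
      B x (covDeriv Γ V e x) (f x) = - B x (covDeriv Γ V f x) (e x) := by
    intro V
    have c1 := h.form_covDeriv_of_const (X := V) hx dξ dξ hF.ξ_ξ
    have c2 := h.form_covDeriv_of_const (X := V) hx de de hF.e_e
    have c3 := h.form_covDeriv_of_const (X := V) hx df df hF.f_f
    have c4 := h.form_covDeriv_of_const (X := V) hx dξ de hF.ξ_e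
    have c5 := h.form_covDeriv_of_const (X := V) hx dξ df hF.ξ_f
    have c6 := h.form_covDeriv_of_const (X := V) hx de df hF.e_f
    rw [sy _ (covDeriv Γ V _ x)] at c1 c2 c3 c4 c5 c6
    refine ⟨?_, ?_, ?_, ?_, ?_, ?_⟩ <;> linarith
  -- The three torsion equations have nine components, exactly enough to solve for the nine
  -- unknowns.
  have t1 := (covDeriv_sub_covDeriv (X := ξ) (Y := e) (h.coeff_symm x hx)).trans
    (hF.bracket_ξ_e x hx)
  have t2 := (covDeriv_sub_covDeriv (X := ξ) (Y := f) (h.coeff_symm x hx)).trans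
    (hF.bracket_ξ_f x hx)
  have t3 := (covDeriv_sub_covDeriv (X := e) (Y := f) (h.coeff_symm x hx)).trans
    (hF.bracket_e_f x hx)
  have pair : ∀ {u v : E}, u = v → B x u (ξ x) = B x v (ξ x) ∧ B x u (e x) = B x v (e x) ∧
      B x u (f x) = B x v (f x) := fun h => by subst h; exact ⟨rfl, rfl, rfl⟩
  have p1 := pair t1
  have p2 := pair t2
  have p3 := pair t3
  simp only [map_sub, map_add, map_smul, sub_apply, add_apply, smul_apply, smul_eq_mul, k1, k2, k3,
    k4, k5, k6, k4', k5', k6', mul_zero, mul_one] at p1 p2 p3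
  have q1 := skew ξ
  have q2 := skew e
  have q3 := skew f
  have ext : ∀ {u v : E}, B x u (ξ x) = B x v (ξ x) → B x u (e x) = B x v (e x) →
      B x u (f x) = B x v (f x) → u = v := fun h1 h2 h3 => by
    exact (hF.span x hx _).trans ((by rw [h1, h2, h3] : _ = _).trans (hF.span x hx _).symm)
  refine ⟨?_, ?_, ?_, ?_, ?_, ?_, ?_, ?_, ?_⟩ <;> apply ext <;>
    simp only [map_zero, zero_apply, map_add, map_smul, add_apply, smul_apply, smul_eq_mul, k1, k2,
      k3, k4, k5, k6, k4', k5', k6', mul_zero, mul_one] <;> linarith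

/-- The curvature operators applied to the Reeb field, in a φ-basis. -/
theorem IsPhiFrameOn.curvature_reeb (hF : IsPhiFrameOn B Ω ξ e f A b s a₄ a₅)
    (h : IsLeviCivitaOn B Γ Ω) (hx : x ∈ Ω) :
    curvature Γ x (e x) (ξ x) (ξ x) =
      (fderiv ℝ A x (ξ x) + 2 * b x * s x - (A x ^ 2 - b x ^ 2 + 1)) • e x
        + (fderiv ℝ b x (ξ x) + 2 * A x * s x) • f x ∧
    curvature Γ x (f x) (ξ x) (ξ x) =
      (-(fderiv ℝ b x (ξ x) + 2 * A x * s x)) • e x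
        + (-(fderiv ℝ A x (ξ x) + 2 * b x * s x) - (A x ^ 2 - b x ^ 2 + 1)) • f x ∧
    curvature Γ x (e x) (f x) (ξ x) =
      (fderiv ℝ b x (e x) + fderiv ℝ A x (f x) + 2 * A x * a₄ x + 2 * b x * a₅ x) • e x
        + (fderiv ℝ A x (e x) + fderiv ℝ b x (f x) + 2 * b x * a₄ x + 2 * A x * a₅ x) • f x := by
  have de := ContDiffAt.differentiableAt_of_infty (hF.contDiff_e x hx)
  have df := ContDiffAt.differentiableAt_of_infty (hF.contDiff_f x hx)
  have dA := ContDiffAt.differentiableAt_of_infty (hF.contDiff_A x hx)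
  have db := ContDiffAt.differentiableAt_of_infty (hF.contDiff_b x hx)
  have hΩ := h.isOpen.mem_nhds hx
  have e1 : covDeriv Γ ξ ξ =ᶠ[𝓝 x] fun _ => 0 :=
    Filter.eventually_of_mem hΩ fun y hy => (hF.covDeriv_frame h hy).1
  have e2 : covDeriv Γ e ξ =ᶠ[𝓝 x] fun y => (-A y) • e y + (-(b y + 1)) • f y :=
    Filter.eventually_of_mem hΩ fun y hy => (hF.covDeriv_frame h hy).2.1
  have e3 : covDeriv Γ f ξ =ᶠ[𝓝 x] fun y => (b y - 1) • e y + A y • f y :=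
    Filter.eventually_of_mem hΩ fun y hy => (hF.covDeriv_frame h hy).2.2.1
  obtain ⟨-, c2, c3, c4, c5, c6, c7, c8, c9⟩ := hF.covDeriv_frame h hx
  have z : ∀ V, covDeriv Γ V (covDeriv Γ ξ ξ) x = 0 := fun V => by
    rw [covDeriv_congr e1]; simp [covDeriv]
  have N2 : ∀ V, covDeriv Γ V (covDeriv Γ e ξ) x =
      (-fderiv ℝ A x (V x)) • e x + (-A x) • covDeriv Γ V e x
        + ((-fderiv ℝ b x (V x)) • f x + (-(b x + 1)) • covDeriv Γ V f x) := fun V => by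
    rw [covDeriv_congr e2, covDeriv_smul_add_smul dA.fun_neg (db.add_const 1).fun_neg de df,
      fderiv_fun_neg, fderiv_fun_neg, fderiv_add_const]
    rfl
  have N3 : ∀ V, covDeriv Γ V (covDeriv Γ f ξ) x =
      (fderiv ℝ b x (V x)) • e x + (b x - 1) • covDeriv Γ V e x
        + ((fderiv ℝ A x (V x)) • f x + (A x) • covDeriv Γ V f x) := fun V => by
    rw [covDeriv_congr e3, covDeriv_smul_add_smul (db.sub_const 1) dA de df, fderiv_sub_const]
  have hξ := hF.contDiff_ξ x hx
  have he := hF.contDiff_e x hx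
  have hf := hF.contDiff_f x hx
  have hΓ := h.contDiff_coeff x hx
  have b1 : VectorField.lieBracket ℝ e ξ x = (0 : ℝ) • ξ x + (-A x) • e x
      + (-(s x + 1 + b x)) • f x := by
    rw [VectorField.lieBracket_swap, hF.bracket_ξ_e x hx]; module
  have b2 : VectorField.lieBracket ℝ f ξ x = (0 : ℝ) • ξ x + (-(s x + 1 - b x)) • e x
      + A x • f x := by
    rw [VectorField.lieBracket_swap, hF.bracket_ξ_f x hx]; module
  have b3 : VectorField.lieBracket ℝ e f x = (-2 : ℝ) • ξ x + a₄ x • e x + (-a₅ x) • f x := by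
    rw [hF.bracket_e_f x hx]; module
  have c1 := (hF.covDeriv_frame h hx).1
  refine ⟨?_, ?_, ?_⟩
  · rw [curvature_eq_covDeriv hΓ he hξ hξ, covDeriv_of_eq b1, z, N2, c1, c2, c3, c4, c5]
    module
  · rw [curvature_eq_covDeriv hΓ hf hξ hξ, covDeriv_of_eq b2, z, N3, c1, c2, c3, c4, c5]
    module
  · rw [curvature_eq_covDeriv hΓ he hf hξ, covDeriv_of_eq b3, N3, N2, c1, c2, c3, c6, c7, c8, c9]
    module

/-- The Ricci form `(v, w) ↦ tr (u ↦ R (u, v) w)`, computed in a frame `ξ, e, f`. -/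
def frameRicci (B : E → E →L[ℝ] E →L[ℝ] ℝ) (Γ : E → E →L[ℝ] E →L[ℝ] E) (ξ e f : E → E)
    (x v w : E) : ℝ :=
  B x (curvature Γ x (ξ x) v w) (ξ x) + B x (curvature Γ x (e x) v w) (e x)
    - B x (curvature Γ x (f x) v w) (f x)

/-- The Ricci curvature in a φ-basis. -/
theorem IsPhiFrameOn.frameRicci_eq (hF : IsPhiFrameOn B Ω ξ e f A b s a₄ a₅)
    (h : IsLeviCivitaOn B Γ Ω) (hx : x ∈ Ω) :
    frameRicci B Γ ξ e f x (ξ x) (ξ x) = -2 * (A x ^ 2 - b x ^ 2 + 1) ∧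
    frameRicci B Γ ξ e f x (ξ x) (e x) =
      -(fderiv ℝ A x (e x) + fderiv ℝ b x (f x) + 2 * b x * a₄ x + 2 * A x * a₅ x) ∧
    frameRicci B Γ ξ e f x (e x) (ξ x) =
      -(fderiv ℝ A x (e x) + fderiv ℝ b x (f x) + 2 * b x * a₄ x + 2 * A x * a₅ x) ∧
    frameRicci B Γ ξ e f x (ξ x) (f x) =
      fderiv ℝ b x (e x) + fderiv ℝ A x (f x) + 2 * A x * a₄ x + 2 * b x * a₅ x ∧
    frameRicci B Γ ξ e f x (f x) (ξ x) =
      fderiv ℝ b x (e x) + fderiv ℝ A x (f x) + 2 * A x * a₄ x + 2 * b x * a₅ x ∧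
    frameRicci B Γ ξ e f x (e x) (f x) = -(fderiv ℝ b x (ξ x) + 2 * A x * s x) ∧
    frameRicci B Γ ξ e f x (f x) (e x) = -(fderiv ℝ b x (ξ x) + 2 * A x * s x) ∧
    frameRicci B Γ ξ e f x (e x) (e x) + frameRicci B Γ ξ e f x (f x) (f x) =
      2 * (fderiv ℝ A x (ξ x) + 2 * b x * s x) := by
  obtain ⟨r1, r2, r3⟩ := hF.curvature_reeb h hx
  let F : Fin 3 → E → E := ![ξ, e, f]
  let G : Fin 3 → Fin 3 → ℝ := ![![1, 0, 0], ![0, 1, 0], ![0, 0, -1]]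
  have sy := fun y hy => h.form_symm y hy
  have hFs : ∀ i, ∀ y ∈ Ω, ContDiffAt ℝ ∞ (F i) y := by
    intro i
    fin_cases i
    exacts [hF.contDiff_ξ, hF.contDiff_e, hF.contDiff_f]
  have hG : ∀ i j, ∀ y ∈ Ω, B y (F i y) (F j y) = G i j := by
    intro i j
    fin_cases i <;> fin_cases j
    exacts [hF.ξ_ξ, hF.ξ_e, hF.ξ_f, fun y hy => (sy y hy _ _).trans (hF.ξ_e y hy), hF.e_e, hF.e_f,
      fun y hy => (sy y hy _ _).trans (hF.ξ_f y hy), fun y hy => (sy y hy _ _).trans (hF.e_f y hy),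
      hF.f_f]
  let R : Fin 3 → Fin 3 → Fin 3 → Fin 3 → ℝ := fun i j k l =>
    B x (curvature Γ x (F i x) (F j x) (F k x)) (F l x)
  have R1 : ∀ i j k l, R i j k l = - R j i k l := fun i j k l => by
    simp only [R]
    rw [curvature_swap]
    simp
  have R2 : ∀ i j k l, R i j k l = - R i j l k := fun i j k l => by
    simp only [R]
    rw [h.form_curvature_of_const hx (hFs i) (hFs j) (hFs k) (hFs l) (hG k l), sy x hx]
  have R3 : ∀ i j k l, R i j k l + R j k i l + R k i j l = 0 := fun i j k l => by
    simp only [R]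
    rw [← add_apply, ← add_apply, ← map_add, ← map_add, curvature_cyclic
      (h.contDiff_coeff x hx) (Filter.eventually_of_mem (h.isOpen.mem_nhds hx) h.coeff_symm)]
    simp
  -- Only R(·,·)ξ has been computed. Where ξ sits in the first pair of slots, pair symmetry moves it
  -- to the second.
  have R4 := pair_symm_of_cyclic R1 R2 R3
  have k1 := hF.ξ_ξ x hx
  have k2 := hF.e_e x hx
  have k3 := hF.f_f x hx
  have k4 := (sy x hx _ _).trans (hF.ξ_e x hx)
  have k5 := (sy x hx _ _).trans (hF.ξ_f x hx)
  have k6 := hF.e_f x hx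
  have k6' := (sy x hx _ _).trans k6
  have pair : ∀ {u v : E}, u = v → B x u (ξ x) = B x v (ξ x) ∧ B x u (e x) = B x v (e x) ∧
      B x u (f x) = B x v (f x) := fun h => by subst h; exact ⟨rfl, rfl, rfl⟩
  have p1 : R 1 0 0 0 = _ ∧ R 1 0 0 1 = _ ∧ R 1 0 0 2 = _ := pair r1
  have p2 : R 2 0 0 0 = _ ∧ R 2 0 0 1 = _ ∧ R 2 0 0 2 = _ := pair r2
  have p3 : R 1 2 0 0 = _ ∧ R 1 2 0 1 = _ ∧ R 1 2 0 2 = _ := pair r3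
  simp only [map_add, map_smul, add_apply, smul_apply, smul_eq_mul, k2, k3,
    k4, k5, k6, k6', mul_zero, mul_one, add_zero, zero_add] at p1 p2 p3
  obtain ⟨p10, p11, p12⟩ := p1
  obtain ⟨p20, p21, p22⟩ := p2
  obtain ⟨p30, p31, p32⟩ := p3
  have ric : ∀ i j, frameRicci B Γ ξ e f x (F i x) (F j x) = R 0 i j 0 + R 1 i j 1 - R 2 i j 2 :=
    fun i j => rfl
  have d12 : ∀ i k l, R i i k l = 0 := fun i k l => by linarith [R1 i i k l]
  have d34 : ∀ i j k, R i j k k = 0 := fun i j k => by linarith [R2 i j k k]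
  refine ⟨?_, ?_, ?_, ?_, ?_, ?_, ?_, ?_⟩
  · refine (ric 0 0).trans ?_
    linarith [d12 0 0 0]
  · refine (ric 0 1).trans ?_
    linarith [d12 0 1 0, d34 1 0 1, R4 2 0 1 2, R2 1 2 2 0]
  · refine (ric 1 0).trans ?_
    linarith [d12 1 0 1, d34 0 1 0, R1 2 1 0 2]
  · refine (ric 0 2).trans ?_
    linarith [d12 0 2 0, d34 2 0 2, R4 1 0 2 1, R2 2 1 1 0, R1 2 1 0 1]
  · refine (ric 2 0).trans ?_
    linarith [d12 2 0 2, d34 0 2 0]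
  · refine (ric 1 2).trans ?_
    linarith [d12 1 2 1, d34 2 1 2, R2 0 1 2 0, R1 0 1 0 2]
  · refine (ric 2 1).trans ?_
    linarith [d12 2 1 2, d34 1 2 1, R2 0 2 1 0, R1 0 2 0 1]
  -- The terms R(e,f,f,e) and R(f,e,e,f) agree and enter the two diagonal entries with opposite
  -- signs. The sum therefore avoids the curvature of the contact plane, which is not determined by
  -- R(·,·)ξ.
  · have h1 := ric 1 1
    have h2 := ric 2 2
    refine (congrArg₂ (· + ·) h1 h2).trans ?_
    linarith [d12 1 1 1, d12 2 2 2, R2 0 1 1 0, R1 0 1 0 1, R2 0 2 2 0, R1 0 2 0 2, R2 1 2 2 1,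
      R1 1 2 1 2]

theorem lieBracket_combination {X Y Z W : E → E} {p q r : E → ℝ} (hp : DifferentiableAt ℝ p x)
    (hq : DifferentiableAt ℝ q x) (hr : DifferentiableAt ℝ r x) (hY : DifferentiableAt ℝ Y x)
    (hZ : DifferentiableAt ℝ Z x) (hW : DifferentiableAt ℝ W x) :
    VectorField.lieBracket ℝ X (fun y => p y • Y y + q y • Z y + r y • W y) x =
      fderiv ℝ p x (X x) • Y x + p x • VectorField.lieBracket ℝ X Y x
        + (fderiv ℝ q x (X x) • Z x + q x • VectorField.lieBracket ℝ X Z x)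
        + (fderiv ℝ r x (X x) • W x + r x • VectorField.lieBracket ℝ X W x) := by
  have h1 := hp.fun_smul hY
  have h2 := hq.fun_smul hZ
  have h3 := hr.fun_smul hW
  have := VectorField.lieBracket_add_right (V := X) (h1.fun_add h2) h3
  refine this.trans ?_
  have := VectorField.lieBracket_add_right (V := X) h1 h2
  rw [VectorField.lieBracket_smul_right hr hW]
  refine congrArg (· + _) (this.trans ?_)
  rw [VectorField.lieBracket_smul_right hp hY, VectorField.lieBracket_smul_right hq hZ]

/-- The Jacobi identity for a frame whose brackets have the shape of those of a φ-basis. -/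
theorem jacobi_of_brackets {C D a : E → ℝ} (hΩ : IsOpen Ω) (hx : x ∈ Ω)
    (hξ : ContDiffAt ℝ ∞ ξ x) (he : ContDiffAt ℝ ∞ e x) (hf : ContDiffAt ℝ ∞ f x)
    (hA : DifferentiableAt ℝ A x) (ha : DifferentiableAt ℝ a x) (hC : DifferentiableAt ℝ C x)
    (hD : DifferentiableAt ℝ D x) (ha₄ : DifferentiableAt ℝ a₄ x) (ha₅ : DifferentiableAt ℝ a₅ x)
    (h₁ : ∀ y ∈ Ω, VectorField.lieBracket ℝ ξ e y = A y • e y + a y • f y)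
    (h₂ : ∀ y ∈ Ω, VectorField.lieBracket ℝ ξ f y = C y • e y + D y • f y)
    (h₃ : ∀ y ∈ Ω, VectorField.lieBracket ℝ e f y = (-2 : ℝ) • ξ y + a₄ y • e y - a₅ y • f y) :
    (2 * (A x + D x)) • ξ x
      + (fderiv ℝ a₄ x (ξ x) - a₅ x * C x + fderiv ℝ A x (f x) - fderiv ℝ C x (e x)
          - D x * a₄ x) • e x
      + (a₄ x * a x - fderiv ℝ a₅ x (ξ x) + A x * a₅ x + fderiv ℝ a x (f x)
          - fderiv ℝ D x (e x)) • f x = 0 := by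
  have dξ := ContDiffAt.differentiableAt_of_infty hξ
  have de := ContDiffAt.differentiableAt_of_infty he
  have df := ContDiffAt.differentiableAt_of_infty hf
  -- The expansions of the inner brackets hold on a neighbourhood, so they may be substituted under
  -- the outer bracket.
  have e₁ : VectorField.lieBracket ℝ ξ e =ᶠ[𝓝 x]
      fun y => (fun _ => (0 : ℝ)) y • ξ y + A y • e y + a y • f y :=
    Filter.eventually_of_mem (hΩ.mem_nhds hx) fun y hy => (h₁ y hy).trans (by module)
  have e₂ : VectorField.lieBracket ℝ ξ f =ᶠ[𝓝 x]
      fun y => (fun _ => (0 : ℝ)) y • ξ y + C y • e y + D y • f y :=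
    Filter.eventually_of_mem (hΩ.mem_nhds hx) fun y hy => (h₂ y hy).trans (by module)
  have e₃ : VectorField.lieBracket ℝ e f =ᶠ[𝓝 x]
      fun y => (fun _ => (-2 : ℝ)) y • ξ y + a₄ y • e y + (fun y => - a₅ y) y • f y :=
    Filter.eventually_of_mem (hΩ.mem_nhds hx) fun y hy => (h₃ y hy).trans (by module)
  have J := VectorField.leibniz_identity_lieBracket (𝕜 := ℝ) (n := ∞)
    (by simpa using WithTop.coe_le_coe.2 (le_top : (2 : ℕ∞) ≤ ⊤)) hξ he hf
  rw [Filter.EventuallyEq.lieBracket_vectorField_eq Filter.EventuallyEq.rfl e₃,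
    Filter.EventuallyEq.lieBracket_vectorField_eq e₁ Filter.EventuallyEq.rfl,
    Filter.EventuallyEq.lieBracket_vectorField_eq Filter.EventuallyEq.rfl e₂,
    VectorField.lieBracket_swap (W := f),
    lieBracket_combination (differentiableAt_const _) ha₄ ha₅.fun_neg dξ de df,
    lieBracket_combination (differentiableAt_const _) hA ha dξ de df,
    lieBracket_combination (differentiableAt_const _) hC hD dξ de df,
    VectorField.lieBracket_swap (V := f) (W := e), VectorField.lieBracket_swap (V := f) (W := ξ),
    VectorField.lieBracket_swap (V := e) (W := ξ), VectorField.lieBracket_self,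
    VectorField.lieBracket_self, VectorField.lieBracket_self, h₁ x hx, h₂ x hx, h₃ x hx,
    (fderiv_fun_neg : fderiv ℝ (fun y => - a₅ y) x = _)] at J
  simp only [fderiv_fun_const, Pi.zero_apply, zero_apply, neg_apply] at J
  rw [← sub_eq_zero] at J
  rw [← J]
  module

end PhiFrame

/-! ### Separating the zero sets of two propagated functions by doubling variables. -/

section Separation

variable {E : Type*} [NormedAddCommGroup E] [InnerProductSpace ℝ E]

/-- First-order condition at a local maximum of `u² exp (-2K (|x - y| + c |x - x₀|²))`. -/
theorem eq_of_isLocalMax_sq_mul_exp {u : E → ℝ} {x y x₀ v : E} {K c a : ℝ} (hxy : x ≠ y)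
    (hu : DifferentiableAt ℝ u x) (hux : u x ≠ 0) (hv : fderiv ℝ u x v = a * u x)
    (hmax : IsLocalMax (fun z => u z ^ 2 *
      Real.exp (-(2 * K * (‖z - y‖ + c * ‖z - x₀‖ ^ 2)))) x) :
    a = K * (inner ℝ (x - y) v / ‖x - y‖ + 2 * c * inner ℝ (x - x₀) v) := by
  have hγ : HasDerivAt (fun t : ℝ => x + t • v) v 0 := by
    simpa using ((hasDerivAt_id (0 : ℝ)).smul_const v).const_add x
  have hγ0 : x + (0 : ℝ) • v = x := by simp
  have h1 : HasDerivAt (fun t : ℝ => u (x + t • v)) (a * u x) 0 := by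
    rw [← hv]
    exact HasFDerivAt.comp_hasDerivAt (0 : ℝ) (by rw [hγ0]; exact hu.hasFDerivAt) hγ
  have hpos : 0 < ‖x - y‖ := norm_pos_iff.2 (sub_ne_zero.2 hxy)
  have h2 : HasDerivAt (fun t : ℝ => ‖x + t • v - y‖) (inner ℝ (x - y) v / ‖x - y‖) 0 := by
    have h := ((hγ.sub_const y).norm_sq).sqrt (by rw [hγ0]; positivity)
    rw [hγ0, Real.sqrt_sq hpos.le] at h
    simp only [Real.sqrt_sq (norm_nonneg _)] at h
    convert h using 1
    field_simp
  have h3 : HasDerivAt (fun t : ℝ => ‖x + t • v - x₀‖ ^ 2) (2 * inner ℝ (x - x₀) v) 0 := by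
    have h := (hγ.sub_const x₀).norm_sq
    rwa [hγ0] at h
  have h4 := (h1.fun_pow 2).fun_mul (((h2.fun_add (h3.const_mul c)).const_mul (2 * K)).fun_neg).exp
  have hmax' : IsLocalMax (fun t : ℝ => u (x + t • v) ^ 2 *
      Real.exp (-(2 * K * (‖x + t • v - y‖ + c * ‖x + t • v - x₀‖ ^ 2)))) 0 := by
    have hc : Filter.Tendsto (fun t : ℝ => x + t • v) (𝓝 0) (𝓝 x) := by
      simpa using hγ.continuousAt.tendsto
    have := hc.eventually hmax
    simpa [IsLocalMax, IsMaxFilter] using this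
  have h5 := hmax'.hasDerivAt_eq_zero h4
  simp only [hγ0] at h5
  have hexp := Real.exp_pos (-(2 * K * (‖x - y‖ + c * ‖x - x₀‖ ^ 2)))
  set ex := Real.exp (-(2 * K * (‖x - y‖ + c * ‖x - x₀‖ ^ 2)))
  have h6 : (2 * u x ^ 2 * ex) *
      (a - K * (inner ℝ (x - y) v / ‖x - y‖ + 2 * c * inner ℝ (x - x₀) v)) = 0 := by
    rw [← h5]
    push_cast
    ring
  have h7 : 2 * u x ^ 2 * ex ≠ 0 := by positivity
  have := (mul_eq_zero.1 h6).resolve_left h7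
  linarith

/-- The first-order condition, solved for the cosine-like quotient, leaves two errors: `C / K` from
the propagation rate and the rest from the gradient of the quadratic penalty. -/
theorem abs_inner_le_of_eq {x y x₀ v : E} {K c a C R : ℝ} (hK : 0 < K) (hc : 0 ≤ c)
    (ha : |a| ≤ C) (hv : ‖v‖ ≤ C) (hx : ‖x - x₀‖ ≤ R)
    (h : a = K * (inner ℝ (x - y) v / ‖x - y‖ + 2 * c * inner ℝ (x - x₀) v)) :
    |inner ℝ (x - y) v| / ‖x - y‖ ≤ C / K + 2 * c * (R * C) := by
  have hR : 0 ≤ R := (norm_nonneg _).trans hx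
  have h1 : inner ℝ (x - y) v / ‖x - y‖ = a / K - 2 * c * inner ℝ (x - x₀) v := by
    rw [h]
    field_simp
    ring
  have h2 : |inner ℝ (x - x₀) v| ≤ R * C :=
    (abs_real_inner_le_norm _ _).trans (mul_le_mul hx hv (norm_nonneg _) hR)
  have h3 : |a / K| ≤ C / K := by
    rw [abs_div, abs_of_pos hK]
    gcongr
  rw [(by rw [abs_div, abs_norm] : |inner ℝ (x - y) v| / ‖x - y‖ = |inner ℝ (x - y) v / ‖x - y‖|),
    h1]
  refine (abs_sub _ _).trans (add_le_add h3 ?_)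
  rw [abs_mul, abs_of_nonneg (by positivity : (0 : ℝ) ≤ 2 * c)]
  gcongr

/-- If the values at `x₀` of three continuous vector fields separate points, then no unit vector is
almost orthogonal to their values at points near `x₀`. -/
theorem exists_forall_le_abs_inner [FiniteDimensional ℝ E] {X P N : E → E} {x₀ : E}
    (hX : ContinuousAt X x₀) (hP : ContinuousAt P x₀) (hN : ContinuousAt N x₀)
    (hspan : ∀ n, inner ℝ n (X x₀) = 0 → inner ℝ n (P x₀) = 0 → inner ℝ n (N x₀) = 0 → n = 0) :
    ∃ k > 0, ∃ S ∈ 𝓝 x₀, ∀ x ∈ S, ∀ y ∈ S, ∀ n : E,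
      |inner ℝ n (X x)| ≤ k * ‖n‖ → |inner ℝ n (P x)| ≤ k * ‖n‖ →
      |inner ℝ n (N y)| ≤ k * ‖n‖ → n = 0 := by
  let L : E →ₗ[ℝ] ℝ × ℝ × ℝ := LinearMap.prod (innerₗ E (X x₀))
    (LinearMap.prod (innerₗ E (P x₀)) (innerₗ E (N x₀)))
  have hL : LinearMap.ker L = ⊥ := by
    refine LinearMap.ker_eq_bot'.2 fun n hn => ?_
    have hn₁ : inner ℝ (X x₀) n = 0 := congrArg Prod.fst hn
    have hn₂ : inner ℝ (P x₀) n = 0 := congrArg (fun p => p.2.1) hn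
    have hn₃ : inner ℝ (N x₀) n = 0 := congrArg (fun p => p.2.2) hn
    rw [real_inner_comm] at hn₁ hn₂ hn₃
    exact hspan n hn₁ hn₂ hn₃
  -- An injective linear map in finite dimension is bounded below. With the threshold `1 / (4 * K)`,
  -- moving the vectors and the assumed near-orthogonality each cost a quarter, which yields ‖n‖ ≤
  -- ‖n‖/2.
  obtain ⟨K, hK, hLK⟩ := L.exists_antilipschitzWith hL
  have hK' : (0 : ℝ) < K := hK
  have key : ∀ n, ‖n‖ ≤ K * ‖L n‖ := fun n => by
    simpa using hLK.le_mul_dist n 0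
  have hε : (0 : ℝ) < 1 / (4 * K) := by positivity
  have close : ∀ {V : E → E}, ContinuousAt V x₀ → ∀ᶠ x in 𝓝 x₀, ‖V x₀ - V x‖ ≤ 1 / (4 * K) :=
    fun hV => by
      filter_upwards [Metric.continuousAt_iff'.1 hV _ hε] with x hx
      rw [← dist_eq_norm, dist_comm]
      exact hx.le
  refine ⟨1 / (4 * K), hε, _, (close hX).and ((close hP).and (close hN)), ?_⟩
  rintro x ⟨hxX, hxP, -⟩ y ⟨-, -, hyN⟩ n h1 h2 h3
  have est : ∀ {v w : E}, ‖v - w‖ ≤ 1 / (4 * K) → |inner ℝ n w| ≤ 1 / (4 * K) * ‖n‖ →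
      |inner ℝ v n| ≤ 1 / (2 * K) * ‖n‖ := fun {v w} h h' => by
    have e : inner ℝ v n = inner ℝ n (v - w) + inner ℝ n w := by
      rw [inner_sub_right, real_inner_comm]; ring
    have h4 : |inner ℝ n (v - w)| ≤ 1 / (4 * K) * ‖n‖ :=
      (abs_real_inner_le_norm _ _).trans (by rw [mul_comm]; gcongr)
    rw [e]
    refine (abs_add_le _ _).trans ((add_le_add h4 h').trans_eq ?_)
    ring
  have hn : ‖L n‖ ≤ 1 / (2 * K) * ‖n‖ :=
    max_le (est hxX h1) (max_le (est hxP h2) (est hyN h3))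
  have h5 : ‖n‖ ≤ ‖n‖ / 2 := by
    refine (key n).trans ((mul_le_mul_of_nonneg_left hn hK'.le).trans_eq ?_)
    field_simp
  exact norm_le_zero_iff.1 (by linarith)

theorem exists_eventually_norm_le {α F : Type*} [TopologicalSpace α] [SeminormedAddCommGroup F]
    {V : α → F} {x₀ : α} (hV : ContinuousAt V x₀) : ∃ C, ∀ᶠ x in 𝓝 x₀, ‖V x‖ ≤ C :=
  ⟨‖V x₀‖ + 1, (hV.norm.eventually_lt continuousAt_const (lt_add_one _)).mono fun _ h => h.le⟩

/-- Let `u w = 0`, where `u` is propagated along the vector fields `X` and `P`, and `w` along `N`. If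
`X, P, N` are linearly independent at `x₀`, then `u` or `w` vanishes near `x₀`. -/
theorem eventually_eq_zero_or_eventually_eq_zero [FiniteDimensional ℝ E] {X P N : E → E} {x₀ : E}
    {u w a₁ a₂ a₃ : E → ℝ}
    (hX : ContinuousAt X x₀) (hP : ContinuousAt P x₀) (hN : ContinuousAt N x₀)
    (hspan : ∀ n, inner ℝ n (X x₀) = 0 → inner ℝ n (P x₀) = 0 → inner ℝ n (N x₀) = 0 → n = 0)
    (h₁ : ContinuousAt a₁ x₀) (h₂ : ContinuousAt a₂ x₀) (h₃ : ContinuousAt a₃ x₀)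
    (hu : ∀ᶠ x in 𝓝 x₀, DifferentiableAt ℝ u x) (hw : ∀ᶠ x in 𝓝 x₀, DifferentiableAt ℝ w x)
    (huw : ∀ᶠ x in 𝓝 x₀, u x * w x = 0)
    (hXu : ∀ᶠ x in 𝓝 x₀, fderiv ℝ u x (X x) = a₁ x * u x)
    (hPu : ∀ᶠ x in 𝓝 x₀, fderiv ℝ u x (P x) = a₂ x * u x)
    (hNw : ∀ᶠ x in 𝓝 x₀, fderiv ℝ w x (N x) = a₃ x * w x) :
    (∀ᶠ x in 𝓝 x₀, u x = 0) ∨ ∀ᶠ x in 𝓝 x₀, w x = 0 := by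
  obtain ⟨k, hk, S, hS, hSk⟩ := exists_forall_le_abs_inner hX hP hN hspan
  obtain ⟨C₁, hC₁⟩ := exists_eventually_norm_le hX
  obtain ⟨C₂, hC₂⟩ := exists_eventually_norm_le hP
  obtain ⟨C₃, hC₃⟩ := exists_eventually_norm_le hN
  obtain ⟨C₄, hC₄⟩ := exists_eventually_norm_le h₁
  obtain ⟨C₅, hC₅⟩ := exists_eventually_norm_le h₂
  obtain ⟨C₆, hC₆⟩ := exists_eventually_norm_le h₃
  obtain ⟨C, hCpos, c₁, c₂, c₃, c₄, c₅, c₆⟩ : ∃ C : ℝ, 0 < C ∧ C₁ ≤ C ∧ C₂ ≤ C ∧ C₃ ≤ C ∧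
      C₄ ≤ C ∧ C₅ ≤ C ∧ C₆ ≤ C :=
    ⟨1 + |C₁| + |C₂| + |C₃| + |C₄| + |C₅| + |C₆|, by positivity, by
      refine ⟨?_, ?_, ?_, ?_, ?_, ?_⟩ <;>
      linarith [le_abs_self C₁, le_abs_self C₂, le_abs_self C₃, le_abs_self C₄, le_abs_self C₅,
        le_abs_self C₆, abs_nonneg C₁, abs_nonneg C₂, abs_nonneg C₃, abs_nonneg C₄, abs_nonneg C₅,
        abs_nonneg C₆]⟩
  have hall := (hC₁.and <| hC₂.and <| hC₃.and <| hC₄.and <| hC₅.and <| hC₆.and <| hu.and <|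
    hw.and <| huw.and <| hXu.and <| hPu.and <| hNw.and hS)
  obtain ⟨R, hR, hball⟩ := Metric.nhds_basis_closedBall.eventually_iff.1 hall
  -- The penalty may use up half of the tolerance `k`; the other half is reserved for `C / K` with
  -- `K` large.
  set c : ℝ := k / (4 * R * C) with hc
  have hcpos : 0 < c := by positivity
  have hcR : 2 * c * (R * C) = k / 2 := by
    rw [hc]
    field_simp
    norm_num
  -- For points within `r` of `x₀` the total penalty is at most 2r + 2c(R/2)² ≤ (3/4)cR², whereas it
  -- is at least cR² as soon as one point lies on the sphere of radius `R`.
  set r : ℝ := min (R / 2) (c * R ^ 2 / 8) with hr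
  have hrpos : 0 < r := by positivity
  have hrR : r ≤ R / 2 := min_le_left _ _
  have hrc : r ≤ c * R ^ 2 / 8 := min_le_right _ _
  by_contra! hcon
  obtain ⟨hq, hq'⟩ := hcon
  obtain ⟨q, hqu, hqr⟩ := (hq.and_eventually (Metric.closedBall_mem_nhds x₀ hrpos)).exists
  obtain ⟨q', hqw, hqr'⟩ := (hq'.and_eventually (Metric.closedBall_mem_nhds x₀ hrpos)).exists
  rw [dist_eq_norm] at hqr hqr'
  have hmem : ∀ {z : E}, z ∈ Metric.closedBall x₀ R ↔ ‖z - x₀‖ ≤ R := mem_closedBall_iff_norm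
  set D : Set E := Metric.closedBall x₀ R with hD
  have hDc : IsCompact D := isCompact_closedBall x₀ R
  have hu' : ContinuousOn u D := fun z hz =>
    (hball hz).2.2.2.2.2.2.1.continuousAt.continuousWithinAt
  have hw' : ContinuousOn w D := fun z hz =>
    (hball hz).2.2.2.2.2.2.2.1.continuousAt.continuousWithinAt
  obtain ⟨Mu, hMu⟩ := hDc.exists_bound_of_continuousOn (hu'.pow 2)
  obtain ⟨Mw, hMw⟩ := hDc.exists_bound_of_continuousOn (hw'.pow 2)
  set m := u q ^ 2 * w q' ^ 2 with hm
  have hmpos : 0 < m := by positivity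
  -- The rate is 2K times the gap (1/4)cR² between these penalties. For large `K` the competitor
  -- `(q, q')` beats every pair with penalty at least cR², so the maximum is interior.
  have hKlim : Filter.Tendsto (fun K : ℝ => Mu * Mw * Real.exp (-(K * (c * R ^ 2 / 2))))
      Filter.atTop (𝓝 0) := by
    have h := (Real.tendsto_exp_neg_atTop_nhds_zero.comp
      (Filter.tendsto_id.atTop_mul_const (by positivity : 0 < c * R ^ 2 / 2))).const_mul (Mu * Mw)
    simpa using h
  obtain ⟨K, hKm, hKC⟩ := ((hKlim.eventually_lt_const hmpos).and
    (Filter.eventually_gt_atTop (2 * C / k))).exists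
  have hK : 0 < K := lt_trans (by positivity) hKC
  have hKk : C / K + 2 * c * (R * C) ≤ k := by
    have : C / K ≤ k / 2 := by
      rw [div_lt_iff₀ hk] at hKC
      rw [div_le_div_iff₀ hK two_pos]
      linarith
    linarith
  let ψ : E × E → ℝ := fun p => ‖p.1 - p.2‖ + c * ‖p.1 - x₀‖ ^ 2 + c * ‖p.2 - x₀‖ ^ 2
  let Φ : E × E → ℝ := fun p => u p.1 ^ 2 * w p.2 ^ 2 * Real.exp (-(2 * K * ψ p))
  have hΦ : ContinuousOn Φ (D ×ˢ D) := by
    refine ContinuousOn.mul (ContinuousOn.mul ?_ ?_) (by fun_prop)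
    · exact (hu'.comp continuousOn_fst fun p hp => hp.1).pow 2
    · exact (hw'.comp continuousOn_snd fun p hp => hp.2).pow 2
  have hqD : (q, q') ∈ D ×ˢ D :=
    ⟨hmem.2 (hqr.trans (by linarith)), hmem.2 (hqr'.trans (by linarith))⟩
  obtain ⟨⟨x, y⟩, ⟨hxD, hyD⟩, hmax⟩ := (hDc.prod hDc).exists_isMaxOn ⟨_, hqD⟩ hΦ
  have hlow : m * Real.exp (-(2 * K * (3 / 4 * (c * R ^ 2)))) ≤ Φ (x, y) := by
    refine le_trans ?_ (hmax hqD)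
    have hψ : ψ (q, q') ≤ 3 / 4 * (c * R ^ 2) := by
      have e1 : ‖q - q'‖ ≤ 2 * r := by
        calc ‖q - q'‖ = ‖(q - x₀) - (q' - x₀)‖ := by congr 1; abel
          _ ≤ ‖q - x₀‖ + ‖q' - x₀‖ := norm_sub_le _ _
          _ ≤ 2 * r := by linarith
      have e2 : ‖q - x₀‖ ^ 2 ≤ (R / 2) ^ 2 :=
        pow_le_pow_left₀ (norm_nonneg _) (hqr.trans hrR) 2
      have e3 : ‖q' - x₀‖ ^ 2 ≤ (R / 2) ^ 2 :=
        pow_le_pow_left₀ (norm_nonneg _) (hqr'.trans hrR) 2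
      have e4 := mul_le_mul_of_nonneg_left e2 hcpos.le
      have e5 := mul_le_mul_of_nonneg_left e3 hcpos.le
      simp only [ψ]
      linarith
    simp only [Φ, ← hm]
    gcongr
  have hΦpos : 0 < Φ (x, y) := lt_of_lt_of_le (by positivity) hlow
  have hux : u x ≠ 0 := fun h => by simp [Φ, h] at hΦpos
  have hwy : w y ≠ 0 := fun h => by simp [Φ, h] at hΦpos
  -- Here `u w = 0` enters: on the diagonal the maximized function vanishes. It is also what makes
  -- `‖x - y‖` differentiable at the maximum.
  have hxy : x ≠ y := fun h => by
    have := (hball hxD).2.2.2.2.2.2.2.2.1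
    rw [mul_eq_zero, h] at this
    exact this.elim (h ▸ hux) hwy
  have hψ : ψ (x, y) < c * R ^ 2 := by
    by_contra! hge
    have e1 : Φ (x, y) ≤ Mu * Mw * Real.exp (-(2 * K * (c * R ^ 2))) := by
      have b1 : u x ^ 2 ≤ Mu := (le_abs_self _).trans (hMu x hxD)
      have b2 : w y ^ 2 ≤ Mw := (le_abs_self _).trans (hMw y hyD)
      have : 0 ≤ Mu := le_trans (sq_nonneg _) b1
      have : 0 ≤ Mu * Mw := mul_nonneg this (le_trans (sq_nonneg _) b2)
      simp only [Φ]
      gcongr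
    have e2 : Mu * Mw * Real.exp (-(2 * K * (c * R ^ 2))) =
        Mu * Mw * Real.exp (-(K * (c * R ^ 2 / 2))) *
          Real.exp (-(2 * K * (3 / 4 * (c * R ^ 2)))) := by
      rw [mul_assoc _ (Real.exp _), ← Real.exp_add]
      congr 2
      ring
    have e3 := mul_lt_mul_of_pos_right hKm (Real.exp_pos (-(2 * K * (3 / 4 * (c * R ^ 2)))))
    linarith
  have hint : ∀ {z : E}, c * ‖z - x₀‖ ^ 2 < c * R ^ 2 → z ∈ Metric.ball x₀ R := fun {z} h => by
    rw [mem_ball_iff_norm]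
    exact lt_of_pow_lt_pow_left₀ 2 hR.le (lt_of_mul_lt_mul_left h hcpos.le)
  have nn1 : 0 ≤ c * ‖x - x₀‖ ^ 2 := by positivity
  have nn2 : 0 ≤ c * ‖y - x₀‖ ^ 2 := by positivity
  have nn3 : 0 ≤ ‖x - y‖ := norm_nonneg _
  simp only [ψ] at hψ
  have hxint := hint (z := x) (by linarith)
  have hyint := hint (z := y) (by linarith)
  -- Freezing one variable leaves a one-variable function times a positive constant.
  have hmaxu : IsLocalMax (fun z => u z ^ 2 *
      Real.exp (-(2 * K * (‖z - y‖ + c * ‖z - x₀‖ ^ 2)))) x := by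
    filter_upwards [Metric.isOpen_ball.mem_nhds hxint] with z hz
    have h := hmax (⟨Metric.ball_subset_closedBall hz, hyD⟩ : (z, y) ∈ D ×ˢ D)
    have e : ∀ z, Φ (z, y) = (u z ^ 2 * Real.exp (-(2 * K * (‖z - y‖ + c * ‖z - x₀‖ ^ 2)))) *
        (w y ^ 2 * Real.exp (-(2 * K * (c * ‖y - x₀‖ ^ 2)))) := fun z => by
      rw [mul_mul_mul_comm, ← Real.exp_add]
      simp only [Φ, ψ]
      ring_nf
    simp only [Set.mem_ofPred_eq, e] at h
    exact le_of_mul_le_mul_right h (by positivity)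
  have hmaxw : IsLocalMax (fun z => w z ^ 2 *
      Real.exp (-(2 * K * (‖z - x‖ + c * ‖z - x₀‖ ^ 2)))) y := by
    filter_upwards [Metric.isOpen_ball.mem_nhds hyint] with z hz
    have h := hmax (⟨hxD, Metric.ball_subset_closedBall hz⟩ : (x, z) ∈ D ×ˢ D)
    have e : ∀ z, Φ (x, z) = (w z ^ 2 * Real.exp (-(2 * K * (‖z - x‖ + c * ‖z - x₀‖ ^ 2)))) *
        (u x ^ 2 * Real.exp (-(2 * K * (c * ‖x - x₀‖ ^ 2)))) := fun z => by
      rw [mul_mul_mul_comm, ← Real.exp_add, norm_sub_rev z x]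
      simp only [Φ, ψ]
      ring_nf
    simp only [Set.mem_ofPred_eq, e] at h
    exact le_of_mul_le_mul_right h (by positivity)
  obtain ⟨x1, x2, -, x4, x5, -, x7, -, -, x10, x11, -, xS⟩ := hball hxD
  obtain ⟨-, -, y3, -, -, y6, -, y8, -, -, -, y12, yS⟩ := hball hyD
  have hxR := hmem.1 hxD
  have hyR := hmem.1 hyD
  have i1 := abs_inner_le_of_eq hK hcpos.le (x4.trans c₄) (x1.trans c₁) hxR
    (eq_of_isLocalMax_sq_mul_exp hxy x7 hux x10 hmaxu)
  have i2 := abs_inner_le_of_eq hK hcpos.le (x5.trans c₅) (x2.trans c₂) hxR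
    (eq_of_isLocalMax_sq_mul_exp hxy x7 hux x11 hmaxu)
  have i3 := abs_inner_le_of_eq hK hcpos.le (y6.trans c₆) (y3.trans c₃) hyR
    (eq_of_isLocalMax_sq_mul_exp hxy.symm y8 hwy y12 hmaxw)
  have hpos : 0 < ‖x - y‖ := norm_pos_iff.2 (sub_ne_zero.2 hxy)
  rw [← neg_sub x y, inner_neg_left, abs_neg, norm_neg] at i3
  have conv : ∀ {t : ℝ}, t / ‖x - y‖ ≤ C / K + 2 * c * (R * C) → t ≤ k * ‖x - y‖ := fun h =>
    (div_le_iff₀ hpos).1 (h.trans hKk)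
  exact sub_ne_zero.2 hxy (hSk x xS y yS (x - y) (conv i1) (conv i2) (conv i3))

end Separation

/-! ### The Christoffel symbols as a Levi-Civita connection. -/

section CoordinateMetric

variable {n : ℕ}

theorem eq_sum_smul_single (u : EuclideanSpace ℝ (Fin n)) :
    u = ∑ i, u i • EuclideanSpace.single i (1 : ℝ) := by
  ext j
  simp [Pi.single_apply]

theorem map_eq_sum {F : Type*} [NormedAddCommGroup F] [NormedSpace ℝ F]
    (L : EuclideanSpace ℝ (Fin n) →L[ℝ] F) (u : EuclideanSpace ℝ (Fin n)) :
    L u = ∑ i, u i • L (EuclideanSpace.single i 1) := by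
  conv_lhs => rw [eq_sum_smul_single u]
  simp only [map_sum, map_smul]

/-- The bilinear form with the matrix `M`. -/
def matrixForm (M : Matrix (Fin n) (Fin n) ℝ) :
    EuclideanSpace ℝ (Fin n) →L[ℝ] EuclideanSpace ℝ (Fin n) →L[ℝ] ℝ :=
  ∑ i, ∑ j, M i j • (EuclideanSpace.proj i : EuclideanSpace ℝ (Fin n) →L[ℝ] ℝ).smulRight
    (EuclideanSpace.proj j : EuclideanSpace ℝ (Fin n) →L[ℝ] ℝ)

theorem matrixForm_apply (M : Matrix (Fin n) (Fin n) ℝ) (u v : EuclideanSpace ℝ (Fin n)) :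
    matrixForm M u v = ∑ i, ∑ j, M i j * (u i * v j) := by
  simp [matrixForm]

/-- The bilinear map with the components `c k i j`. -/
def coeffMap (c : Fin n → Fin n → Fin n → ℝ) :
    EuclideanSpace ℝ (Fin n) →L[ℝ] EuclideanSpace ℝ (Fin n) →L[ℝ] EuclideanSpace ℝ (Fin n) :=
  ∑ k, ∑ i, ∑ j, c k i j • (EuclideanSpace.proj i : EuclideanSpace ℝ (Fin n) →L[ℝ] ℝ).smulRight
    ((EuclideanSpace.proj j : EuclideanSpace ℝ (Fin n) →L[ℝ] ℝ).smulRight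
      (EuclideanSpace.single k (1 : ℝ)))

theorem coeffMap_apply (c : Fin n → Fin n → Fin n → ℝ) (u v : EuclideanSpace ℝ (Fin n))
    (k : Fin n) : coeffMap c u v k = ∑ i, ∑ j, c k i j * (u i * v j) := by
  simp [coeffMap, Finset.sum_apply, Pi.single_apply]

theorem coeffMap_single (c : Fin n → Fin n → Fin n → ℝ) (k i j : Fin n) :
    coeffMap c (EuclideanSpace.single i 1) (EuclideanSpace.single j 1) k = c k i j := by
  simp [coeffMap_apply]

theorem matrixForm_single (M : Matrix (Fin n) (Fin n) ℝ) (i j : Fin n) :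
    matrixForm M (EuclideanSpace.single i 1) (EuclideanSpace.single j 1) = M i j := by
  simp [matrixForm_apply]

variable {G : EuclideanSpace ℝ (Fin n) → Matrix (Fin n) (Fin n) ℝ}
  {x : EuclideanSpace ℝ (Fin n)}

theorem contDiffAt_partialDeriv {f : EuclideanSpace ℝ (Fin n) → ℝ} (hf : ContDiffAt ℝ ∞ f x)
    (i : Fin n) : ContDiffAt ℝ ∞ (partialDeriv i f) x :=
  (contDiffAt_fderiv_of_infty hf).clm_apply contDiffAt_const

theorem fderiv_eq_sum_partialDeriv (f : EuclideanSpace ℝ (Fin n) → ℝ)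
    (v : EuclideanSpace ℝ (Fin n)) : fderiv ℝ f x v = ∑ i, v i * partialDeriv i f x := by
  rw [map_eq_sum]
  rfl

theorem contDiffAt_det {m : ℕ} {M : EuclideanSpace ℝ (Fin n) → Matrix (Fin m) (Fin m) ℝ}
    (hM : ∀ i j, ContDiffAt ℝ ∞ (fun y => M y i j) x) :
    ContDiffAt ℝ ∞ (fun y => (M y).det) x := by
  simp only [Matrix.det_apply]
  exact ContDiffAt.sum fun σ _ => (contDiffAt_prod fun i _ => hM _ _).const_smul _

theorem contDiffAt_inv_apply (hG : ∀ i j, ContDiffAt ℝ ∞ (fun y => G y i j) x)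
    (hdet : IsUnit (G x).det) (k l : Fin n) : ContDiffAt ℝ ∞ (fun y => (G y)⁻¹ k l) x := by
  -- Cramer's rule: each entry of the inverse is a quotient of determinants.
  simp only [Matrix.inv_def, Matrix.smul_apply, Ring.inverse_eq_inv', smul_eq_mul,
    Matrix.adjugate_apply]
  refine ((contDiffAt_det hG).inv hdet.ne_zero).mul (contDiffAt_det fun i j => ?_)
  simp only [Matrix.updateRow_apply]
  split_ifs
  · exact contDiffAt_const
  · exact hG i j

theorem contDiffAt_christoffel (hG : ∀ i j, ContDiffAt ℝ ∞ (fun y => G y i j) x)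
    (hdet : IsUnit (G x).det) (k i j : Fin n) : ContDiffAt ℝ ∞ (christoffel G k i j) x :=
  contDiffAt_const.mul <| ContDiffAt.sum fun l _ => (contDiffAt_inv_apply hG hdet k l).mul
    (((contDiffAt_partialDeriv (hG j l) i).add (contDiffAt_partialDeriv (hG i l) j)).sub
      (contDiffAt_partialDeriv (hG i j) l))

/-- The connection coefficients of the metric with components `G`, as a bilinear map. -/
def connectionCoeff (G : EuclideanSpace ℝ (Fin n) → Matrix (Fin n) (Fin n) ℝ)
    (x : EuclideanSpace ℝ (Fin n)) :
    EuclideanSpace ℝ (Fin n) →L[ℝ] EuclideanSpace ℝ (Fin n) →L[ℝ] EuclideanSpace ℝ (Fin n) :=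
  coeffMap fun k i j => christoffel G k i j x

theorem contDiffAt_smul_const {E F : Type*} [NormedAddCommGroup E] [NormedSpace ℝ E]
    [NormedAddCommGroup F] [NormedSpace ℝ F] {x : E} {f : E → ℝ} (hf : ContDiffAt ℝ ∞ f x) (c : F) :
    ContDiffAt ℝ ∞ (fun y => f y • c) x :=
  hf.smul contDiffAt_const

theorem contDiffAt_coeffMap {c : EuclideanSpace ℝ (Fin n) → Fin n → Fin n → Fin n → ℝ}
    (hc : ∀ k i j, ContDiffAt ℝ ∞ (fun y => c y k i j) x) :
    ContDiffAt ℝ ∞ (fun y => coeffMap (c y)) x :=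
  ContDiffAt.sum fun k _ => ContDiffAt.sum fun i _ => ContDiffAt.sum fun j _ =>
    contDiffAt_smul_const (hc k i j) _

theorem contDiffAt_matrixForm (hG : ∀ i j, ContDiffAt ℝ ∞ (fun y => G y i j) x) :
    ContDiffAt ℝ ∞ (fun y => matrixForm (G y)) x :=
  ContDiffAt.sum fun i _ => ContDiffAt.sum fun j _ => contDiffAt_smul_const (hG i j) _

theorem fderiv_matrixForm_single (hG : ∀ i j, ContDiffAt ℝ ∞ (fun y => G y i j) x)
    (l i j : Fin n) :
    fderiv ℝ (fun y => matrixForm (G y)) x (EuclideanSpace.single l 1)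
      (EuclideanSpace.single i 1) (EuclideanSpace.single j 1) =
      partialDeriv l (fun y => G y i j) x := by
  have h := fderiv_form (ContDiffAt.differentiableAt_of_infty (contDiffAt_matrixForm hG))
    (differentiableAt_const (EuclideanSpace.single i (1 : ℝ)))
    (differentiableAt_const (EuclideanSpace.single j (1 : ℝ))) (EuclideanSpace.single l 1)
  simp only [matrixForm_single, fderiv_fun_const, Pi.zero_apply, zero_apply, map_zero,
    add_zero] at h
  exact h.symm

/-- Lowering the upper index cancels the inverse matrix, so that metric compatibility becomes a
linear identity between partial derivatives. -/
theorem sum_mul_christoffel (hdet : IsUnit (G x).det) (l i j : Fin n) :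
    ∑ k, G x l k * christoffel G k i j x =
      1 / 2 * (partialDeriv i (fun y => G y j l) x + partialDeriv j (fun y => G y i l) x
        - partialDeriv l (fun y => G y i j) x) := by
  set c : Fin n → ℝ := fun l => partialDeriv i (fun y => G y j l) x
    + partialDeriv j (fun y => G y i l) x - partialDeriv l (fun y => G y i j) x with hc
  have h1 : ∀ k, christoffel G k i j x = 1 / 2 * ((G x)⁻¹.mulVec c) k := fun k => rfl
  have h2 : (G x).mulVec ((G x)⁻¹.mulVec c) = c := by
    rw [Matrix.mulVec_mulVec, Matrix.mul_nonsing_inv _ hdet, Matrix.one_mulVec]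
  calc ∑ k, G x l k * christoffel G k i j x
      = 1 / 2 * (G x).mulVec ((G x)⁻¹.mulVec c) l := by
        rw [Matrix.mulVec, dotProduct, Finset.mul_sum]
        exact Finset.sum_congr rfl fun k _ => by rw [h1]; ring
    _ = _ := by rw [h2]

set_option synthInstance.maxHeartbeats 200000 in
theorem isLeviCivitaOn_connectionCoeff {Ω : Set (EuclideanSpace ℝ (Fin n))} (hΩ : IsOpen Ω)
    (hG : ∀ x ∈ Ω, ∀ i j, ContDiffAt ℝ ∞ (fun y => G y i j) x)
    (hsymm : ∀ x ∈ Ω, ∀ i j, G x i j = G x j i) (hdet : ∀ x ∈ Ω, IsUnit (G x).det) :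
    IsLeviCivitaOn (fun x => matrixForm (G x)) (connectionCoeff G) Ω := by
  have pd : ∀ x ∈ Ω, ∀ l i j, partialDeriv l (fun y => G y i j) x =
      partialDeriv l (fun y => G y j i) x := fun x hx l i j => by
    have e : (fun y => G y i j) =ᶠ[𝓝 x] fun y => G y j i :=
      Filter.eventually_of_mem (hΩ.mem_nhds hx) fun y hy => hsymm y hy i j
    simp only [partialDeriv, e.fderiv_eq]
  refine ⟨hΩ, fun x hx => contDiffAt_matrixForm (hG x hx), fun x hx => ?_, fun x hx u v => ?_,
    fun x hx u v => ?_, fun x hx u v w => ?_⟩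
  · exact contDiffAt_coeffMap fun k i j => contDiffAt_christoffel (hG x hx) (hdet x hx) k i j
  · rw [matrixForm_apply, matrixForm_apply, Finset.sum_comm]
    exact Finset.sum_congr rfl fun i _ => Finset.sum_congr rfl fun j _ => by
      rw [hsymm x hx]; ring
  · ext k
    rw [connectionCoeff, coeffMap_apply, coeffMap_apply, Finset.sum_comm]
    refine Finset.sum_congr rfl fun i _ => Finset.sum_congr rfl fun j _ => ?_
    have : christoffel G k j i x = christoffel G k i j x := by
      simp only [christoffel]
      refine congrArg _ (Finset.sum_congr rfl fun l _ => ?_)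
      rw [pd x hx l j i]
      ring
    rw [this]
    ring
  -- Both sides are trilinear, so compatibility is checked on basis vectors, where it is the sum of
  -- two lowered Christoffel symbols.
  · have key : ∀ l i j, fderiv ℝ (fun y => matrixForm (G y)) x (EuclideanSpace.single l 1)
        (EuclideanSpace.single i 1) (EuclideanSpace.single j 1) =
        matrixForm (G x) (connectionCoeff G x (EuclideanSpace.single l 1)
          (EuclideanSpace.single i 1)) (EuclideanSpace.single j 1)
        + matrixForm (G x) (EuclideanSpace.single i 1) (connectionCoeff G x
          (EuclideanSpace.single l 1) (EuclideanSpace.single j 1)) := fun l i j => by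
      rw [fderiv_matrixForm_single (hG x hx)]
      have e1 : matrixForm (G x) (connectionCoeff G x (EuclideanSpace.single l 1)
          (EuclideanSpace.single i 1)) (EuclideanSpace.single j 1) =
          ∑ k, G x j k * christoffel G k l i x := by
        rw [matrixForm_apply]
        refine Finset.sum_congr rfl fun k _ => ?_
        rw [connectionCoeff, coeffMap_single, hsymm x hx j k]
        simp
      have e2 : matrixForm (G x) (EuclideanSpace.single i 1) (connectionCoeff G x
          (EuclideanSpace.single l 1) (EuclideanSpace.single j 1)) =
          ∑ k, G x i k * christoffel G k l j x := by
        rw [matrixForm_apply, Finset.sum_comm]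
        refine Finset.sum_congr rfl fun k _ => ?_
        rw [connectionCoeff, coeffMap_single]
        simp
      rw [e1, e2, sum_mul_christoffel (hdet x hx), sum_mul_christoffel (hdet x hx),
        pd x hx i l j, pd x hx j l i, pd x hx i j l, pd x hx j i l, pd x hx l j i]
      ring
    rw [eq_sum_smul_single u, eq_sum_smul_single v, eq_sum_smul_single w]
    simp only [map_sum, map_smul, sum_apply, smul_apply, key, smul_add, Finset.sum_add_distrib]
    refine congrArg (_ + ·) (Finset.sum_congr rfl fun j _ => congrArg _ ?_)
    simp only [Finset.smul_sum]
    rw [Finset.sum_comm]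
    exact Finset.sum_congr rfl fun i _ => Finset.sum_congr rfl fun l _ => smul_comm _ _ _

end CoordinateMetric

/-! ### Multilinearity of the curvature. -/

section CurvatureLinear

variable {E : Type*} [NormedAddCommGroup E] [NormedSpace ℝ E] {Γ : E → E →L[ℝ] E →L[ℝ] E} {x : E}

theorem curvature_sum_third {ι : Type*} [Fintype ι] (u v : E) (a : ι → ℝ) (y : ι → E) :
    curvature Γ x u v (∑ i, a i • y i) = ∑ i, a i • curvature Γ x u v (y i) := by
  simp only [curvature, map_sum, map_smul, smul_add, smul_sub, Finset.sum_add_distrib,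
    Finset.sum_sub_distrib]

set_option synthInstance.maxHeartbeats 200000 in
theorem curvature_sum_second {ι : Type*} [Fintype ι] (u w : E) (a : ι → ℝ) (y : ι → E) :
    curvature Γ x u (∑ i, a i • y i) w = ∑ i, a i • curvature Γ x u (y i) w := by
  simp only [curvature, map_sum, map_smul, smul_add, smul_sub, Finset.sum_add_distrib,
    Finset.sum_sub_distrib, sum_apply, smul_apply]

theorem curvature_sum_first {ι : Type*} [Fintype ι] (v w : E) (a : ι → ℝ) (y : ι → E) :
    curvature Γ x (∑ i, a i • y i) v w = ∑ i, a i • curvature Γ x (y i) v w := by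
  rw [curvature_swap, curvature_sum_second, ← Finset.sum_neg_distrib]
  exact Finset.sum_congr rfl fun i _ => by rw [curvature_swap (y i), smul_neg]

end CurvatureLinear

/-! ### Ricci and scalar curvature as traces in a pseudo-orthonormal frame. -/

section CoordinateMetric

variable {n : ℕ} {G : EuclideanSpace ℝ (Fin n) → Matrix (Fin n) (Fin n) ℝ}
  {x : EuclideanSpace ℝ (Fin n)}

/-- The curvature of `connectionCoeff G` has the components `riemann G`. -/
theorem curvature_connectionCoeff_single (hG : ∀ i j, ContDiffAt ℝ ∞ (fun y => G y i j) x)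
    (hdet : IsUnit (G x).det) (l i j k : Fin n) :
    curvature (connectionCoeff G) x (EuclideanSpace.single i 1) (EuclideanSpace.single j 1)
      (EuclideanSpace.single k 1) l = riemann G l i j k x := by
  have hΓ := contDiffAt_christoffel hG hdet
  have hd : ∀ i j k, fderiv ℝ (connectionCoeff G) x (EuclideanSpace.single i 1)
      (EuclideanSpace.single j 1) (EuclideanSpace.single k 1) l =
      partialDeriv i (christoffel G l j k) x := fun i j k => by
    have hC : ContDiffAt ℝ ∞ (connectionCoeff G) x := contDiffAt_coeffMap hΓ
    have h1 := (((ContDiffAt.differentiableAt_of_infty hC).hasFDerivAt.clm_apply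
      (hasFDerivAt_const (EuclideanSpace.single j (1 : ℝ)) x)).clm_apply
      (hasFDerivAt_const (EuclideanSpace.single k (1 : ℝ)) x))
    have h2 := ((EuclideanSpace.proj l : EuclideanSpace ℝ (Fin n) →L[ℝ] ℝ).hasFDerivAt.comp x h1)
    have h3 : (fun y => christoffel G l j k y) = (EuclideanSpace.proj l ∘ fun y =>
        connectionCoeff G y (EuclideanSpace.single j (1 : ℝ)) (EuclideanSpace.single k (1 : ℝ))) :=
      funext fun y => (coeffMap_single (fun k i j => christoffel G k i j y) l j k).symm
    have h4 : fderiv ℝ (christoffel G l j k) x = _ := (h3 ▸ h2).fderiv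
    rw [partialDeriv, h4]
    simp only [add_apply, ContinuousLinearMap.comp_apply, ContinuousLinearMap.flip_apply,
      zero_apply, map_zero, zero_add]
    rfl
  have hq : ∀ i j k, connectionCoeff G x (EuclideanSpace.single i 1)
      (connectionCoeff G x (EuclideanSpace.single j 1) (EuclideanSpace.single k 1)) l =
      ∑ m, christoffel G l i m x * christoffel G m j k x := fun i j k => by
    rw [connectionCoeff, coeffMap_apply, Finset.sum_comm]
    refine Finset.sum_congr rfl fun m _ => ?_
    rw [coeffMap_single]
    simp
  simp only [curvature, riemann, PiLp.sub_apply, PiLp.add_apply, hd, hq, Finset.sum_sub_distrib]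
  ring

theorem sum_riemann_apply (hG : ∀ i j, ContDiffAt ℝ ∞ (fun y => G y i j) x)
    (hdet : IsUnit (G x).det) (v w : EuclideanSpace ℝ (Fin n)) :
    ∑ j, ∑ k, v j * w k * ricciComp G j k x =
      ∑ i, curvature (connectionCoeff G) x (EuclideanSpace.single i 1) v w i := by
  have hlin : ∀ i, curvature (connectionCoeff G) x (EuclideanSpace.single i 1) v w i =
      ∑ k, ∑ j, w k * (v j * riemann G i i j k x) := fun i => by
    conv_lhs => rw [eq_sum_smul_single v, eq_sum_smul_single w, curvature_sum_third]
    rw [WithLp.ofLp_sum, Finset.sum_apply]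
    refine Finset.sum_congr rfl fun k _ => ?_
    rw [curvature_sum_second, PiLp.smul_apply, WithLp.ofLp_sum, Finset.sum_apply, smul_eq_mul,
      Finset.mul_sum]
    refine Finset.sum_congr rfl fun j _ => ?_
    rw [PiLp.smul_apply, curvature_connectionCoeff_single hG hdet, smul_eq_mul]
  simp only [hlin, ricciComp, Finset.mul_sum]
  rw [Finset.sum_comm]
  conv_rhs => rw [Finset.sum_comm]
  refine Finset.sum_congr rfl fun k _ => ?_
  conv_rhs => rw [Finset.sum_comm]
  exact Finset.sum_congr rfl fun j _ => Finset.sum_congr rfl fun i _ => by ring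

/-- The Ricci curvature of `G` is the trace computed in any pseudo-orthonormal frame. -/
theorem sum_ricciComp_eq_frameRicci (hG : ∀ i j, ContDiffAt ℝ ∞ (fun y => G y i j) x)
    (hdet : IsUnit (G x).det) {ξ e f : EuclideanSpace ℝ (Fin n) → EuclideanSpace ℝ (Fin n)}
    (hspan : ∀ v, v = matrixForm (G x) v (ξ x) • ξ x + matrixForm (G x) v (e x) • e x
      + (-matrixForm (G x) v (f x)) • f x) (v w : EuclideanSpace ℝ (Fin n)) :
    ∑ j, ∑ k, v j * w k * ricciComp G j k x =
      frameRicci (fun y => matrixForm (G y)) (connectionCoeff G) ξ e f x v w := by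
  rw [sum_riemann_apply hG hdet]
  -- The trace is independent of the basis: `hspan` expands each coordinate along the frame, and the
  -- sum over `i` then reassembles the frame vector in the first slot.
  have tr : ∀ p : EuclideanSpace ℝ (Fin n), ∑ i, p i *
      matrixForm (G x) (curvature (connectionCoeff G) x (EuclideanSpace.single i 1) v w) p =
      matrixForm (G x) (curvature (connectionCoeff G) x p v w) p := fun p => by
    conv_rhs => rw [eq_sum_smul_single p, curvature_sum_first, ← eq_sum_smul_single p]
    rw [map_sum, sum_apply]
    exact Finset.sum_congr rfl fun i _ => by rw [map_smul, smul_apply, smul_eq_mul]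
  have hi : ∀ i, curvature (connectionCoeff G) x (EuclideanSpace.single i 1) v w i =
      ξ x i * matrixForm (G x) (curvature (connectionCoeff G) x (EuclideanSpace.single i 1) v w)
        (ξ x) + e x i * matrixForm (G x) (curvature (connectionCoeff G) x
        (EuclideanSpace.single i 1) v w) (e x) - f x i * matrixForm (G x)
        (curvature (connectionCoeff G) x (EuclideanSpace.single i 1) v w) (f x) := fun i => by
    have h := congrArg (fun p : EuclideanSpace ℝ (Fin n) => p i)
      (hspan (curvature (connectionCoeff G) x (EuclideanSpace.single i 1) v w))
    simp only [PiLp.add_apply, PiLp.smul_apply, smul_eq_mul] at h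
    rw [h]
    ring
  simp only [hi, Finset.sum_sub_distrib, Finset.sum_add_distrib, tr, frameRicci]

/-- The scalar curvature as the trace of the Ricci tensor in a pseudo-orthonormal frame. -/
theorem sum_inv_mul_eq (hsymm : ∀ i j, G x i j = G x j i)
    {a b c : EuclideanSpace ℝ (Fin n)}
    (hspan : ∀ v, v = matrixForm (G x) v a • a + matrixForm (G x) v b • b
      + (-matrixForm (G x) v c) • c) (T : Fin n → Fin n → ℝ) :
    ∑ i, ∑ j, (G x)⁻¹ i j * T i j = ∑ i, ∑ j, a i * a j * T i j + ∑ i, ∑ j, b i * b j * T i j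
      - ∑ i, ∑ j, c i * c j * T i j := by
  let N : Matrix (Fin n) (Fin n) ℝ :=
    Matrix.of fun i j => a i * a j + b i * b j - c i * c j
  -- The expansion of every vector in the frame says precisely that a⊗a + b⊗b − c⊗c is the inverse
  -- metric.
  have hN : (G x)⁻¹ = N := by
    refine Matrix.inv_eq_left_inv ?_
    ext i l
    have h := congrArg (fun p : EuclideanSpace ℝ (Fin n) => p i)
      (hspan (EuclideanSpace.single l 1))
    have hm : ∀ p : EuclideanSpace ℝ (Fin n), matrixForm (G x) (EuclideanSpace.single l 1) p =
        ∑ j, G x l j * p j := fun p => by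
      rw [matrixForm_apply, Finset.sum_comm]
      simp
    simp only [PiLp.add_apply, PiLp.smul_apply, smul_eq_mul, hm] at h
    rw [Matrix.mul_apply, Matrix.one_apply]
    have h' : (EuclideanSpace.single l (1 : ℝ) : EuclideanSpace ℝ (Fin n)) i =
        if i = l then 1 else 0 := by simp
    rw [← h', h]
    simp only [N, Matrix.of_apply, Finset.sum_mul, ← Finset.sum_neg_distrib,
      ← Finset.sum_add_distrib]
    exact Finset.sum_congr rfl fun j _ => by rw [hsymm j l]; ring
  rw [hN]
  simp only [N, Matrix.of_apply, ← Finset.sum_sub_distrib, ← Finset.sum_add_distrib]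
  exact Finset.sum_congr rfl fun i _ => Finset.sum_congr rfl fun j _ => by ring

end CoordinateMetric

/-! ### Vector fields and metrics read in a chart. -/

section Charts

variable {n : ℕ} {M : Type*} [TopologicalSpace M] [ChartedSpace (EuclideanSpace ℝ (Fin n)) M]

/-- The expression of a vector field in the chart at `p`. -/
def coordField (X : (q : M) → TangentSpace (𝓡 n) q) (p : M) (x : EuclideanSpace ℝ (Fin n)) :
    EuclideanSpace ℝ (Fin n) :=
  (chartFrame p x).inverse (X ((extChartAt (𝓡 n) p).symm x))

theorem isOpen_chart_target (p : M) : IsOpen (extChartAt (𝓡 n) p).target :=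
  isOpen_extChartAt_target p

/-- The part of the chart at `p` that corresponds to `U`. -/
def chartDomain (p : M) (U : Set M) : Set (EuclideanSpace ℝ (Fin n)) :=
  (extChartAt (𝓡 n) p).target ∩ (extChartAt (𝓡 n) p).symm ⁻¹' U

theorem isOpen_chartDomain (p : M) {U : Set M} (hU : IsOpen U) :
    IsOpen (chartDomain (n := n) p U) :=
  (continuousOn_extChartAt_symm p).isOpen_inter_preimage (isOpen_chart_target p) hU

theorem mem_chartDomain {p : M} {U : Set M} (hp : p ∈ U) :
    extChartAt (𝓡 n) p p ∈ chartDomain p U :=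
  ⟨mem_extChartAt_target p, by simpa using hp⟩

variable [IsManifold (𝓡 n) ∞ M] {p : M} {x : EuclideanSpace ℝ (Fin n)} {U : Set M}

theorem isInvertible_chartFrame (hx : x ∈ (extChartAt (𝓡 n) p).target) :
    (chartFrame p x).IsInvertible := by
  have : IsManifold (𝓡 n) 1 M := IsManifold.of_le (n := ∞) (by simp)
  have h := isInvertible_mfderivWithin_extChartAt_symm (I := 𝓡 n) hx
  rwa [modelWithCornersSelf_coe, Set.range_id, mfderivWithin_univ] at h

theorem chartFrame_coordField (X : (q : M) → TangentSpace (𝓡 n) q)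
    (hx : x ∈ (extChartAt (𝓡 n) p).target) :
    chartFrame p x (coordField X p x) = X ((extChartAt (𝓡 n) p).symm x) :=
  (isInvertible_chartFrame hx).self_apply_inverse _

/-- The tangent space at `p` is modelled through the preferred chart at `p`, so that chart has
identity derivative there. This ties `coord` to `coordField`. -/
theorem chartFrame_self (p : M) (v : EuclideanSpace ℝ (Fin n)) :
    (show EuclideanSpace ℝ (Fin n) from chartFrame p (extChartAt (𝓡 n) p p) v) = v := by
  have : IsManifold (𝓡 n) 1 M := IsManifold.of_le (n := ∞) (by simp)
  have h := mfderivWithin_range_extChartAt_symm (I := 𝓡 n) (x := p)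
  rw [modelWithCornersSelf_coe, Set.range_id, mfderivWithin_univ] at h
  exact congrArg (fun L : EuclideanSpace ℝ (Fin n) →L[ℝ] EuclideanSpace ℝ (Fin n) => L v) h

theorem coordField_self (X : (q : M) → TangentSpace (𝓡 n) q) (p : M) :
    coordField X p (extChartAt (𝓡 n) p p) = (show EuclideanSpace ℝ (Fin n) from X p) := by
  have h := chartFrame_coordField X (mem_extChartAt_target (I := 𝓡 n) p)
  have h' := (chartFrame_self p (coordField X p (extChartAt (𝓡 n) p p))).symm.trans h
  refine h'.trans ?_
  have e : (extChartAt (𝓡 n) p).symm (extChartAt (𝓡 n) p p) = p := extChartAt_to_inv p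
  exact congrArg (fun q => (show EuclideanSpace ℝ (Fin n) from X q)) e

theorem contMDiffAt_chart_symm (hx : x ∈ (extChartAt (𝓡 n) p).target) :
    ContMDiffAt (𝓡 n) (𝓡 n) ∞ (extChartAt (𝓡 n) p).symm x :=
  (contMDiffOn_extChartAt_symm p).contMDiffAt ((isOpen_chart_target p).mem_nhds hx)

theorem contDiffAt_coordField {X : (q : M) → TangentSpace (𝓡 n) q} (hU : IsOpen U)
    (hX : ContMDiffOn (𝓡 n) (𝓡 n).tangent ∞ (fun q => (⟨q, X q⟩ : TangentBundle (𝓡 n) M)) U)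
    (hx : x ∈ chartDomain p U) : ContDiffAt ℝ ∞ (coordField X p) x := by
  have h := ContMDiffAt.mpullback_vectorField_preimage (I := 𝓡 n) (I' := 𝓡 n) (m := ∞) (n := ∞)
    (hX.contMDiffAt (hU.mem_nhds hx.2)) (contMDiffAt_chart_symm hx.1)
    (isInvertible_chartFrame hx.1) (by simp)
  exact contMDiffAt_vectorSpace_iff_contDiffAt.1 h

/-- `coordField` is the pullback by the inverse chart, and brackets are natural under pullback by
local diffeomorphisms. -/
theorem lieBracket_coordField {X Y : (q : M) → TangentSpace (𝓡 n) q} (hU : IsOpen U)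
    (hX : ContMDiffOn (𝓡 n) (𝓡 n).tangent ∞ (fun q => (⟨q, X q⟩ : TangentBundle (𝓡 n) M)) U)
    (hY : ContMDiffOn (𝓡 n) (𝓡 n).tangent ∞ (fun q => (⟨q, Y q⟩ : TangentBundle (𝓡 n) M)) U)
    (hx : x ∈ chartDomain p U) :
    VectorField.lieBracket ℝ (coordField X p) (coordField Y p) x =
      coordField (VectorField.mlieBracket (𝓡 n) X Y) p x := by
  have : IsManifold (𝓡 n) (minSmoothness ℝ 2) M := IsManifold.of_le (n := ∞) (by simpa using WithTop.coe_le_coe.2 (le_top : (2 : ℕ∞) ≤ ⊤))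
  have h := VectorField.mpullback_mlieBracket (I := 𝓡 n) (I' := 𝓡 n) (n := ∞)
    ((hX.contMDiffAt (hU.mem_nhds hx.2)).mdifferentiableAt (by simp))
    ((hY.contMDiffAt (hU.mem_nhds hx.2)).mdifferentiableAt (by simp))
    (contMDiffAt_chart_symm hx.1) (by simpa using WithTop.coe_le_coe.2 (le_top : (2 : ℕ∞) ≤ ⊤))
  rw [← VectorField.mlieBracketWithin_univ (I := 𝓡 n) (M := EuclideanSpace ℝ (Fin n)),
    VectorField.mlieBracketWithin_eq_lieBracketWithin] at h
  exact (h.trans (congrFun (VectorField.lieBracketWithin_univ (𝕜 := ℝ) (V := coordField X p)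
    (W := coordField Y p)) x)).symm

/-- The coordinate field is the image of a constant section under the tangent map of the inverse
chart, which is smooth. -/
theorem contMDiffAt_chartFrame (hx : x ∈ (extChartAt (𝓡 n) p).target)
    (v : EuclideanSpace ℝ (Fin n)) :
    ContMDiffAt (𝓡 n) (𝓡 n).tangent ∞ (fun y => (⟨(extChartAt (𝓡 n) p).symm y,
      chartFrame p y v⟩ : TangentBundle (𝓡 n) M)) x := by
  have h := (contMDiffOn_extChartAt_symm (I := 𝓡 n) (n := ∞) p).contMDiffOn_tangentMapWithin (m := ∞) (by simp)
    (isOpen_chart_target p).uniqueMDiffOn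
  have hv : ContMDiffAt (𝓡 n) (𝓡 n).tangent ∞ (fun y : EuclideanSpace ℝ (Fin n) =>
      (⟨y, v⟩ : TangentBundle (𝓡 n) (EuclideanSpace ℝ (Fin n)))) x :=
    contMDiffAt_vectorSpace_iff_contDiffAt.2 contDiffAt_const
  have h' : ContMDiffWithinAt (𝓡 n) (𝓡 n).tangent ∞ _ (extChartAt (𝓡 n) p).target x :=
    ContMDiffWithinAt.comp x (h (⟨x, v⟩ : TangentBundle (𝓡 n) (EuclideanSpace ℝ (Fin n))) hx)
      hv.contMDiffWithinAt (fun y hy => hy)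
  refine (h'.contMDiffAt ((isOpen_chart_target p).mem_nhds hx)).congr_of_eventuallyEq ?_
  filter_upwards [(isOpen_chart_target p).mem_nhds hx] with y hy
  simp only [Function.comp_apply, tangentMapWithin]
  rw [mfderivWithin_of_isOpen (isOpen_chart_target p) hy]
  rfl

theorem contDiffAt_bilinInChart (g : PseudoMetric n M) (hx : x ∈ (extChartAt (𝓡 n) p).target)
    (i j : Fin n) : ContDiffAt ℝ ∞ (fun y => bilinInChart g.val p y i j) x := by
  rw [← contMDiffAt_iff_contDiffAt]
  have : ContMDiffAt (𝓡 n) ((𝓡 n).prod 𝓘(ℝ, ℝ)) ∞ (fun y => Bundle.TotalSpace.mk' ℝ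
      (E := Bundle.Trivial M ℝ) ((extChartAt (𝓡 n) p).symm y)
      (g.val ((extChartAt (𝓡 n) p).symm y) (chartFrame p y (EuclideanSpace.single i 1))
        (chartFrame p y (EuclideanSpace.single j 1)))) x :=
    ContMDiffAt.clm_bundle_apply₂ (F₁ := EuclideanSpace ℝ (Fin n)) (F₂ := EuclideanSpace ℝ (Fin n))
      (g.smooth.contMDiffAt.comp x (contMDiffAt_chart_symm hx)) (contMDiffAt_chartFrame hx _)
      (contMDiffAt_chartFrame hx _)
  rw [Bundle.contMDiffAt_totalSpace] at this
  exact this.2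

end Charts

/-! ### Metric, Lie derivative and exterior derivative through a chart. -/

section ChartTransfer

variable {n : ℕ} {M : Type*} [TopologicalSpace M] [ChartedSpace (EuclideanSpace ℝ (Fin n)) M]

theorem matrixForm_bilinInChart
    (g : (q : M) → TangentSpace (𝓡 n) q →L[ℝ] TangentSpace (𝓡 n) q →L[ℝ] ℝ) (p : M)
    (x u v : EuclideanSpace ℝ (Fin n)) :
    matrixForm (bilinInChart g p x) u v =
      g ((extChartAt (𝓡 n) p).symm x) (chartFrame p x u) (chartFrame p x v) := by
  rw [matrixForm_apply]
  conv_rhs => rw [eq_sum_smul_single u, eq_sum_smul_single v]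
  simp only [map_sum, map_smul, sum_apply, smul_apply, smul_eq_mul, Finset.mul_sum]
  rw [Finset.sum_comm]
  refine Finset.sum_congr rfl fun i _ => Finset.sum_congr rfl fun j _ => ?_
  rw [bilinInChart, Matrix.of_apply]
  ring

variable [IsManifold (𝓡 n) ∞ M] {p : M} {x : EuclideanSpace ℝ (Fin n)} {U : Set M}

theorem bilin_eq_sum (T : EuclideanSpace ℝ (Fin n) →L[ℝ] EuclideanSpace ℝ (Fin n) →L[ℝ] ℝ)
    (u v : EuclideanSpace ℝ (Fin n)) : T u v =
    ∑ i, ∑ j, u i * v j * T (EuclideanSpace.single i 1) (EuclideanSpace.single j 1) := by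
  conv_lhs => rw [map_eq_sum T u, sum_apply]
  refine Finset.sum_congr rfl fun i _ => ?_
  rw [smul_apply, map_eq_sum, smul_eq_mul, Finset.mul_sum]
  exact Finset.sum_congr rfl fun j _ => (mul_assoc _ _ _).symm

theorem DifferentiableAt.component {V : EuclideanSpace ℝ (Fin n) → EuclideanSpace ℝ (Fin n)}
    (hV : DifferentiableAt ℝ V x) (k : Fin n) : DifferentiableAt ℝ (fun y => V y k) x :=
  (EuclideanSpace.proj (𝕜 := ℝ) k).differentiableAt.comp x hV

theorem fderiv_apply_component {V : EuclideanSpace ℝ (Fin n) → EuclideanSpace ℝ (Fin n)}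
    (hV : DifferentiableAt ℝ V x) (u : EuclideanSpace ℝ (Fin n)) (k : Fin n) :
    fderiv ℝ V x u k = fderiv ℝ (fun y => V y k) x u :=
  (congrArg (fun L : EuclideanSpace ℝ (Fin n) →L[ℝ] ℝ => L u)
    ((EuclideanSpace.proj (𝕜 := ℝ) k).hasFDerivAt.comp x hV.hasFDerivAt).fderiv).symm

theorem matrixForm_coordField
    (g : (q : M) → TangentSpace (𝓡 n) q →L[ℝ] TangentSpace (𝓡 n) q →L[ℝ] ℝ)
    (X Y : (q : M) → TangentSpace (𝓡 n) q) (hx : x ∈ (extChartAt (𝓡 n) p).target) :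
    matrixForm (bilinInChart g p x) (coordField X p x) (coordField Y p x) =
      g ((extChartAt (𝓡 n) p).symm x) (X _) (Y _) := by
  rw [matrixForm_bilinInChart, chartFrame_coordField X hx, chartFrame_coordField Y hx]

theorem bilinInChart_symm (g : PseudoMetric n M) (p : M) (x : EuclideanSpace ℝ (Fin n))
    (i j : Fin n) : bilinInChart g.val p x i j = bilinInChart g.val p x j i :=
  g.symm _ _ _

/-- A kernel vector of the coordinate matrix would represent a vector in the radical of `g`. -/
theorem isUnit_det_bilinInChart (g : PseudoMetric n M)
    (hx : x ∈ (extChartAt (𝓡 n) p).target) : IsUnit (bilinInChart g.val p x).det := by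
  rw [isUnit_iff_ne_zero]
  intro h
  obtain ⟨v, hv, hMv⟩ := Matrix.exists_mulVec_eq_zero_iff.2 h
  refine hv ?_
  have h0 : ∀ u : EuclideanSpace ℝ (Fin n),
      matrixForm (bilinInChart g.val p x) u (WithLp.toLp 2 v) = 0 := fun u => by
    rw [matrixForm_apply]
    refine Finset.sum_eq_zero fun i _ => ?_
    have := congrFun hMv i
    simp only [Matrix.mulVec, dotProduct, Pi.zero_apply] at this
    calc ∑ j, bilinInChart g.val p x i j * (u i * v j)
        = u i * ∑ j, bilinInChart g.val p x i j * v j := by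
          rw [Finset.mul_sum]; exact Finset.sum_congr rfl fun j _ => by ring
      _ = 0 := by rw [this, mul_zero]
  have h1 : chartFrame p x (WithLp.toLp 2 v) = 0 := by
    refine g.nondegenerate _ _ fun w => ?_
    have := h0 ((chartFrame p x).inverse w)
    rwa [matrixForm_bilinInChart, (isInvertible_chartFrame hx).self_apply_inverse, g.symm] at this
  have h2 := congrArg (chartFrame p x).inverse h1
  rw [(isInvertible_chartFrame hx).inverse_apply_self, map_zero] at h2
  exact congrArg WithLp.ofLp h2

theorem isLeviCivitaOn_chart (g : PseudoMetric n M) (p : M) (hU : IsOpen U) :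
    IsLeviCivitaOn (fun x => matrixForm (bilinInChart g.val p x))
      (connectionCoeff (bilinInChart g.val p)) (chartDomain p U) :=
  isLeviCivitaOn_connectionCoeff (isOpen_chartDomain p hU)
    (fun _ hx => contDiffAt_bilinInChart g hx.1)
    (fun x _ => bilinInChart_symm g p x) (fun _ hx => isUnit_det_bilinInChart g hx.1)

theorem contDiffAt_comp_chart_symm {a : M → ℝ} (hU : IsOpen U)
    (ha : ContMDiffOn (𝓡 n) 𝓘(ℝ, ℝ) ∞ a U) (hx : x ∈ chartDomain p U) :
    ContDiffAt ℝ ∞ (a ∘ (extChartAt (𝓡 n) p).symm) x :=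
  contMDiffAt_iff_contDiffAt.1
    ((ha.contMDiffAt (hU.mem_nhds hx.2)).comp x (contMDiffAt_chart_symm hx.1))

/-- Valid at every point of the chart at `p`, not only its centre, although `dirDeriv` is formed in
the chart of the point itself: the chain rule compares the two. -/
theorem fderiv_comp_chart_symm {a : M → ℝ} (hU : IsOpen U)
    (ha : ContMDiffOn (𝓡 n) 𝓘(ℝ, ℝ) ∞ a U) (V : (q : M) → TangentSpace (𝓡 n) q)
    (hx : x ∈ chartDomain p U) :
    fderiv ℝ (a ∘ (extChartAt (𝓡 n) p).symm) x (coordField V p x) =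
      dirDeriv a (V ((extChartAt (𝓡 n) p).symm x)) := by
  have h := mfderiv_comp x ((ha.contMDiffAt (hU.mem_nhds hx.2)).mdifferentiableAt (by simp))
    ((contMDiffAt_chart_symm hx.1).mdifferentiableAt (by simp))
  rw [mfderiv_eq_fderiv] at h
  have h' := congrArg (fun L : EuclideanSpace ℝ (Fin n) →L[ℝ] ℝ => L (coordField V p x)) h
  refine h'.trans ?_
  rw [dirDeriv, ← chartFrame_coordField V hx.1]
  rfl

theorem dirDeriv_eq_fderiv {a : M → ℝ} (hU : IsOpen U)
    (ha : ContMDiffOn (𝓡 n) 𝓘(ℝ, ℝ) ∞ a U) (V : (q : M) → TangentSpace (𝓡 n) q) (hp : p ∈ U) :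
    dirDeriv a (V p) = fderiv ℝ (a ∘ (extChartAt (𝓡 n) p).symm) (extChartAt (𝓡 n) p p)
      (coordField V p (extChartAt (𝓡 n) p p)) := by
  rw [fderiv_comp_chart_symm hU ha V (mem_chartDomain hp), extChartAt_to_inv]

theorem coord_eq (X : (q : M) → TangentSpace (𝓡 n) q) (p : M) (i : Fin n) :
    coord (X p) i = coordField X p (extChartAt (𝓡 n) p p) i := by
  rw [coordField_self]
  rfl

set_option synthInstance.maxHeartbeats 200000 in
theorem sum_lieDeriv_eq {G : EuclideanSpace ℝ (Fin n) → Matrix (Fin n) (Fin n) ℝ}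
    {V : EuclideanSpace ℝ (Fin n) → EuclideanSpace ℝ (Fin n)}
    (hG : ∀ i j, ContDiffAt ℝ ∞ (fun y => G y i j) x) (hV : DifferentiableAt ℝ V x)
    (i j : Fin n) :
    ∑ k, (V x k * partialDeriv k (fun y => G y i j) x
      + G x k j * partialDeriv i (fun y => V y k) x
      + G x i k * partialDeriv j (fun y => V y k) x) =
    fderiv ℝ (fun y => matrixForm (G y)) x (V x) (EuclideanSpace.single i 1)
        (EuclideanSpace.single j 1)
      + matrixForm (G x) (fderiv ℝ V x (EuclideanSpace.single i 1)) (EuclideanSpace.single j 1)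
      + matrixForm (G x) (EuclideanSpace.single i 1)
          (fderiv ℝ V x (EuclideanSpace.single j 1)) := by
  rw [map_eq_sum (fderiv ℝ (fun y => matrixForm (G y)) x),
    map_eq_sum (matrixForm (G x) (EuclideanSpace.single i 1)),
    map_eq_sum (matrixForm (G x)), Finset.sum_add_distrib, Finset.sum_add_distrib]
  simp only [sum_apply, smul_apply, smul_eq_mul, fderiv_matrixForm_single hG, matrixForm_single,
    fderiv_apply_component hV]
  refine congrArg₂ _ (congrArg₂ _ rfl ?_) ?_ <;>
  exact Finset.sum_congr rfl fun k _ => mul_comm _ _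

-- The index formula is tensorial, whereas the bracket form only needs the brackets and the
-- derivative of g(Y, Z), which is zero for fields of a pseudo-orthonormal frame.
set_option synthInstance.maxHeartbeats 200000 in
theorem lieDerivBilin_apply (g : PseudoMetric n M) {X Y Z : (q : M) → TangentSpace (𝓡 n) q}
    (hU : IsOpen U) (hp : p ∈ U)
    (hX : ContMDiffOn (𝓡 n) (𝓡 n).tangent ∞ (fun q => (⟨q, X q⟩ : TangentBundle (𝓡 n) M)) U)
    (hY : ContMDiffOn (𝓡 n) (𝓡 n).tangent ∞ (fun q => (⟨q, Y q⟩ : TangentBundle (𝓡 n) M)) U)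
    (hZ : ContMDiffOn (𝓡 n) (𝓡 n).tangent ∞ (fun q => (⟨q, Z q⟩ : TangentBundle (𝓡 n) M)) U) :
    lieDerivBilin X g.val p (Y p) (Z p) =
      fderiv ℝ (fun x => matrixForm (bilinInChart g.val p x) (coordField Y p x)
        (coordField Z p x)) (extChartAt (𝓡 n) p p) (coordField X p (extChartAt (𝓡 n) p p))
      - g.val p (VectorField.mlieBracket (𝓡 n) X Y p) (Z p)
      - g.val p (Y p) (VectorField.mlieBracket (𝓡 n) X Z p) := by
  set x₀ := extChartAt (𝓡 n) p p with hx₀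
  have hx : x₀ ∈ chartDomain p U := mem_chartDomain hp
  have dX := ContDiffAt.differentiableAt_of_infty (contDiffAt_coordField hU hX hx)
  have dY := ContDiffAt.differentiableAt_of_infty (contDiffAt_coordField hU hY hx)
  have dZ := ContDiffAt.differentiableAt_of_infty (contDiffAt_coordField hU hZ hx)
  have hG := contDiffAt_bilinInChart g hx.1
  rw [fderiv_form (ContDiffAt.differentiableAt_of_infty (contDiffAt_matrixForm hG)) dY dZ]
  have e1 : g.val p (VectorField.mlieBracket (𝓡 n) X Y p) (Z p) =
      matrixForm (bilinInChart g.val p x₀)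
        (VectorField.lieBracket ℝ (coordField X p) (coordField Y p) x₀) (coordField Z p x₀) := by
    rw [lieBracket_coordField hU hX hY hx, matrixForm_coordField _ _ _ hx.1, extChartAt_to_inv]
  have e2 : g.val p (Y p) (VectorField.mlieBracket (𝓡 n) X Z p) =
      matrixForm (bilinInChart g.val p x₀) (coordField Y p x₀)
        (VectorField.lieBracket ℝ (coordField X p) (coordField Z p) x₀) := by
    rw [lieBracket_coordField hU hX hZ hx, matrixForm_coordField _ _ _ hx.1, extChartAt_to_inv]
  rw [e1, e2, VectorField.lieBracket, VectorField.lieBracket, map_sub, map_sub, sub_apply]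
  set T : EuclideanSpace ℝ (Fin n) →L[ℝ] EuclideanSpace ℝ (Fin n) →L[ℝ] ℝ :=
    fderiv ℝ (fun y => matrixForm (bilinInChart g.val p y)) x₀ (coordField X p x₀)
      + (matrixForm (bilinInChart g.val p x₀)).comp (fderiv ℝ (coordField X p) x₀)
      + ((matrixForm (bilinInChart g.val p x₀)).flip.comp (fderiv ℝ (coordField X p) x₀)).flip
    with hT
  have hTa : ∀ u v, T u v =
      fderiv ℝ (fun y => matrixForm (bilinInChart g.val p y)) x₀ (coordField X p x₀) u v
      + matrixForm (bilinInChart g.val p x₀) (fderiv ℝ (coordField X p) x₀ u) v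
      + matrixForm (bilinInChart g.val p x₀) u (fderiv ℝ (coordField X p) x₀ v) := fun u v => by
    simp only [hT, add_apply, ContinuousLinearMap.comp_apply, ContinuousLinearMap.flip_apply]
  have key : lieDerivBilin X g.val p (Y p) (Z p) = T (coordField Y p x₀) (coordField Z p x₀) := by
    rw [bilin_eq_sum, lieDerivBilin]
    refine Finset.sum_congr rfl fun i _ => Finset.sum_congr rfl fun j _ => ?_
    rw [coord_eq, coord_eq, ← hx₀, hTa]
    exact congrArg _ (sum_lieDeriv_eq hG dX i j)
  rw [key, hTa]
  ring

theorem contDiffAt_formInChart {η : (q : M) → TangentSpace (𝓡 n) q →L[ℝ] ℝ}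
    (hη : ContMDiff (𝓡 n) ((𝓡 n).prod 𝓘(ℝ, EuclideanSpace ℝ (Fin n) →L[ℝ] ℝ)) ∞
      (fun p => Bundle.TotalSpace.mk' (EuclideanSpace ℝ (Fin n) →L[ℝ] ℝ)
        (E := fun q : M => TangentSpace (𝓡 n) q →L[ℝ] ℝ) p (η p)))
    (hx : x ∈ (extChartAt (𝓡 n) p).target) (i : Fin n) :
    ContDiffAt ℝ ∞ (formInChart η p i) x := by
  rw [← contMDiffAt_iff_contDiffAt]
  have : ContMDiffAt (𝓡 n) ((𝓡 n).prod 𝓘(ℝ, ℝ)) ∞ (fun y => Bundle.TotalSpace.mk' ℝ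
      (E := Bundle.Trivial M ℝ) ((extChartAt (𝓡 n) p).symm y)
      (η ((extChartAt (𝓡 n) p).symm y) (chartFrame p y (EuclideanSpace.single i 1)))) x :=
    ContMDiffAt.clm_bundle_apply (F₁ := EuclideanSpace ℝ (Fin n))
      (hη.contMDiffAt.comp x (contMDiffAt_chart_symm hx)) (contMDiffAt_chartFrame hx _)
  rw [Bundle.contMDiffAt_totalSpace] at this
  exact this.2

theorem form_eq_sum (η : (q : M) → TangentSpace (𝓡 n) q →L[ℝ] ℝ)
    (X : (q : M) → TangentSpace (𝓡 n) q) (hx : x ∈ (extChartAt (𝓡 n) p).target) :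
    η ((extChartAt (𝓡 n) p).symm x) (X _) = ∑ i, formInChart η p i x * coordField X p x i := by
  rw [← chartFrame_coordField X hx]
  conv_lhs => rw [eq_sum_smul_single (coordField X p x)]
  simp only [map_sum, map_smul, smul_eq_mul]
  exact Finset.sum_congr rfl fun i _ => mul_comm _ _

-- With η(X) and η(Y) constant, only the bracket term of 2dη(X, Y) survives. The factor −2 is the
-- normalization that later produces −2ξ in [e, φe].
set_option synthInstance.maxHeartbeats 200000 in
theorem extDerivForm_apply {η : (q : M) → TangentSpace (𝓡 n) q →L[ℝ] ℝ}
    (hη : ContMDiff (𝓡 n) ((𝓡 n).prod 𝓘(ℝ, EuclideanSpace ℝ (Fin n) →L[ℝ] ℝ)) ∞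
      (fun p => Bundle.TotalSpace.mk' (EuclideanSpace ℝ (Fin n) →L[ℝ] ℝ)
        (E := fun q : M => TangentSpace (𝓡 n) q →L[ℝ] ℝ) p (η p)))
    {X Y : (q : M) → TangentSpace (𝓡 n) q} (hU : IsOpen U) (hp : p ∈ U)
    (hX : ContMDiffOn (𝓡 n) (𝓡 n).tangent ∞ (fun q => (⟨q, X q⟩ : TangentBundle (𝓡 n) M)) U)
    (hY : ContMDiffOn (𝓡 n) (𝓡 n).tangent ∞ (fun q => (⟨q, Y q⟩ : TangentBundle (𝓡 n) M)) U)
    (cX : ℝ) (hcX : ∀ q ∈ U, η q (X q) = cX) (cY : ℝ) (hcY : ∀ q ∈ U, η q (Y q) = cY) :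
    η p (VectorField.mlieBracket (𝓡 n) X Y p) = -2 * extDerivForm η p (X p) (Y p) := by
  set x₀ := extChartAt (𝓡 n) p p with hx₀
  have hx : x₀ ∈ chartDomain p U := mem_chartDomain hp
  have dX := ContDiffAt.differentiableAt_of_infty (contDiffAt_coordField hU hX hx)
  have dY := ContDiffAt.differentiableAt_of_infty (contDiffAt_coordField hU hY hx)
  have dη := fun i => ContDiffAt.differentiableAt_of_infty
    (contDiffAt_formInChart (p := p) hη hx.1 i)
  -- The product rule for a constant η(Z) trades derivatives of the field for derivatives of the
  -- form.
  have const : ∀ {Z : (q : M) → TangentSpace (𝓡 n) q} {c : ℝ} (u : EuclideanSpace ℝ (Fin n)),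
      DifferentiableAt ℝ (coordField Z p) x₀ → (∀ q ∈ U, η q (Z q) = c) →
      ∑ i, (formInChart η p i x₀ * fderiv ℝ (coordField Z p) x₀ u i +
        coordField Z p x₀ i * fderiv ℝ (formInChart η p i) x₀ u) = 0 := fun {Z c} u dZ hc => by
    have h1 : (fun y => ∑ i, formInChart η p i y * coordField Z p y i) =ᶠ[𝓝 x₀] fun _ => c := by
      filter_upwards [(isOpen_chartDomain p hU).mem_nhds hx] with y hy
      rw [← form_eq_sum η Z hy.1, hc _ hy.2]
    have h2 := h1.fderiv_eq (𝕜 := ℝ)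
    have h3 := HasFDerivAt.fun_sum (𝕜 := ℝ) (u := Finset.univ) fun (i : Fin n) _ =>
      HasFDerivAt.fun_mul (dη i).hasFDerivAt (DifferentiableAt.component dZ i).hasFDerivAt
    rw [h3.fderiv] at h2
    have h4 := congrArg (fun L : EuclideanSpace ℝ (Fin n) →L[ℝ] ℝ => L u) h2
    simp only [sum_apply, add_apply, smul_apply, smul_eq_mul, fderiv_fun_const, Pi.zero_apply,
      zero_apply, ← fderiv_apply_component dZ] at h4
    exact h4
  have hbr : η p (VectorField.mlieBracket (𝓡 n) X Y p) = ∑ i, formInChart η p i x₀ *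
      VectorField.lieBracket ℝ (coordField X p) (coordField Y p) x₀ i := by
    rw [lieBracket_coordField hU hX hY hx, ← form_eq_sum _ _ hx.1, extChartAt_to_inv]
  have h1 := const (coordField X p x₀) dY hcY
  have h2 := const (coordField Y p x₀) dX hcX
  simp only [Finset.sum_add_distrib] at h1 h2
  have hd : extDerivForm η p (X p) (Y p) = 1 / 2 *
      (∑ i, coordField Y p x₀ i * fderiv ℝ (formInChart η p i) x₀ (coordField X p x₀)
        - ∑ i, coordField X p x₀ i * fderiv ℝ (formInChart η p i) x₀ (coordField Y p x₀)) := by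
    simp only [extDerivForm, coord_eq, ← hx₀, fderiv_eq_sum_partialDeriv, Finset.mul_sum, mul_sub,
      Finset.sum_sub_distrib]
    rw [Finset.sum_comm]
    refine congrArg₂ _ ?_ ?_ <;>
    exact Finset.sum_congr rfl fun i _ => Finset.sum_congr rfl fun j _ => by ring
  rw [hbr, hd]
  simp only [VectorField.lieBracket, PiLp.sub_apply, mul_sub, Finset.sum_sub_distrib]
  linarith

end ChartTransfer

/-- The dual functionals show independence, the dimension turns it into spanning, and evaluating
them identifies the coefficients. -/
theorem eq_sum_smul_of_dual {E : Type*} [AddCommGroup E] [Module ℝ E]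
    (hE : Module.finrank ℝ E = 3) {a b c : E} {α β γ : E →ₗ[ℝ] ℝ}
    (haa : α a = 1) (hab : α b = 0) (hac : α c = 0) (hba : β a = 0) (hbb : β b = 1)
    (hbc : β c = 0) (hca : γ a = 0) (hcb : γ b = 0) (hcc : γ c = 1) (v : E) :
    v = α v • a + β v • b + γ v • c := by
  have hli : LinearIndependent ℝ ![a, b, c] := by
    rw [Fintype.linearIndependent_iff]
    intro g hg
    rw [Fin.sum_univ_three] at hg
    have h0 := congrArg α hg
    have h1 := congrArg β hg
    have h2 := congrArg γ hg
    simp [haa, hab, hac, hba, hbb, hbc, hca, hcb, hcc] at h0 h1 h2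
    intro i
    fin_cases i
    exacts [h0, h1, h2]
  have : FiniteDimensional ℝ E := Module.finite_of_finrank_pos (by omega)
  have hspan := hli.span_eq_top_of_card_eq_finrank' (by simp [hE])
  have hv : v ∈ Submodule.span ℝ (Set.range ![a, b, c]) := hspan ▸ Submodule.mem_top
  obtain ⟨k, hk⟩ := (Submodule.mem_span_range_iff_exists_fun ℝ).1 hv
  rw [Fin.sum_univ_three] at hk
  simp only [Matrix.cons_val] at hk
  simp [← hk, haa, hab, hac, hba, hbb, hbc, hca, hcb, hcc]

/-! ### φ-bases: pointwise algebra, Ricci tensor and L_ξ g. -/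

namespace AlmostParacontactMetric

section Pointwise

variable {n : ℕ} {M : Type*} [TopologicalSpace M] [ChartedSpace (EuclideanSpace ℝ (Fin n)) M]
  [IsManifold (𝓡 n) ∞ M] (S : AlmostParacontactMetric n M)

theorem g_ξ (q : M) (v : TangentSpace (𝓡 n) q) : S.g.val q (S.ξ q) v = S.η q v := by
  have h := S.compatible q (S.ξ q) v
  rw [S.φ_ξ, S.η_ξ, map_zero, zero_apply] at h
  linarith

theorem g_φ_left (q : M) (v w : TangentSpace (𝓡 n) q) :
    S.g.val q (S.φ q v) w = - S.g.val q v (S.φ q w) := by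
  have h := S.compatible q v (S.φ q w)
  rw [S.φ_φ, S.η_φ, map_sub, map_smul, S.g.symm q _ (S.ξ q), S.g_ξ, S.η_φ] at h
  simpa using h

theorem g_self_φ (q : M) (v : TangentSpace (𝓡 n) q) : S.g.val q v (S.φ q v) = 0 := by
  have h := S.g_φ_left q v v
  rw [S.g.symm] at h
  linarith

variable {S} {U : Set M} {X Y : (q : M) → TangentSpace (𝓡 n) q}

theorem contMDiffOn_applyφ
    (hX : ContMDiffOn (𝓡 n) (𝓡 n).tangent ∞ (fun q => (⟨q, X q⟩ : TangentBundle (𝓡 n) M)) U) :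
    ContMDiffOn (𝓡 n) (𝓡 n).tangent ∞
      (fun q => (⟨q, S.applyφ X q⟩ : TangentBundle (𝓡 n) M)) U :=
  ContMDiffOn.clm_bundle_apply (F₁ := EuclideanSpace ℝ (Fin n)) (F₂ := EuclideanSpace ℝ (Fin n))
    S.smooth_φ.contMDiffOn hX

theorem contMDiffOn_ξ : ContMDiffOn (𝓡 n) (𝓡 n).tangent ∞
    (fun q => (⟨q, S.ξ q⟩ : TangentBundle (𝓡 n) M)) U := S.smooth_ξ.contMDiffOn

theorem _root_.Paracontact.PseudoMetric.contMDiffOn_val (g : PseudoMetric n M)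
    (hX : ContMDiffOn (𝓡 n) (𝓡 n).tangent ∞ (fun q => (⟨q, X q⟩ : TangentBundle (𝓡 n) M)) U)
    (hY : ContMDiffOn (𝓡 n) (𝓡 n).tangent ∞ (fun q => (⟨q, Y q⟩ : TangentBundle (𝓡 n) M)) U) :
    ContMDiffOn (𝓡 n) 𝓘(ℝ, ℝ) ∞ (fun q => g.val q (X q) (Y q)) U := by
  intro q hq
  have : ContMDiffWithinAt (𝓡 n) ((𝓡 n).prod 𝓘(ℝ, ℝ)) ∞ (fun q => Bundle.TotalSpace.mk' ℝ
      (E := Bundle.Trivial M ℝ) q (g.val q (X q) (Y q))) U q :=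
    ContMDiffWithinAt.clm_bundle_apply₂ (F₁ := EuclideanSpace ℝ (Fin n))
      (F₂ := EuclideanSpace ℝ (Fin n)) g.smooth.contMDiffAt.contMDiffWithinAt (hX q hq) (hY q hq)
  rw [Bundle.contMDiffWithinAt_totalSpace] at this
  exact this.2

end Pointwise

variable {M : Type*} [TopologicalSpace M] [ChartedSpace (EuclideanSpace ℝ (Fin 3)) M]
  [IsManifold (𝓡 3) ∞ M] {S : AlmostParacontactMetric 3 M} {U : Set M}
  {e : (q : M) → TangentSpace (𝓡 3) q}

theorem IsPhiBasisOn.span (hb : S.IsPhiBasisOn e U) {q : M} (hq : q ∈ U)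
    (v : TangentSpace (𝓡 3) q) :
    v = S.g.val q v (S.ξ q) • S.ξ q + S.g.val q v (e q) • e q
      + (-S.g.val q v (S.φ q (e q))) • S.φ q (e q) := by
  have hE : Module.finrank ℝ (TangentSpace (𝓡 3) q) = 3 :=
    finrank_euclideanSpace_fin (𝕜 := ℝ) (n := 3)
  have h := eq_sum_smul_of_dual hE (a := S.ξ q) (b := e q) (c := S.φ q (e q))
    (α := (S.g.val q (S.ξ q)).toLinearMap) (β := (S.g.val q (e q)).toLinearMap)
    (γ := -(S.g.val q (S.φ q (e q))).toLinearMap) (hb.ξ_ξ q hq) (hb.ξ_e q hq) (hb.ξ_φe q hq)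
    ((S.g.symm _ _ _).trans (hb.ξ_e q hq)) (hb.e_e q hq) (hb.e_φe q hq)
    (neg_eq_zero.2 ((S.g.symm _ _ _).trans (hb.ξ_φe q hq)))
    (neg_eq_zero.2 ((S.g.symm _ _ _).trans (hb.e_φe q hq)))
    (neg_eq_iff_eq_neg.2 (hb.φe_φe q hq)) v
  rw [S.g.symm q v, S.g.symm q v, S.g.symm q v]
  exact h

variable (S) in
/-- A φ-basis with the structure functions of its Lie brackets. -/
structure IsAdaptedFrameOn (e : (q : M) → TangentSpace (𝓡 3) q) (U : Set M)
    (A b s a₄ a₅ : M → ℝ) : Prop where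
  basis : S.IsPhiBasisOn e U
  isOpen : IsOpen U
  smooth_A : ContMDiffOn (𝓡 3) 𝓘(ℝ, ℝ) ∞ A U
  smooth_b : ContMDiffOn (𝓡 3) 𝓘(ℝ, ℝ) ∞ b U
  smooth_s : ContMDiffOn (𝓡 3) 𝓘(ℝ, ℝ) ∞ s U
  smooth_a₄ : ContMDiffOn (𝓡 3) 𝓘(ℝ, ℝ) ∞ a₄ U
  smooth_a₅ : ContMDiffOn (𝓡 3) 𝓘(ℝ, ℝ) ∞ a₅ U
  bracket_ξ_e : ∀ q ∈ U, VectorField.mlieBracket (𝓡 3) S.ξ e q =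
    A q • e q + (s q + 1 + b q) • S.φ q (e q)
  bracket_ξ_φe : ∀ q ∈ U, VectorField.mlieBracket (𝓡 3) S.ξ (S.applyφ e) q =
    (s q + 1 - b q) • e q - A q • S.φ q (e q)
  bracket_e_φe : ∀ q ∈ U, VectorField.mlieBracket (𝓡 3) e (S.applyφ e) q =
    (-2 : ℝ) • S.ξ q + a₄ q • e q - a₅ q • S.φ q (e q)

theorem IsPhiBasisOn.span_chart (hb : S.IsPhiBasisOn e U) (p : M)
    {x : EuclideanSpace ℝ (Fin 3)} (hx : x ∈ chartDomain p U) (v : EuclideanSpace ℝ (Fin 3)) :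
    v = matrixForm (bilinInChart S.g.val p x) v (coordField S.ξ p x) • coordField S.ξ p x
      + matrixForm (bilinInChart S.g.val p x) v (coordField e p x) • coordField e p x
      + (-matrixForm (bilinInChart S.g.val p x) v (coordField (S.applyφ e) p x)) •
        coordField (S.applyφ e) p x := by
  have h := congrArg (chartFrame p x).inverse (hb.span hx.2 (chartFrame p x v))
  rw [(isInvertible_chartFrame hx.1).inverse_apply_self, map_add, map_add, map_smul, map_smul,
    map_smul] at h
  rw [matrixForm_bilinInChart, matrixForm_bilinInChart, matrixForm_bilinInChart,
    chartFrame_coordField _ hx.1, chartFrame_coordField _ hx.1, chartFrame_coordField _ hx.1]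
  exact h

variable {A b s a₄ a₅ : M → ℝ}

/-- The passage from manifold to vector space: inner products and brackets are preserved by the
chart, so the curvature computation for frames in a vector space applies. -/
theorem IsAdaptedFrameOn.isPhiFrameOn (h : S.IsAdaptedFrameOn e U A b s a₄ a₅) (p : M) :
    IsPhiFrameOn (fun x => matrixForm (bilinInChart S.g.val p x)) (chartDomain p U)
      (coordField S.ξ p) (coordField e p) (coordField (S.applyφ e) p)
      (A ∘ (extChartAt (𝓡 3) p).symm) (b ∘ (extChartAt (𝓡 3) p).symm)
      (s ∘ (extChartAt (𝓡 3) p).symm) (a₄ ∘ (extChartAt (𝓡 3) p).symm)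
      (a₅ ∘ (extChartAt (𝓡 3) p).symm) where
  contDiff_ξ _ hx := contDiffAt_coordField h.isOpen contMDiffOn_ξ hx
  contDiff_e _ hx := contDiffAt_coordField h.isOpen h.basis.smooth hx
  contDiff_f _ hx := contDiffAt_coordField h.isOpen (contMDiffOn_applyφ h.basis.smooth) hx
  contDiff_A _ hx := contDiffAt_comp_chart_symm h.isOpen h.smooth_A hx
  contDiff_b _ hx := contDiffAt_comp_chart_symm h.isOpen h.smooth_b hx
  contDiff_s _ hx := contDiffAt_comp_chart_symm h.isOpen h.smooth_s hx
  contDiff_a₄ _ hx := contDiffAt_comp_chart_symm h.isOpen h.smooth_a₄ hx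
  contDiff_a₅ _ hx := contDiffAt_comp_chart_symm h.isOpen h.smooth_a₅ hx
  ξ_ξ x hx := (matrixForm_coordField _ _ _ hx.1).trans (h.basis.ξ_ξ _ hx.2)
  e_e x hx := (matrixForm_coordField _ _ _ hx.1).trans (h.basis.e_e _ hx.2)
  f_f x hx := (matrixForm_coordField _ _ _ hx.1).trans (h.basis.φe_φe _ hx.2)
  ξ_e x hx := (matrixForm_coordField _ _ _ hx.1).trans (h.basis.ξ_e _ hx.2)
  ξ_f x hx := (matrixForm_coordField _ _ _ hx.1).trans (h.basis.ξ_φe _ hx.2)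
  e_f x hx := (matrixForm_coordField _ _ _ hx.1).trans (h.basis.e_φe _ hx.2)
  span x hx v := h.basis.span_chart p hx v
  bracket_ξ_e x hx := by
    rw [lieBracket_coordField h.isOpen contMDiffOn_ξ h.basis.smooth hx, coordField,
      h.bracket_ξ_e _ hx.2, map_add, map_smul, map_smul]
    rfl
  bracket_ξ_f x hx := by
    rw [lieBracket_coordField h.isOpen contMDiffOn_ξ (contMDiffOn_applyφ h.basis.smooth) hx,
      coordField, h.bracket_ξ_φe _ hx.2, map_sub, map_smul, map_smul]
    rfl
  bracket_e_f x hx := by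
    rw [lieBracket_coordField h.isOpen h.basis.smooth (contMDiffOn_applyφ h.basis.smooth) hx,
      coordField, h.bracket_e_φe _ hx.2, map_sub, map_add, map_smul, map_smul, map_smul]
    rfl

theorem IsPhiBasisOn.ricci_eq_frameRicci (hb : S.IsPhiBasisOn e U) {q : M} (hq : q ∈ U)
    (X Y : (q : M) → TangentSpace (𝓡 3) q) :
    S.g.ricci q (X q) (Y q) = frameRicci (fun x => matrixForm (bilinInChart S.g.val q x))
      (connectionCoeff (bilinInChart S.g.val q)) (coordField S.ξ q) (coordField e q)
      (coordField (S.applyφ e) q) (extChartAt (𝓡 3) q q)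
      (coordField X q (extChartAt (𝓡 3) q q)) (coordField Y q (extChartAt (𝓡 3) q q)) := by
  have hx := mem_chartDomain (n := 3) hq
  rw [← sum_ricciComp_eq_frameRicci (contDiffAt_bilinInChart S.g hx.1)
    (isUnit_det_bilinInChart S.g hx.1) (hb.span_chart q hx)]
  simp only [PseudoMetric.ricci, coord_eq]

theorem IsPhiBasisOn.scalarCurvature_eq (hb : S.IsPhiBasisOn e U) {q : M} (hq : q ∈ U) :
    S.g.scalarCurvature q = S.g.ricci q (S.ξ q) (S.ξ q) + S.g.ricci q (e q) (e q)
      - S.g.ricci q (S.φ q (e q)) (S.φ q (e q)) := by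
  have hx := mem_chartDomain (n := 3) hq
  have h := sum_inv_mul_eq (bilinInChart_symm S.g q _) (hb.span_chart q hx)
    fun i j => ricciComp (bilinInChart S.g.val q) i j (extChartAt (𝓡 3) q q)
  simp only [← coord_eq] at h
  exact h

theorem IsAdaptedFrameOn.ricci_eq (h : S.IsAdaptedFrameOn e U A b s a₄ a₅) {q : M}
    (hq : q ∈ U) :
    S.g.ricci q (S.ξ q) (S.ξ q) = -2 * (A q ^ 2 - b q ^ 2 + 1) ∧
    S.g.ricci q (S.ξ q) (e q) = -(dirDeriv A (e q) + dirDeriv b (S.φ q (e q))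
      + 2 * b q * a₄ q + 2 * A q * a₅ q) ∧
    S.g.ricci q (e q) (S.ξ q) = -(dirDeriv A (e q) + dirDeriv b (S.φ q (e q))
      + 2 * b q * a₄ q + 2 * A q * a₅ q) ∧
    S.g.ricci q (S.ξ q) (S.φ q (e q)) = dirDeriv b (e q) + dirDeriv A (S.φ q (e q))
      + 2 * A q * a₄ q + 2 * b q * a₅ q ∧
    S.g.ricci q (S.φ q (e q)) (S.ξ q) = dirDeriv b (e q) + dirDeriv A (S.φ q (e q))
      + 2 * A q * a₄ q + 2 * b q * a₅ q ∧
    S.g.ricci q (e q) (S.φ q (e q)) = -(dirDeriv b (S.ξ q) + 2 * A q * s q) ∧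
    S.g.ricci q (S.φ q (e q)) (e q) = -(dirDeriv b (S.ξ q) + 2 * A q * s q) ∧
    S.g.ricci q (e q) (e q) + S.g.ricci q (S.φ q (e q)) (S.φ q (e q)) =
      2 * (dirDeriv A (S.ξ q) + 2 * b q * s q) := by
  have key := (h.isPhiFrameOn q).frameRicci_eq (isLeviCivitaOn_chart S.g q h.isOpen)
    (mem_chartDomain hq)
  simp only [← h.basis.ricci_eq_frameRicci hq, ← dirDeriv_eq_fderiv h.isOpen h.smooth_A _ hq,
    ← dirDeriv_eq_fderiv h.isOpen h.smooth_b _ hq, Function.comp_apply, extChartAt_to_inv] at key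
  exact key

theorem IsAdaptedFrameOn.lieDerivBilin_eq (h : S.IsAdaptedFrameOn e U A b s a₄ a₅) {q : M}
    (hq : q ∈ U) :
    lieDerivBilin S.ξ S.g.val q (S.ξ q) (S.ξ q) = 0 ∧
    lieDerivBilin S.ξ S.g.val q (S.ξ q) (e q) = 0 ∧
    lieDerivBilin S.ξ S.g.val q (e q) (S.ξ q) = 0 ∧
    lieDerivBilin S.ξ S.g.val q (S.ξ q) (S.φ q (e q)) = 0 ∧
    lieDerivBilin S.ξ S.g.val q (S.φ q (e q)) (S.ξ q) = 0 ∧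
    lieDerivBilin S.ξ S.g.val q (e q) (e q) = -2 * A q ∧
    lieDerivBilin S.ξ S.g.val q (e q) (S.φ q (e q)) = 2 * b q ∧
    lieDerivBilin S.ξ S.g.val q (S.φ q (e q)) (e q) = 2 * b q ∧
    lieDerivBilin S.ξ S.g.val q (S.φ q (e q)) (S.φ q (e q)) = -2 * A q := by
  have const : ∀ {Y Z : (q : M) → TangentSpace (𝓡 3) q} {c : ℝ},
      ContMDiffOn (𝓡 3) (𝓡 3).tangent ∞ (fun q => (⟨q, Y q⟩ : TangentBundle (𝓡 3) M)) U →
      ContMDiffOn (𝓡 3) (𝓡 3).tangent ∞ (fun q => (⟨q, Z q⟩ : TangentBundle (𝓡 3) M)) U →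
      (∀ q ∈ U, S.g.val q (Y q) (Z q) = c) → lieDerivBilin S.ξ S.g.val q (Y q) (Z q) =
        - S.g.val q (VectorField.mlieBracket (𝓡 3) S.ξ Y q) (Z q)
        - S.g.val q (Y q) (VectorField.mlieBracket (𝓡 3) S.ξ Z q) := fun {Y Z c} hY hZ hc => by
    have h1 : (fun x => matrixForm (bilinInChart S.g.val q x) (coordField Y q x)
        (coordField Z q x)) =ᶠ[𝓝 (extChartAt (𝓡 3) q q)] fun _ => c := by
      filter_upwards [(isOpen_chartDomain q h.isOpen).mem_nhds (mem_chartDomain hq)] with y hy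
      rw [matrixForm_coordField _ _ _ hy.1, hc _ hy.2]
    rw [lieDerivBilin_apply S.g h.isOpen hq contMDiffOn_ξ hY hZ, h1.fderiv_eq (𝕜 := ℝ),
      fderiv_fun_const]
    simp
  have hξ := contMDiffOn_ξ (S := S) (U := U)
  have he := h.basis.smooth
  have hf := contMDiffOn_applyφ (S := S) he
  have c1 := h.basis.ξ_ξ
  have c2 := h.basis.ξ_e
  have c3 := h.basis.ξ_φe
  have c4 := h.basis.e_e
  have c5 := h.basis.e_φe
  have c6 := h.basis.φe_φe
  have c2' : ∀ q ∈ U, S.g.val q (e q) (S.ξ q) = 0 := fun q hq => (S.g.symm _ _ _).trans (c2 q hq)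
  have c3' : ∀ q ∈ U, S.g.val q (S.φ q (e q)) (S.ξ q) = 0 :=
    fun q hq => (S.g.symm _ _ _).trans (c3 q hq)
  have c5' : ∀ q ∈ U, S.g.val q (S.φ q (e q)) (e q) = 0 :=
    fun q hq => (S.g.symm _ _ _).trans (c5 q hq)
  have b0 : VectorField.mlieBracket (𝓡 3) S.ξ S.ξ q = 0 := by
    simp
  have b1 := h.bracket_ξ_e q hq
  have b2 := h.bracket_ξ_φe q hq
  refine ⟨(const hξ hξ c1).trans ?_, (const hξ he c2).trans ?_, (const he hξ c2').trans ?_,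
    (const hξ hf c3).trans ?_, (const hf hξ c3').trans ?_, (const he he c4).trans ?_,
    (const he hf c5).trans ?_, (const hf he c5').trans ?_, (const hf hf c6).trans ?_⟩ <;>
  simp only [b0, b1, b2, map_add, map_sub, map_smul, add_apply, sub_apply, smul_apply, map_zero,
    zero_apply, smul_eq_mul, applyφ, c2 q hq, c3 q hq, c4 q hq, c5 q hq, c6 q hq,
    c2' q hq, c3' q hq, c5' q hq] <;> ring

end AlmostParacontactMetric

/-! ### Existence of φ-bases, and the soliton equation in components. -/

namespace AlmostParacontactMetric

variable {M : Type*} [TopologicalSpace M] [ChartedSpace (EuclideanSpace ℝ (Fin 3)) M]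
  [IsManifold (𝓡 3) ∞ M] {S : AlmostParacontactMetric 3 M} {U : Set M}
  {e : (q : M) → TangentSpace (𝓡 3) q}

-- φ reverses the sign of g on ker η, so without a space-like vector g would vanish on ker η by
-- polarization. Nondegeneracy then makes ker η trivial, and ξ alone would span a three-dimensional
-- space.
variable (S) in
theorem exists_spacelike (p : M) :
    ∃ v : TangentSpace (𝓡 3) p, S.η p v = 0 ∧ 0 < S.g.val p v v := by
  by_contra! h
  have h0 : ∀ v, S.η p v = 0 → S.g.val p v v = 0 := fun v hv => by
    refine le_antisymm (h v hv) ?_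
    have h1 := h (S.φ p v) (S.η_φ p v)
    rw [S.compatible, hv] at h1
    linarith
  have h2 : ∀ v w, S.η p v = 0 → S.η p w = 0 → S.g.val p v w = 0 := fun v w hv hw => by
    have h1 := h0 (v + w) (by rw [map_add, hv, hw, add_zero])
    rw [map_add, map_add, add_apply, add_apply, h0 v hv, h0 w hw, S.g.symm p w v] at h1
    linarith
  have h3 : ∀ v, S.η p v = 0 → v = 0 := fun v hv => by
    refine S.g.nondegenerate p v fun w => ?_
    have h4 := h2 v (S.φ p (S.φ p w)) hv (S.η_φ p _)
    rwa [S.φ_φ, map_sub, map_smul, S.g.symm p v (S.ξ p), S.g_ξ, hv, smul_zero, sub_zero] at h4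
  have h5 : Module.finrank ℝ (TangentSpace (𝓡 3) p) ≤ 1 := by
    refine finrank_le_one (S.ξ p) fun w => ⟨S.η p w, ?_⟩
    have := h3 (S.φ p (S.φ p w)) (S.η_φ p _)
    rw [S.φ_φ, sub_eq_zero] at this
    exact this.symm
  have h6 : Module.finrank ℝ (TangentSpace (𝓡 3) p) = 3 :=
    finrank_euclideanSpace_fin (𝕜 := ℝ) (n := 3)
  omega

variable (S) in
theorem exists_isPhiBasisOn (p : M) :
    ∃ U : Set M, IsOpen U ∧ p ∈ U ∧ ∃ e : (q : M) → TangentSpace (𝓡 3) q,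
      S.IsPhiBasisOn e U := by
  obtain ⟨v, hv, hpos⟩ := S.exists_spacelike p
  obtain ⟨s, hs, hV⟩ := FiberBundle.exists_contMDiffOn_extend (k := ∞) (𝓡 3)
    (EuclideanSpace ℝ (Fin 3)) (V := fun q : M => TangentSpace (𝓡 3) q) v
  obtain ⟨U₁, hU₁s, hU₁, hpU₁⟩ := mem_nhds_iff.1 hs
  -- φ² is the projection onto ker η along ξ; it fixes `v` and keeps the extension in ker η.
  -- Normalizing where `N > 0` gives `e`.
  set W := S.applyφ (S.applyφ (FiberBundle.extend (EuclideanSpace ℝ (Fin 3))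
    (E := fun q : M => TangentSpace (𝓡 3) q) v)) with hW
  have hWs := contMDiffOn_applyφ (S := S) (contMDiffOn_applyφ (S := S) (hV.mono hU₁s))
  have hN := S.g.contMDiffOn_val hWs hWs
  set N : M → ℝ := fun q => S.g.val q (W q) (W q) with hNdef
  have hNp : 0 < N p := by
    have : W p = v := by
      simp only [hW, applyφ]
      rw [FiberBundle.extend_apply_self, S.φ_φ, hv, zero_smul, sub_zero]
    simp only [hNdef, this]
    exact hpos
  have hU : IsOpen (U₁ ∩ N ⁻¹' Set.Ioi 0) := hN.continuousOn.isOpen_inter_preimage hU₁ isOpen_Ioi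
  have hee : ∀ q ∈ U₁ ∩ N ⁻¹' Set.Ioi 0, S.g.val q ((√(N q))⁻¹ • W q) ((√(N q))⁻¹ • W q) = 1 :=
    fun q hq => by
    have h1 : 0 < N q := hq.2
    have h2 : √(N q) * √(N q) = N q := Real.mul_self_sqrt h1.le
    have h3 : √(N q) ≠ 0 := (Real.sqrt_pos.2 h1).ne'
    rw [map_smul, map_smul, smul_apply, smul_eq_mul, smul_eq_mul]
    change (√(N q))⁻¹ * ((√(N q))⁻¹ * N q) = 1
    field_simp
    nlinarith
  have hη : ∀ q, S.η q ((√(N q))⁻¹ • W q) = 0 := fun q => by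
    rw [map_smul, hW, applyφ, S.η_φ, smul_zero]
  refine ⟨_, hU, ⟨hpU₁, hNp⟩, fun q => (√(N q))⁻¹ • W q, ?_, fun q _ => ?_, hee, fun q hq => ?_,
    fun q _ => ?_, fun q _ => ?_, fun q _ => S.g_self_φ q _⟩
  · refine ContMDiffOn.smul_section (f := fun q => (√(N q))⁻¹) (fun q hq => ?_)
      (hWs.mono Set.inter_subset_left)
    have h1 : 0 < N q := hq.2
    exact (((Real.contDiffAt_sqrt h1.ne').inv (Real.sqrt_pos.2 h1).ne').contMDiffAt.comp q
      (hN.contMDiffAt (hU₁.mem_nhds hq.1))).contMDiffWithinAt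
  · rw [S.g_ξ, S.η_ξ]
  · rw [S.compatible, hee q hq, hη]
    norm_num
  · rw [S.g_ξ, hη]
  · rw [S.g_ξ, S.η_φ]

theorem contMDiffOn_mlieBracket {X Y : (q : M) → TangentSpace (𝓡 3) q} (hU : IsOpen U)
    (hX : ContMDiffOn (𝓡 3) (𝓡 3).tangent ∞ (fun q => (⟨q, X q⟩ : TangentBundle (𝓡 3) M)) U)
    (hY : ContMDiffOn (𝓡 3) (𝓡 3).tangent ∞ (fun q => (⟨q, Y q⟩ : TangentBundle (𝓡 3) M)) U) :
    ContMDiffOn (𝓡 3) (𝓡 3).tangent ∞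
      (fun q => (⟨q, VectorField.mlieBracket (𝓡 3) X Y q⟩ : TangentBundle (𝓡 3) M)) U := by
  intro q hq
  have : IsManifold (𝓡 3) (minSmoothness ℝ 2) M := IsManifold.of_le (n := ∞)
    (by simpa using WithTop.coe_le_coe.2 (le_top : (2 : ℕ∞) ≤ ⊤))
  have : IsManifold (𝓡 3) (((⊤ : ℕ∞) : WithTop ℕ∞) + 1) M := IsManifold.of_le (n := ∞) (by simp)
  exact (ContMDiffAt.mlieBracket_vectorField (m := ⊤) (n := ⊤) (hX.contMDiffAt (hU.mem_nhds hq))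
    (hY.contMDiffAt (hU.mem_nhds hq)) (by simp)).contMDiffWithinAt

variable {A b s a₄ a₅ : M → ℝ}

/-- These are the frame components of the equation. The (φe, φe) one follows from the (e, e) one,
because ϱ(e,e) + ϱ(φe,φe) is known to be 2(ξA + 2bs). -/
theorem IsAdaptedFrameOn.soliton_iff (h : S.IsAdaptedFrameOn e U A b s a₄ a₅) {q : M}
    (hq : q ∈ U) (lam : ℝ) :
    (∀ v w, lieDerivBilin S.ξ S.g.val q v w + S.g.ricci q v w = lam * S.g.val q v w) ↔
      -2 * (A q ^ 2 - b q ^ 2 + 1) = lam ∧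
      dirDeriv A (e q) + dirDeriv b (S.φ q (e q)) + 2 * b q * a₄ q + 2 * A q * a₅ q = 0 ∧
      dirDeriv b (e q) + dirDeriv A (S.φ q (e q)) + 2 * A q * a₄ q + 2 * b q * a₅ q = 0 ∧
      dirDeriv A (S.ξ q) + 2 * b q * s q = 2 * A q ∧
      dirDeriv b (S.ξ q) + 2 * A q * s q = 2 * b q ∧
      S.g.ricci q (e q) (e q) - 2 * A q = lam := by
  obtain ⟨r1, r2, r3, r4, r5, r6, r7, r8⟩ := h.ricci_eq hq
  obtain ⟨l1, l2, l3, l4, l5, l6, l7, l8, l9⟩ := h.lieDerivBilin_eq hq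
  have c1 := h.basis.ξ_ξ q hq
  have c2 := h.basis.ξ_e q hq
  have c3 := h.basis.ξ_φe q hq
  have c4 := h.basis.e_e q hq
  have c5 := h.basis.e_φe q hq
  have c6 := h.basis.φe_φe q hq
  have c2' := (S.g.symm q (e q) (S.ξ q)).trans c2
  have c3' := (S.g.symm q (S.φ q (e q)) (S.ξ q)).trans c3
  have c5' := (S.g.symm q (S.φ q (e q)) (e q)).trans c5
  constructor
  · intro H
    have h1 := H (S.ξ q) (S.ξ q)
    have h2 := H (S.ξ q) (e q)
    have h3 := H (S.ξ q) (S.φ q (e q))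
    have h4 := H (e q) (e q)
    have h5 := H (e q) (S.φ q (e q))
    have h6 := H (S.φ q (e q)) (S.φ q (e q))
    rw [l1, r1, c1] at h1
    rw [l2, r2, c2] at h2
    rw [l4, r4, c3] at h3
    rw [l6, c4] at h4
    rw [l7, r6, c5] at h5
    rw [l9, c6] at h6
    refine ⟨?_, ?_, ?_, ?_, ?_, ?_⟩ <;> linarith
  · rintro ⟨h1, h2, h3, h4, h5, h6⟩ v w
    -- L_ξ g + ϱ − λg is packaged as one bilinear map `T`, so that vanishing on the nine pairs of
    -- frame vectors is enough.
    let N : Matrix (Fin 3) (Fin 3) ℝ := Matrix.of fun i j =>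
      (∑ k, (vectorInChart S.ξ q k (extChartAt (𝓡 3) q q) *
        partialDeriv k (fun x => bilinInChart S.g.val q x i j) (extChartAt (𝓡 3) q q)
      + bilinInChart S.g.val q (extChartAt (𝓡 3) q q) k j *
        partialDeriv i (vectorInChart S.ξ q k) (extChartAt (𝓡 3) q q)
      + bilinInChart S.g.val q (extChartAt (𝓡 3) q q) i k *
        partialDeriv j (vectorInChart S.ξ q k) (extChartAt (𝓡 3) q q))) +
      ricciComp (bilinInChart S.g.val q) i j (extChartAt (𝓡 3) q q)
    let T : EuclideanSpace ℝ (Fin 3) →L[ℝ] EuclideanSpace ℝ (Fin 3) →L[ℝ] ℝ :=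
      matrixForm N - lam • (show EuclideanSpace ℝ (Fin 3) →L[ℝ] EuclideanSpace ℝ (Fin 3) →L[ℝ] ℝ
        from S.g.val q)
    have hT : ∀ v w : TangentSpace (𝓡 3) q, lieDerivBilin S.ξ S.g.val q v w + S.g.ricci q v w
        - lam * S.g.val q v w = T v w := fun v w => by
      change _ = matrixForm N v w - lam * S.g.val q v w
      refine congrArg (· - _) (Eq.trans ?_ (matrixForm_apply N _ _).symm)
      simp only [lieDerivBilin, PseudoMetric.ricci, N, Matrix.of_apply, ← Finset.sum_add_distrib]
      refine Finset.sum_congr rfl fun i _ => Finset.sum_congr rfl fun j _ => ?_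
      rw [← mul_add, mul_comm]
      rfl
    have t1 := hT (S.ξ q) (S.ξ q)
    have t2 := hT (S.ξ q) (e q)
    have t3 := hT (S.ξ q) (S.φ q (e q))
    have t4 := hT (e q) (S.ξ q)
    have t5 := hT (e q) (e q)
    have t6 := hT (e q) (S.φ q (e q))
    have t7 := hT (S.φ q (e q)) (S.ξ q)
    have t8 := hT (S.φ q (e q)) (e q)
    have t9 := hT (S.φ q (e q)) (S.φ q (e q))
    rw [l1, r1, c1] at t1
    rw [l2, r2, c2] at t2
    rw [l4, r4, c3] at t3
    rw [l3, r3, c2'] at t4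
    rw [l6, c4] at t5
    rw [l7, r6, c5] at t6
    rw [l5, r5, c3'] at t7
    rw [l8, r7, c5'] at t8
    rw [l9, c6] at t9
    have T1 : T (S.ξ q) (S.ξ q) = 0 := by linarith
    have T2 : T (S.ξ q) (e q) = 0 := by linarith
    have T3 : T (S.ξ q) (S.φ q (e q)) = 0 := by linarith
    have T4 : T (e q) (S.ξ q) = 0 := by linarith
    have T5 : T (e q) (e q) = 0 := by linarith
    have T6 : T (e q) (S.φ q (e q)) = 0 := by linarith
    have T7 : T (S.φ q (e q)) (S.ξ q) = 0 := by linarith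
    have T8 : T (S.φ q (e q)) (e q) = 0 := by linarith
    have T9 : T (S.φ q (e q)) (S.φ q (e q)) = 0 := by linarith
    have key : ∀ (a b c a' b' c' : ℝ) (x y z : EuclideanSpace ℝ (Fin 3)),
        T x x = 0 → T x y = 0 → T x z = 0 → T y x = 0 → T y y = 0 → T y z = 0 → T z x = 0 →
        T z y = 0 → T z z = 0 → T (a • x + b • y + c • z) (a' • x + b' • y + c' • z) = 0 :=
      fun a b c a' b' c' x y z k1 k2 k3 k4 k5 k6 k7 k8 k9 => by
        simp only [map_add, map_smul, add_apply, smul_apply, smul_eq_mul, k1, k2, k3, k4, k5, k6,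
          k7, k8, k9, mul_zero, add_zero]
    rw [← sub_eq_zero, hT, h.basis.span hq v, h.basis.span hq w]
    exact key _ _ _ _ _ _ _ _ _ T1 T2 T3 T4 T5 T6 T7 T8 T9

end AlmostParacontactMetric

/-! ### Rules for directional derivatives on the manifold. -/

section DirDeriv

variable {n : ℕ} {M : Type*} [TopologicalSpace M] [ChartedSpace (EuclideanSpace ℝ (Fin n)) M]

theorem dirDeriv_add_vector (a : M → ℝ) {p : M} (v w : TangentSpace (𝓡 n) p) :
    dirDeriv a (v + w) = dirDeriv a v + dirDeriv a w := by
  simp [dirDeriv]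

theorem dirDeriv_smul_vector (a : M → ℝ) {p : M} (c : ℝ) (v : TangentSpace (𝓡 n) p) :
    dirDeriv a (c • v) = c * dirDeriv a v := by
  simp [dirDeriv]

variable {U : Set M} {p : M} {a b : M → ℝ}

theorem dirDeriv_const (hU : IsOpen U) (c : ℝ) (ha : ∀ q ∈ U, a q = c) (hp : p ∈ U)
    (v : TangentSpace (𝓡 n) p) : dirDeriv a v = 0 := by
  have h : a =ᶠ[𝓝 p] fun _ => c := Filter.eventually_of_mem (hU.mem_nhds hp) ha
  rw [dirDeriv, h.mfderiv_eq, mfderiv_const]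
  exact map_zero _

variable [IsManifold (𝓡 n) ∞ M]

/-- A single tangent vector is extended to a field to reduce to the version for fields. -/
theorem dirDeriv_eq_fderiv_chart (hU : IsOpen U) (ha : ContMDiffOn (𝓡 n) 𝓘(ℝ, ℝ) ∞ a U)
    (hp : p ∈ U) (v : TangentSpace (𝓡 n) p) :
    dirDeriv a v = fderiv ℝ (a ∘ (extChartAt (𝓡 n) p).symm) (extChartAt (𝓡 n) p p)
      (show EuclideanSpace ℝ (Fin n) from v) := by
  have h := dirDeriv_eq_fderiv hU ha (FiberBundle.extend (EuclideanSpace ℝ (Fin n))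
    (E := fun q : M => TangentSpace (𝓡 n) q) v) hp
  rw [coordField_self] at h
  simp only [FiberBundle.extend_apply_self] at h
  exact h

theorem differentiableAt_comp_chart_symm (hU : IsOpen U)
    (ha : ContMDiffOn (𝓡 n) 𝓘(ℝ, ℝ) ∞ a U) (hp : p ∈ U) :
    DifferentiableAt ℝ (a ∘ (extChartAt (𝓡 n) p).symm) (extChartAt (𝓡 n) p p) :=
  ContDiffAt.differentiableAt_of_infty (contDiffAt_comp_chart_symm hU ha (mem_chartDomain hp))

theorem dirDeriv_add (hU : IsOpen U) (ha : ContMDiffOn (𝓡 n) 𝓘(ℝ, ℝ) ∞ a U)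
    (hb : ContMDiffOn (𝓡 n) 𝓘(ℝ, ℝ) ∞ b U) (hp : p ∈ U) (v : TangentSpace (𝓡 n) p) :
    dirDeriv (fun q => a q + b q) v = dirDeriv a v + dirDeriv b v := by
  rw [dirDeriv_eq_fderiv_chart hU ha hp, dirDeriv_eq_fderiv_chart hU hb hp,
    dirDeriv_eq_fderiv_chart (a := fun q => a q + b q) hU (ha.add hb) hp]
  have h := fderiv_fun_add (differentiableAt_comp_chart_symm hU ha hp)
    (differentiableAt_comp_chart_symm hU hb hp)
  exact congrArg (fun L : EuclideanSpace ℝ (Fin n) →L[ℝ] ℝ =>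
    L (show EuclideanSpace ℝ (Fin n) from v)) h

theorem dirDeriv_mul (hU : IsOpen U) (ha : ContMDiffOn (𝓡 n) 𝓘(ℝ, ℝ) ∞ a U)
    (hb : ContMDiffOn (𝓡 n) 𝓘(ℝ, ℝ) ∞ b U) (hp : p ∈ U) (v : TangentSpace (𝓡 n) p) :
    dirDeriv (fun q => a q * b q) v = a p * dirDeriv b v + b p * dirDeriv a v := by
  rw [dirDeriv_eq_fderiv_chart hU ha hp, dirDeriv_eq_fderiv_chart hU hb hp,
    dirDeriv_eq_fderiv_chart (a := fun q => a q * b q) hU (ha.mul hb) hp]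
  have h := fderiv_fun_mul (differentiableAt_comp_chart_symm hU ha hp)
    (differentiableAt_comp_chart_symm hU hb hp)
  have h' := congrArg (fun L : EuclideanSpace ℝ (Fin n) →L[ℝ] ℝ =>
    L (show EuclideanSpace ℝ (Fin n) from v)) h
  simp only [Function.comp_apply, extChartAt_to_inv] at h'
  exact h'

theorem dirDeriv_const_mul (hU : IsOpen U) (c : ℝ)
    (hb : ContMDiffOn (𝓡 n) 𝓘(ℝ, ℝ) ∞ b U) (hp : p ∈ U) (v : TangentSpace (𝓡 n) p) :
    dirDeriv (fun q => c * b q) v = c * dirDeriv b v := by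
  rw [dirDeriv_mul hU contMDiffOn_const hb hp, dirDeriv_const hU c (fun _ _ => rfl) hp, mul_zero,
    add_zero]

end DirDeriv

/-! ### The Jacobi identity and the structure functions of a φ-basis. -/

namespace AlmostParacontactMetric

variable {M : Type*} [TopologicalSpace M] [ChartedSpace (EuclideanSpace ℝ (Fin 3)) M]
  [IsManifold (𝓡 3) ∞ M] {S : AlmostParacontactMetric 3 M} {U : Set M}
  {e : (q : M) → TangentSpace (𝓡 3) q} {A b s a₄ a₅ : M → ℝ} {q : M}

/-- The Jacobi identity for a φ-basis. -/
theorem IsPhiBasisOn.jacobi (hb : S.IsPhiBasisOn e U) (hU : IsOpen U) {a C D : M → ℝ}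
    (hA : ContMDiffOn (𝓡 3) 𝓘(ℝ, ℝ) ∞ A U) (ha : ContMDiffOn (𝓡 3) 𝓘(ℝ, ℝ) ∞ a U)
    (hC : ContMDiffOn (𝓡 3) 𝓘(ℝ, ℝ) ∞ C U) (hD : ContMDiffOn (𝓡 3) 𝓘(ℝ, ℝ) ∞ D U)
    (ha₄ : ContMDiffOn (𝓡 3) 𝓘(ℝ, ℝ) ∞ a₄ U) (ha₅ : ContMDiffOn (𝓡 3) 𝓘(ℝ, ℝ) ∞ a₅ U)
    (h₁ : ∀ q ∈ U, VectorField.mlieBracket (𝓡 3) S.ξ e q = A q • e q + a q • S.φ q (e q))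
    (h₂ : ∀ q ∈ U, VectorField.mlieBracket (𝓡 3) S.ξ (S.applyφ e) q =
      C q • e q + D q • S.φ q (e q))
    (h₃ : ∀ q ∈ U, VectorField.mlieBracket (𝓡 3) e (S.applyφ e) q =
      (-2 : ℝ) • S.ξ q + a₄ q • e q - a₅ q • S.φ q (e q)) (hq : q ∈ U) :
    A q + D q = 0 ∧
    dirDeriv a₄ (S.ξ q) - a₅ q * C q + dirDeriv A (S.φ q (e q)) - dirDeriv C (e q)
      - D q * a₄ q = 0 ∧
    a₄ q * a q - dirDeriv a₅ (S.ξ q) + A q * a₅ q + dirDeriv a (S.φ q (e q))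
      - dirDeriv D (e q) = 0 := by
  have hx := mem_chartDomain (n := 3) hq
  have he := hb.smooth
  have hf := contMDiffOn_applyφ (S := S) he
  have hξ := contMDiffOn_ξ (S := S) (U := U)
  have key := jacobi_of_brackets (isOpen_chartDomain q hU) hx (contDiffAt_coordField hU hξ hx)
    (contDiffAt_coordField hU he hx) (contDiffAt_coordField hU hf hx)
    (differentiableAt_comp_chart_symm hU hA hq) (differentiableAt_comp_chart_symm hU ha hq)
    (differentiableAt_comp_chart_symm hU hC hq) (differentiableAt_comp_chart_symm hU hD hq)
    (differentiableAt_comp_chart_symm hU ha₄ hq) (differentiableAt_comp_chart_symm hU ha₅ hq)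
    (fun x hx => by
      rw [lieBracket_coordField hU hξ he hx, coordField, h₁ _ hx.2, map_add, map_smul, map_smul]
      rfl)
    (fun x hx => by
      rw [lieBracket_coordField hU hξ hf hx, coordField, h₂ _ hx.2, map_add, map_smul, map_smul]
      rfl)
    (fun x hx => by
      rw [lieBracket_coordField hU he hf hx, coordField, h₃ _ hx.2, map_sub, map_add, map_smul,
        map_smul, map_smul]
      rfl)
  simp only [← dirDeriv_eq_fderiv hU hA _ hq, ← dirDeriv_eq_fderiv hU ha _ hq,
    ← dirDeriv_eq_fderiv hU hC _ hq, ← dirDeriv_eq_fderiv hU hD _ hq,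
    ← dirDeriv_eq_fderiv hU ha₄ _ hq, ← dirDeriv_eq_fderiv hU ha₅ _ hq, Function.comp_apply,
    extChartAt_to_inv] at key
  have pair : ∀ {X Y : (q : M) → TangentSpace (𝓡 3) q} {c : ℝ}, S.g.val q (X q) (Y q) = c →
      matrixForm (bilinInChart S.g.val q (extChartAt (𝓡 3) q q))
        (coordField X q (extChartAt (𝓡 3) q q)) (coordField Y q (extChartAt (𝓡 3) q q)) = c :=
    fun {X Y c} h => by rw [matrixForm_coordField _ _ _ hx.1, extChartAt_to_inv, h]
  have p1 := pair (hb.ξ_ξ q hq)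
  have p2 := pair (hb.ξ_e q hq)
  have p3 := pair (Y := S.applyφ e) (hb.ξ_φe q hq)
  have p4 := pair (hb.e_e q hq)
  have p5 := pair (Y := S.applyφ e) (hb.e_φe q hq)
  have p6 := pair (X := S.applyφ e) (Y := S.applyφ e) (hb.φe_φe q hq)
  have k1 := congrArg (matrixForm (bilinInChart S.g.val q (extChartAt (𝓡 3) q q))
    (coordField S.ξ q (extChartAt (𝓡 3) q q))) key
  have k2 := congrArg (fun v => matrixForm (bilinInChart S.g.val q (extChartAt (𝓡 3) q q)) v
    (coordField e q (extChartAt (𝓡 3) q q))) key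
  have k3 := congrArg (fun v => matrixForm (bilinInChart S.g.val q (extChartAt (𝓡 3) q q)) v
    (coordField (S.applyφ e) q (extChartAt (𝓡 3) q q))) key
  have p5' := (pair (X := S.applyφ e) (Y := e) ((S.g.symm _ _ _).trans (hb.e_φe q hq)))
  simp only [map_add, map_smul, add_apply, smul_apply, smul_eq_mul, map_zero, zero_apply, p1, p2,
    p3, p4, p5, p5', p6, mul_zero, mul_one, add_zero, zero_add] at k1 k2 k3
  refine ⟨by linarith, k2, ?_⟩
  have : ∀ t : ℝ, t * -1 = 0 → t = 0 := fun t ht => by linarith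
  exact this _ k3

/-- The ξ-component of each bracket is −2dη, hence −2g(X, φY): zero for the two brackets with ξ and
−2 for [e, φe]. The ξ-part of the Jacobi identity makes the remaining 2×2 block trace-free. -/
theorem IsPhiBasisOn.exists_isAdaptedFrameOn (hS : S.IsParacontactMetric)
    (hb : S.IsPhiBasisOn e U) (hU : IsOpen U) :
    ∃ A b s a₄ a₅ : M → ℝ, S.IsAdaptedFrameOn e U A b s a₄ a₅ := by
  have he := hb.smooth
  have hf := contMDiffOn_applyφ (S := S) he
  have hξ := contMDiffOn_ξ (S := S) (U := U)
  have ηξ : ∀ q ∈ U, S.η q (S.ξ q) = 1 := fun q _ => S.η_ξ q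
  have ηe : ∀ q ∈ U, S.η q (e q) = 0 := fun q hq => (S.g_ξ q _).symm.trans (hb.ξ_e q hq)
  have ηf : ∀ q ∈ U, S.η q (S.applyφ e q) = 0 := fun q _ => S.η_φ q _
  have φf : ∀ q ∈ U, S.φ q (S.applyφ e q) = e q := fun q hq => by
    rw [applyφ, S.φ_φ, ηe q hq, zero_smul, sub_zero]
  have b1 := contMDiffOn_mlieBracket hU hξ he
  have b2 := contMDiffOn_mlieBracket hU hξ hf
  have b3 := contMDiffOn_mlieBracket hU he hf
  set A : M → ℝ := fun q => S.g.val q (VectorField.mlieBracket (𝓡 3) S.ξ e q) (e q) with hA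
  set a : M → ℝ := fun q => -S.g.val q (VectorField.mlieBracket (𝓡 3) S.ξ e q) (S.applyφ e q)
    with ha
  set C : M → ℝ := fun q => S.g.val q (VectorField.mlieBracket (𝓡 3) S.ξ (S.applyφ e) q) (e q)
    with hC
  set D : M → ℝ := fun q =>
    -S.g.val q (VectorField.mlieBracket (𝓡 3) S.ξ (S.applyφ e) q) (S.applyφ e q) with hD
  set a₄ : M → ℝ := fun q => S.g.val q (VectorField.mlieBracket (𝓡 3) e (S.applyφ e) q) (e q)
    with ha₄
  set a₅ : M → ℝ := fun q =>
    S.g.val q (VectorField.mlieBracket (𝓡 3) e (S.applyφ e) q) (S.applyφ e q) with ha₅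
  have sA : ContMDiffOn (𝓡 3) 𝓘(ℝ, ℝ) ∞ A U := S.g.contMDiffOn_val b1 he
  have sa : ContMDiffOn (𝓡 3) 𝓘(ℝ, ℝ) ∞ a U := (S.g.contMDiffOn_val b1 hf).neg
  have sC : ContMDiffOn (𝓡 3) 𝓘(ℝ, ℝ) ∞ C U := S.g.contMDiffOn_val b2 he
  have sD : ContMDiffOn (𝓡 3) 𝓘(ℝ, ℝ) ∞ D U := (S.g.contMDiffOn_val b2 hf).neg
  have sa₄ : ContMDiffOn (𝓡 3) 𝓘(ℝ, ℝ) ∞ a₄ U := S.g.contMDiffOn_val b3 he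
  have sa₅ : ContMDiffOn (𝓡 3) 𝓘(ℝ, ℝ) ∞ a₅ U := S.g.contMDiffOn_val b3 hf
  have h₁ : ∀ q ∈ U, VectorField.mlieBracket (𝓡 3) S.ξ e q =
      A q • e q + a q • S.φ q (e q) := fun q hq => by
    have h := hb.span hq (VectorField.mlieBracket (𝓡 3) S.ξ e q)
    rw [S.g.symm q _ (S.ξ q), S.g_ξ, extDerivForm_apply S.smooth_η hU hq hξ he 1 ηξ 0 ηe, ← hS,
      hb.ξ_φe q hq, mul_zero, zero_smul, zero_add] at h
    exact h
  have h₂ : ∀ q ∈ U, VectorField.mlieBracket (𝓡 3) S.ξ (S.applyφ e) q =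
      C q • e q + D q • S.φ q (e q) := fun q hq => by
    have h := hb.span hq (VectorField.mlieBracket (𝓡 3) S.ξ (S.applyφ e) q)
    rw [S.g.symm q _ (S.ξ q), S.g_ξ, extDerivForm_apply S.smooth_η hU hq hξ hf 1 ηξ 0 ηf, ← hS,
      φf q hq, hb.ξ_e q hq, mul_zero, zero_smul, zero_add] at h
    exact h
  have h₃ : ∀ q ∈ U, VectorField.mlieBracket (𝓡 3) e (S.applyφ e) q =
      (-2 : ℝ) • S.ξ q + a₄ q • e q - a₅ q • S.φ q (e q) := fun q hq => by
    have h := hb.span hq (VectorField.mlieBracket (𝓡 3) e (S.applyφ e) q)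
    rw [S.g.symm q _ (S.ξ q), S.g_ξ, extDerivForm_apply S.smooth_η hU hq he hf 0 ηe 0 ηf, ← hS,
      φf q hq, hb.e_e q hq, mul_one, neg_smul (S.g.val q _ _), ← sub_eq_add_neg] at h
    exact h
  have hAD : ∀ q ∈ U, D q = -A q := fun q hq =>
    eq_neg_of_add_eq_zero_right (hb.jacobi hU sA sa sC sD sa₄ sa₅ h₁ h₂ h₃ hq).1
  -- Solves a = s + 1 + b and C = s + 1 − b.
  refine ⟨A, fun q => (1 / 2) * (a q - C q), fun q => (1 / 2) * (a q + C q) - 1, a₄, a₅, hb, hU, sA,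
    contMDiffOn_const.mul (sa.sub sC), (contMDiffOn_const.mul (sa.add sC)).sub contMDiffOn_const,
    sa₄, sa₅, fun q hq => ?_, fun q hq => ?_, h₃⟩
  · rw [h₁ q hq]
    congr 2
    ring
  · rw [h₂ q hq, hAD q hq, neg_smul, ← sub_eq_add_neg]
    congr 2
    ring

end AlmostParacontactMetric

/-! ### Consequences of the soliton equation. -/

namespace AlmostParacontactMetric

variable {M : Type*} [TopologicalSpace M] [ChartedSpace (EuclideanSpace ℝ (Fin 3)) M]
  [IsManifold (𝓡 3) ∞ M] {S : AlmostParacontactMetric 3 M} {U V : Set M}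
  {e : (q : M) → TangentSpace (𝓡 3) q} {A b s a₄ a₅ : M → ℝ} {q : M} {lam : ℝ}

theorem IsPhiBasisOn.mono (hb : S.IsPhiBasisOn e U) (hV : V ⊆ U) : S.IsPhiBasisOn e V where
  smooth := hb.smooth.mono hV
  ξ_ξ q hq := hb.ξ_ξ q (hV hq)
  e_e q hq := hb.e_e q (hV hq)
  φe_φe q hq := hb.φe_φe q (hV hq)
  ξ_e q hq := hb.ξ_e q (hV hq)
  ξ_φe q hq := hb.ξ_φe q (hV hq)
  e_φe q hq := hb.e_φe q (hV hq)

theorem IsAdaptedFrameOn.restrict (h : S.IsAdaptedFrameOn e U A b s a₄ a₅) (hV : V ⊆ U)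
    (hVo : IsOpen V) {A' : M → ℝ} (hA : ∀ q ∈ V, A' q = A q) :
    S.IsAdaptedFrameOn e V A' b s a₄ a₅ where
  basis := h.basis.mono hV
  isOpen := hVo
  smooth_A := (h.smooth_A.mono hV).congr hA
  smooth_b := h.smooth_b.mono hV
  smooth_s := h.smooth_s.mono hV
  smooth_a₄ := h.smooth_a₄.mono hV
  smooth_a₅ := h.smooth_a₅.mono hV
  bracket_ξ_e q hq := by rw [hA q hq]; exact h.bracket_ξ_e q (hV hq)
  bracket_ξ_φe q hq := by rw [hA q hq]; exact h.bracket_ξ_φe q (hV hq)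
  bracket_e_φe q hq := h.bracket_e_φe q (hV hq)

/-- By the (ξ, ξ) component A² − b² is constant, yet its ξ-derivative is 4(A² − b²): the terms with
`s` cancel. -/
theorem IsAdaptedFrameOn.sq_eq_sq (h : S.IsAdaptedFrameOn e U A b s a₄ a₅)
    (hs : S.IsReebSoliton lam) (hq : q ∈ U) : b q ^ 2 = A q ^ 2 := by
  obtain ⟨-, -, -, h4, h5, -⟩ := (h.soliton_iff hq lam).1 (hs q)
  have hc := dirDeriv_const (a := fun q => A q * A q + (-1) * (b q * b q)) h.isOpen
    (-lam / 2 - 1) (fun p hp => by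
      have := ((h.soliton_iff hp lam).1 (hs p)).1
      linarith) hq (S.ξ q)
  rw [dirDeriv_add (a := fun q => A q * A q) (b := fun q => (-1) * (b q * b q)) h.isOpen
    (h.smooth_A.mul h.smooth_A) (contMDiffOn_const.mul (h.smooth_b.mul h.smooth_b)) hq,
    dirDeriv_const_mul (b := fun q => b q * b q) h.isOpen _ (h.smooth_b.mul h.smooth_b) hq,
    dirDeriv_mul h.isOpen h.smooth_A h.smooth_A hq,
    dirDeriv_mul h.isOpen h.smooth_b h.smooth_b hq] at hc
  linear_combination (1 / 4) * (-hc) + (1 / 2) * A q * h4 - (1 / 2) * b q * h5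

theorem IsAdaptedFrameOn.lam_eq (h : S.IsAdaptedFrameOn e U A b s a₄ a₅)
    (hs : S.IsReebSoliton lam) (hq : q ∈ U) : lam = -2 := by
  have h1 := ((h.soliton_iff hq lam).1 (hs q)).1
  have h2 := h.sq_eq_sq hs hq
  rw [h2] at h1
  linarith

theorem IsAdaptedFrameOn.scalarCurvature_of_soliton (h : S.IsAdaptedFrameOn e U A b s a₄ a₅)
    (hs : S.IsReebSoliton lam) (hq : q ∈ U) : S.g.scalarCurvature q = 3 * lam := by
  obtain ⟨h1, -, -, h4, -, h6⟩ := (h.soliton_iff hq lam).1 (hs q)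
  obtain ⟨r1, -, -, -, -, -, -, r8⟩ := h.ricci_eq hq
  rw [h.basis.scalarCurvature_eq hq, r1]
  linarith

/-- The sum and difference of the soliton equations decouple A + b from b − A, giving propagation
along ξ, e + φe and e − φe as the separation lemma requires. -/
theorem IsAdaptedFrameOn.eventually_eq_or (h : S.IsAdaptedFrameOn e U A b s a₄ a₅)
    (hs : S.IsReebSoliton lam) {p : M} (hp : p ∈ U) :
    (∀ᶠ q in 𝓝 p, A q = -b q) ∨ (∀ᶠ q in 𝓝 p, A q = b q) := by
  set x₀ := extChartAt (𝓡 3) p p with hx₀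
  set ψ := (extChartAt (𝓡 3) p).symm with hψ
  have hF := h.isPhiFrameOn p
  have hx : x₀ ∈ chartDomain p U := mem_chartDomain hp
  have hev : ∀ᶠ x in 𝓝 x₀, x ∈ chartDomain p U := (isOpen_chartDomain p h.isOpen).mem_nhds hx
  have eqs : ∀ x ∈ chartDomain p U, _ := fun x hx => (h.soliton_iff hx.2 lam).1 (hs (ψ x))
  have dA : ∀ x ∈ chartDomain p U, DifferentiableAt ℝ (A ∘ ψ) x := fun x hx =>
    ContDiffAt.differentiableAt_of_infty (hF.contDiff_A x hx)
  have db : ∀ x ∈ chartDomain p U, DifferentiableAt ℝ (b ∘ ψ) x := fun x hx =>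
    ContDiffAt.differentiableAt_of_infty (hF.contDiff_b x hx)
  -- The soliton equations at nearby points are all read in the single chart at `p`, where the
  -- separation argument takes place.
  have dirA : ∀ x ∈ chartDomain p U, ∀ V : (q : M) → TangentSpace (𝓡 3) q,
      fderiv ℝ (A ∘ ψ) x (coordField V p x) = dirDeriv A (V (ψ x)) := fun x hx V =>
    fderiv_comp_chart_symm h.isOpen h.smooth_A V hx
  have dirb : ∀ x ∈ chartDomain p U, ∀ V : (q : M) → TangentSpace (𝓡 3) q,
      fderiv ℝ (b ∘ ψ) x (coordField V p x) = dirDeriv b (V (ψ x)) := fun x hx V =>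
    fderiv_comp_chart_symm h.isOpen h.smooth_b V hx
  have key := eventually_eq_zero_or_eventually_eq_zero (x₀ := x₀)
    (u := fun x => (A ∘ ψ) x + (b ∘ ψ) x) (w := fun x => (b ∘ ψ) x - (A ∘ ψ) x)
    (X := coordField S.ξ p) (P := fun x => coordField e p x + coordField (S.applyφ e) p x)
    (N := fun x => coordField e p x - coordField (S.applyφ e) p x)
    (a₁ := fun x => 2 - 2 * (s ∘ ψ) x) (a₂ := fun x => -2 * ((a₄ ∘ ψ) x + (a₅ ∘ ψ) x))
    (a₃ := fun x => 2 * ((a₄ ∘ ψ) x - (a₅ ∘ ψ) x))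
    (hF.contDiff_ξ x₀ hx).continuousAt
    ((hF.contDiff_e x₀ hx).add (hF.contDiff_f x₀ hx)).continuousAt
    ((hF.contDiff_e x₀ hx).sub (hF.contDiff_f x₀ hx)).continuousAt
    -- A vector Euclidean-orthogonal to ξ and e ± φe is orthogonal to the whole frame, hence to
    -- itself.
    (fun n hn1 hn2 hn3 => by
      rw [inner_add_right] at hn2
      rw [inner_sub_right] at hn3
      have k2 : inner ℝ n (coordField e p x₀) = 0 := by linarith
      have k3 : inner ℝ n (coordField (S.applyφ e) p x₀) = 0 := by linarith
      have hn := congrArg (inner ℝ n) (hF.span x₀ hx n)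
      rw [inner_add_right, inner_add_right, real_inner_smul_right, real_inner_smul_right,
        real_inner_smul_right, hn1, k2, k3] at hn
      exact inner_self_eq_zero.1 (hn.trans (by ring)))
    (continuousAt_const.sub (continuousAt_const.mul (hF.contDiff_s x₀ hx).continuousAt))
    (continuousAt_const.mul ((hF.contDiff_a₄ x₀ hx).add (hF.contDiff_a₅ x₀ hx)).continuousAt)
    (continuousAt_const.mul ((hF.contDiff_a₄ x₀ hx).sub (hF.contDiff_a₅ x₀ hx)).continuousAt)
    (hev.mono fun x hx => (dA x hx).fun_add (db x hx))
    (hev.mono fun x hx => (db x hx).fun_sub (dA x hx))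
    (hev.mono fun x hx => by
      have := h.sq_eq_sq hs hx.2
      simp only [Function.comp_apply]
      linear_combination this)
    (hev.mono fun x hx => by
      obtain ⟨-, h2, h3, h4, h5, -⟩ := eqs x hx
      rw [fderiv_fun_add (dA x hx) (db x hx), add_apply, dirA x hx, dirb x hx]
      simp only [Function.comp_apply]
      linear_combination h4 + h5)
    (hev.mono fun x hx => by
      obtain ⟨-, h2, h3, h4, h5, -⟩ := eqs x hx
      rw [fderiv_fun_add (dA x hx) (db x hx), add_apply, map_add, map_add, dirA x hx, dirb x hx,
        dirA x hx, dirb x hx]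
      simp only [Function.comp_apply]
      simp only [applyφ]
      linear_combination h2 + h3)
    (hev.mono fun x hx => by
      obtain ⟨-, h2, h3, h4, h5, -⟩ := eqs x hx
      rw [fderiv_fun_sub (db x hx) (dA x hx), sub_apply, map_sub, map_sub, dirA x hx, dirb x hx,
        dirA x hx, dirb x hx]
      simp only [Function.comp_apply]
      simp only [applyφ]
      linear_combination h3 - h2)
  have pull : ∀ {f : M → ℝ}, (∀ᶠ x in 𝓝 x₀, f (ψ x) = 0) → ∀ᶠ q in 𝓝 p, f q = 0 := fun {f} hf => by
    filter_upwards [(continuousAt_extChartAt (I := 𝓡 3) p).eventually hf,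
      extChartAt_source_mem_nhds (I := 𝓡 3) p] with q hq hqs
    rwa [hψ, (extChartAt (𝓡 3) p).left_inv hqs] at hq
  rcases key with h0 | h0
  · exact Or.inl ((pull (f := fun q => A q + b q) h0).mono fun q hq => by linarith)
  · exact Or.inr ((pull (f := fun q => b q - A q) h0).mono fun q hq => by linarith)

/-- Around each point of a Reeb soliton there is a φ-basis with `A = ε b`. -/
theorem exists_isAdaptedFrameOn_of_soliton (hS : S.IsParacontactMetric)
    (hs : S.IsReebSoliton lam) (p : M) :
    ∃ U : Set M, p ∈ U ∧ ∃ ε : ℝ, (ε = 1 ∨ ε = -1) ∧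
      ∃ (e : (q : M) → TangentSpace (𝓡 3) q) (b s a₄ a₅ : M → ℝ),
        S.IsAdaptedFrameOn e U (fun q => ε * b q) b s a₄ a₅ := by
  obtain ⟨U, hU, hp, e, hb⟩ := S.exists_isPhiBasisOn p
  obtain ⟨A, b, s, a₄, a₅, h⟩ := hb.exists_isAdaptedFrameOn hS hU
  have res : ∀ ε : ℝ, (∀ᶠ q in 𝓝 p, A q = ε * b q) → ∃ V : Set M, p ∈ V ∧
      S.IsAdaptedFrameOn e V (fun q => ε * b q) b s a₄ a₅ := fun ε hε => by
    obtain ⟨W, hW, hWo, hpW⟩ := eventually_nhds_iff.1 hε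
    exact ⟨U ∩ W, ⟨hp, hpW⟩, h.restrict Set.inter_subset_left (hU.inter hWo)
      fun q hq => (hW q hq.2).symm⟩
  rcases h.eventually_eq_or hs hp with h0 | h0
  · obtain ⟨V, hpV, hV⟩ := res (-1) (h0.mono fun q hq => by rw [hq]; ring)
    exact ⟨V, hpV, -1, Or.inr rfl, e, b, s, a₄, a₅, hV⟩
  · obtain ⟨V, hpV, hV⟩ := res 1 (h0.mono fun q hq => by rw [hq]; ring)
    exact ⟨V, hpV, 1, Or.inl rfl, e, b, s, a₄, a₅, hV⟩

end AlmostParacontactMetric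

end Paracontact

end

/-! ### The equivalence and the sign of λ. -/

theorem mainTheorem2
    {M : Type*} [TopologicalSpace M] [T2Space M] [SecondCountableTopology M] [ConnectedSpace M]
    [ChartedSpace (EuclideanSpace ℝ (Fin 3)) M] [IsManifold (𝓡 3) ∞ M]
    (S : Paracontact.AlmostParacontactMetric 3 M)
    (hS : S.IsParacontactMetric) :
    (∀ lam : ℝ, S.IsReebSoliton lam ↔
      lam = -2 ∧
      ∀ p : M, ∃ U : Set M, IsOpen U ∧ p ∈ U ∧
        ∃ e : (q : M) → TangentSpace (𝓡 3) q, S.IsPhiBasisOn e U ∧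
        ∃ ε : ℝ, (ε = 1 ∨ ε = -1) ∧
        ∃ a₁ a₃ a₄ a₅ : M → ℝ,
          ContMDiffOn (𝓡 3) 𝓘(ℝ, ℝ) ∞ a₁ U ∧ ContMDiffOn (𝓡 3) 𝓘(ℝ, ℝ) ∞ a₃ U ∧
          ContMDiffOn (𝓡 3) 𝓘(ℝ, ℝ) ∞ a₄ U ∧ ContMDiffOn (𝓡 3) 𝓘(ℝ, ℝ) ∞ a₅ U ∧
          ∀ q ∈ U,
            -- the bracket relations
            VectorField.mlieBracket (𝓡 3) S.ξ e q =
              (-(ε * a₁ q)) • e q + (a₃ q - a₁ q + 1) • S.φ q (e q) ∧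
            VectorField.mlieBracket (𝓡 3) S.ξ (S.applyφ e) q =
              (a₃ q + a₁ q + 1) • e q + (ε * a₁ q) • S.φ q (e q) ∧
            VectorField.mlieBracket (𝓡 3) e (S.applyφ e) q =
              (-2 : ℝ) • S.ξ q + a₄ q • e q - a₅ q • S.φ q (e q) ∧
            -- the constraints on the functions
            Paracontact.dirDeriv a₄ (S.ξ q) - Paracontact.dirDeriv a₃ (e q)
              + ε * a₁ q * a₄ q - a₅ q * (a₃ q - a₁ q + 1) = 0 ∧
            Paracontact.dirDeriv a₅ (S.ξ q) - Paracontact.dirDeriv a₃ (S.φ q (e q))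
              - ε * a₁ q * a₅ q - a₄ q * (a₃ q + a₁ q + 1) = 0 ∧
            Paracontact.dirDeriv a₁ (e q + ε • S.φ q (e q))
              + 2 * ε * a₁ q * a₄ q + 2 * a₁ q * a₅ q = 0 ∧
            -- the soliton conditions
            Paracontact.dirDeriv a₁ (S.ξ q) + 2 * ε * a₁ q * a₃ q = 2 * a₁ q ∧
            S.g.scalarCurvature q = -6) ∧
    (∀ lam : ℝ, S.IsReebSoliton lam → lam < 0) := by
  have lam_eq : ∀ lam : ℝ, S.IsReebSoliton lam → lam = -2 := fun lam hs => by
    -- One point determines λ; connectedness supplies it.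
    obtain ⟨p⟩ : Nonempty M := inferInstance
    obtain ⟨U, hp, ε, -, e, b, s, a₄, a₅, h⟩ :=
      Paracontact.AlmostParacontactMetric.exists_isAdaptedFrameOn_of_soliton hS hs p
    exact h.lam_eq hs hp
  refine ⟨fun lam => ⟨fun hs => ⟨lam_eq lam hs, fun p => ?_⟩, ?_⟩,
    fun lam hs => by rw [lam_eq lam hs]; norm_num⟩
  · obtain ⟨U, hp, ε, hε, e, b, s, a₄, a₅, h⟩ :=
      Paracontact.AlmostParacontactMetric.exists_isAdaptedFrameOn_of_soliton hS hs p
    have hU := h.isOpen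
    refine ⟨U, hU, hp, e, h.basis, ε, hε, fun q => (-1) * b q, s, a₄, a₅,
      contMDiffOn_const.mul h.smooth_b, h.smooth_s, h.smooth_a₄, h.smooth_a₅, fun q hq => ?_⟩
    have hεε : ε * ε = 1 := by rcases hε with rfl | rfl <;> norm_num
    obtain ⟨-, h2, h3, h4, h5, -⟩ := (h.soliton_iff hq lam).1 (hs q)
    obtain ⟨-, j1, j2⟩ := h.basis.jacobi hU h.smooth_A
      (a := fun q => s q + (b q + 1)) (C := fun q => s q + ((-1) * b q + 1))
      (D := fun q => (-1) * (ε * b q))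
      (h.smooth_s.add (h.smooth_b.add contMDiffOn_const))
      (h.smooth_s.add ((contMDiffOn_const.mul h.smooth_b).add contMDiffOn_const))
      (contMDiffOn_const.mul h.smooth_A) h.smooth_a₄ h.smooth_a₅
      (fun q hq => by rw [h.bracket_ξ_e q hq]; module)
      (fun q hq => by rw [h.bracket_ξ_φe q hq]; module) h.bracket_e_φe hq
    have dA := fun v => Paracontact.dirDeriv_const_mul hU ε h.smooth_b hq v
    have dn := fun v => Paracontact.dirDeriv_const_mul hU (-1) h.smooth_b hq v
    have dD := fun v => Paracontact.dirDeriv_const_mul hU (-1) h.smooth_A hq v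
    have da := fun v => Paracontact.dirDeriv_add hU h.smooth_s
      (b := fun q => b q + 1) (h.smooth_b.add contMDiffOn_const) hq v
    have da' := fun v => Paracontact.dirDeriv_add hU h.smooth_b
      (b := fun _ => (1 : ℝ)) contMDiffOn_const hq v
    have dC := fun v => Paracontact.dirDeriv_add hU h.smooth_s
      (b := fun q => (-1) * b q + 1) ((contMDiffOn_const.mul h.smooth_b).add contMDiffOn_const) hq v
    have dC' := fun v => Paracontact.dirDeriv_add hU (a := fun q => (-1) * b q)
      (b := fun _ => (1 : ℝ)) (contMDiffOn_const.mul h.smooth_b) contMDiffOn_const hq v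
    have d1 := fun v : TangentSpace (𝓡 3) q => Paracontact.dirDeriv_const hU (a := fun _ => (1 : ℝ)) 1 (fun _ _ => rfl) hq v
    simp only [dA, dD, da, da', dC, dC', dn, d1] at h2 h3 h4 h5 j1 j2
    refine ⟨?_, ?_, h.bracket_e_φe q hq, ?_, ?_, ?_, ?_, ?_⟩
    · rw [h.bracket_ξ_e q hq]
      module
    · rw [h.bracket_ξ_φe q hq]
      module
    -- The Jacobi identity contains derivatives of A and b along e and φe; the mixed soliton
    -- components eliminate them, here and in the next constraint.
    · linear_combination j1 - h3
    · linear_combination -j2 + h2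
    · rw [dn, Paracontact.dirDeriv_add_vector, Paracontact.dirDeriv_smul_vector]
      linear_combination -h3
    · rw [dn]
      linear_combination -h5
    · rw [h.scalarCurvature_of_soliton hs hq, lam_eq lam hs]
      norm_num
  · rintro ⟨rfl, H⟩ p
    obtain ⟨U, hU, hp, e, hb, ε, hε, a₁, a₃, a₄, a₅, s₁, s₃, s₄, s₅, H⟩ := H p
    have hεε : ε * ε = 1 := by rcases hε with rfl | rfl <;> norm_num
    have h : S.IsAdaptedFrameOn e U (fun q => (-ε) * a₁ q) (fun q => (-1) * a₁ q) a₃ a₄ a₅ :=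
      ⟨hb, hU, contMDiffOn_const.mul s₁, contMDiffOn_const.mul s₁, s₃, s₄, s₅,
        fun q hq => by rw [(H q hq).1]; module, fun q hq => by rw [(H q hq).2.1]; module,
        fun q hq => (H q hq).2.2.1⟩
    obtain ⟨-, -, -, -, -, h3, hξ, hr⟩ := H p hp
    have dA := fun v => Paracontact.dirDeriv_const_mul hU (-ε) s₁ hp v
    have dn := fun v => Paracontact.dirDeriv_const_mul hU (-1) s₁ hp v
    obtain ⟨r1, -, -, -, -, -, -, r8⟩ := h.ricci_eq hp
    rw [Paracontact.dirDeriv_add_vector, Paracontact.dirDeriv_smul_vector] at h3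
    rw [hb.scalarCurvature_eq hp, r1] at hr
    rw [h.soliton_iff hp]
    simp only [dA, dn] at r8 hr ⊢
    refine ⟨?_, ?_, ?_, ?_, ?_, ?_⟩
    · linear_combination (-2) * a₁ p ^ 2 * hεε
    -- With A = εb the two mixed components are ε-multiples of each other, so the single equation
    -- along e + εφe gives both. The same holds for the two equations along ξ.
    · linear_combination (-ε) * h3 + (Paracontact.dirDeriv a₁ (S.φ p (e p)) + 2 * a₁ p * a₄ p) * hεε
    · linear_combination -h3
    · linear_combination (-ε) * hξ + 2 * a₁ p * a₃ p * hεε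
    · linear_combination -hξ
    -- The scalar curvature gives the difference of ϱ(e,e) and ϱ(φe,φe), and `r8` gives their sum;
    -- the half-sum isolates ϱ(e,e).
    · linear_combination (1 / 2) * hr + (1 / 2) * r8 - ε * hξ + (a₁ p ^ 2 + 2 * a₁ p * a₃ p) * hεε
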